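/- Let $*:V(S)\to V(T)$ be a nonstandard embedding of superstructures (over base sets $S$ and $T={}^*S$, with $\mathbb Z\subset S$) that satisfies the Transfer Principle for bounded formulas and countable saturation. An element of a set ${}^*C$, $C\in V(S)$ a set, is called *internal*; an element of ${}^*\mathcal P_{\rm fin}(A)$, $A\in V(S)$ a set, is called *hyperfinite*. An *internal Dedekind ring* is an internal ring $B$ that satisfies the transferred definition of a Dedekind domain, i.e. $(B,+,\cdot)\in{}^*\mathcal D$ for some set $\mathcal D\in V(S)$ of Dedekind domains (fields are allowed). Let $L$ be the quotient field of $B$. Let $\mathcal M$ be the set of nonzero internal maximal ideals of $B$, let $\mathcal L={}^*\mathcal P_{\rm fin}(\mathcal M)$ be the lattice of hyperfinite subsets of $\mathcal M$, and let ${}^*\bigoplus_{\mathcal M}{}^*\mathbb Z$ be the group of internal functions $\mathcal M\to{}^*\mathbb Z$ that vanish outside a hyperfinite subset of $\mathcal M$. A maximal filter on $\mathcal L$ is a maximal element of the set of all nonempty filters $\mathcal F\subsetneq\mathcal L$. For such an $\mathcal F$, let $({}^*\bigoplus_{\mathcal M}{}^*\mathbb Z)/\mathcal F$ be the quotient group in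 which two functions are identified if they agree on some $H\in\mathcal F$, ordered by $[d]\le[e]$ iff $d\le e$ on some $H\in\mathcal F$. For $0\ne a\in B$ let $\operatorname{div}(a)\in{}^*\bigoplus_{\mathcal M}{}^*\mathbb Z$ be the function $\mathfrak p\mapsto v_{\mathfrak p}(a)$, where $v_{\mathfrak p}(a)$ is the $n\in{}^*\mathbb N$ with $a\in\mathfrak p^n\setminus\mathfrak p^{n+1}$ (internal powers). Then the following three sets are in bijection: 1. the nonzero prime ideals $\mathfrak p$ of $B$ (internal or external); 2. the equivalence classes of nontrivial valuations $v$ of $L$ (with arbitrary value group) with $v(B)\ge 0$; 3. the pairs $(\mathcal F,U)$, where $\mathcal F$ is a maximal filter on the lattice $\mathcal L$ and $U$ is a proper convex subgroup of $({}^*\bigoplus_{\mathcal M}{}^*\mathbb Z)/\mathcal F$. More precisely, there is a bijection from (1) to (2) which maps $\mathfrak p$ to the class of valuations $v$ with valuation ring $B_{\mathfrak p}$, with $\mathfrak p=\{a\in B: v(a)>0\}$; and there is a bijection from (3) to (1) which maps $(\mathcal F,U)$ to $\{a\in B: a=0 \text{ or } [\operatorname{div}(a)]>u \text{ for all } u\in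 U\}$. -/

import Mathlib

universe u w

noncomputable section

namespace Nonstandard

/-! ## Superstructures and nonstandard embeddings -/

/-- The `n`-th level `V_n(S)` of the superstructure over the base set `S`:
`V_0(S) = S` and `V_{n+1}(S) = V_n(S) ∪ 𝒫(V_n(S))`. -/
def level (S : ZFSet.{u}) : ℕ → ZFSet.{u}
  | 0 => S
  | n + 1 => level S n ∪ (level S n).powerset

/-- `x` is an entity of the superstructure `V(S) = ⋃ₙ V_n(S)`. -/
def InSuper (S x : ZFSet.{u}) : Prop := ∃ n, x ∈ level S n

/-- `S` is a base set: its elements are individuals, that is, they are nonempty and no element of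
an individual is an entity of the superstructure. -/
def IsBaseSet (S : ZFSet.{u}) : Prop :=
  ∅ ∉ S ∧ ∀ x ∈ S, ∀ y ∈ x, ¬ InSuper S y

/-- `A` is a set (and not an individual) of the superstructure over `S`. -/
def IsSetIn (S A : ZFSet.{u}) : Prop := InSuper S A ∧ A ∉ S

/-- Bounded (`Δ₀`) formulas of the language of set theory; variables are de Bruijn indices and
`ball j φ` is the bounded quantifier `∀ x ∈ x_j, φ`. -/
inductive BFormula : Type
  | mem (i j : ℕ) : BFormula
  | eq (i j : ℕ) : BFormula
  | neg (φ : BFormula) : BFormula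
  | and (φ ψ : BFormula) : BFormula
  | ball (j : ℕ) (φ : BFormula) : BFormula

/-- The value of the `i`-th variable (variables without an assigned value denote `∅`). -/
def val (l : List ZFSet.{u}) (i : ℕ) : ZFSet.{u} := l.getD i ∅

/-- Truth of a bounded formula in the superstructure over `S`, at the list `l` of values of the
variables. -/
def Holds (S : ZFSet.{u}) : BFormula → List ZFSet.{u} → Prop
  | .mem i j, l => val l i ∈ val l j
  | .eq i j, l => val l i = val l j
  | .neg φ, l => ¬ Holds S φ l
  | .and φ ψ, l => Holds S φ l ∧ Holds S ψ l
  | .ball j φ, l => ∀ x, InSuper S x → x ∈ val l j → Holds S φ (x :: l)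

/-- A countably saturated nonstandard embedding `* : V(S) → V(T)` of superstructures, where the
base set `S` contains a copy of the integers (as individuals). -/
structure NonstandardEmbedding (S T : ZFSet.{u}) where
  isBaseSet_source : IsBaseSet S
  isBaseSet_target : IsBaseSet T
  /-- the embedding `*` (only its values on `V(S)` matter) -/
  star : ZFSet.{u} → ZFSet.{u}
  inSuper_star : ∀ x, InSuper S x → InSuper T (star x)
  star_base : star S = T
  /-- the Transfer Principle -/
  transfer : ∀ (φ : BFormula) (l : List ZFSet.{u}), (∀ x ∈ l, InSuper S x) →
    (Holds S φ l ↔ Holds T φ (l.map star))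
  /-- Countable Saturation: a sequence of internal sets with the finite intersection property has
  a common element -/
  saturated : ∀ A : ℕ → ZFSet.{u},
    (∀ n, A n ∉ T ∧ ∃ C, IsSetIn S C ∧ A n ∈ star C) →
    (∀ n, ∃ x, ∀ k ≤ n, x ∈ A k) → ∃ x, ∀ k, x ∈ A k
  /-- the copy of the integers inside the base set -/
  int : ℤ → ZFSet.{u}
  int_mem : ∀ n, int n ∈ S
  int_injective : Function.Injective int

/-! ### Basic facts on superstructures -/

section Super

variable {S : ZFSet.{u}}

theorem level_mono_succ (n : ℕ) : level S n ⊆ level S (n + 1) := by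
  intro x hx
  simp [level, hx]

theorem level_mono {m n : ℕ} (h : m ≤ n) : level S m ⊆ level S n := by
  induction n, h using Nat.le_induction with
  | base => exact fun _ h => h
  | succ n _ ih => exact fun x hx => level_mono_succ n (ih hx)

theorem mem_level_of_mem (hS : IsBaseSet S) {n : ℕ} {x y : ZFSet.{u}} (hx : x ∈ level S n)
    (hy : y ∈ x) (hyS : InSuper S y) : y ∈ level S n := by
  induction n with
  | zero => exact absurd hyS (hS.2 x hx y hy)
  | succ n ih =>
    simp only [level, ZFSet.mem_union, ZFSet.mem_powerset] at hx
    rcases hx with hx | hx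
    · exact level_mono_succ n (ih hx)
    · exact level_mono_succ n (hx hy)

theorem exists_subset_level {A : ZFSet.{u}} (hA : IsSetIn S A) : ∃ n, A ⊆ level S n := by
  obtain ⟨⟨n, hn⟩, h⟩ := hA
  induction n with
  | zero => exact absurd hn h
  | succ n ih =>
    simp only [level, ZFSet.mem_union, ZFSet.mem_powerset] at hn
    rcases hn with hn | hn
    · exact ih hn
    · exact ⟨n, hn⟩

theorem IsSetIn.inSuper_of_mem {A x : ZFSet.{u}} (hA : IsSetIn S A) (hx : x ∈ A) :
    InSuper S x := by
  obtain ⟨n, hn⟩ := exists_subset_level hA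
  exact ⟨n, hn hx⟩

theorem isSetIn_of_subset_level (hS : IsBaseSet S) {n : ℕ} {A : ZFSet.{u}}
    (h : A ⊆ level S n) : IsSetIn S A := by
  refine ⟨⟨n + 1, by simp [level, h]⟩, fun hA => ?_⟩
  have h0 : A ≠ ∅ := fun h0 => hS.1 (h0 ▸ hA)
  obtain ⟨y, hy⟩ := (ZFSet.eq_empty_or_nonempty A).resolve_left h0
  exact hS.2 A hA y hy ⟨n, h hy⟩

theorem isSetIn_level (hS : IsBaseSet S) (n : ℕ) : IsSetIn S (level S n) :=
  isSetIn_of_subset_level hS (fun _ h => h)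

theorem IsSetIn.subset (hS : IsBaseSet S) {A C : ZFSet.{u}} (hA : IsSetIn S A) (h : C ⊆ A) :
    IsSetIn S C := by
  obtain ⟨n, hn⟩ := exists_subset_level hA
  exact isSetIn_of_subset_level hS (n := n) (fun x hx => hn (h hx))

theorem IsSetIn.powerset (hS : IsBaseSet S) {A : ZFSet.{u}} (hA : IsSetIn S A) :
    IsSetIn S A.powerset := by
  obtain ⟨n, hn⟩ := exists_subset_level hA
  refine isSetIn_of_subset_level hS (n := n + 1) (fun x hx => ?_)
  simp only [level, ZFSet.mem_union, ZFSet.mem_powerset] at hx ⊢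
  exact Or.inr (fun y hy => hn (hx hy))

theorem IsSetIn.union (hS : IsBaseSet S) {A C : ZFSet.{u}} (hA : IsSetIn S A)
    (hC : IsSetIn S C) : IsSetIn S (A ∪ C) := by
  obtain ⟨n, hn⟩ := exists_subset_level hA
  obtain ⟨m, hm⟩ := exists_subset_level hC
  refine isSetIn_of_subset_level hS (n := max n m) (fun x hx => ?_)
  rcases ZFSet.mem_union.1 hx with hx | hx
  · exact level_mono (le_max_left _ _) (hn hx)
  · exact level_mono (le_max_right _ _) (hm hx)

theorem IsSetIn.insert_singleton (hS : IsBaseSet S) {x y : ZFSet.{u}} (hx : InSuper S x)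
    (hy : InSuper S y) : IsSetIn S {x, y} := by
  obtain ⟨n, hn⟩ := hx
  obtain ⟨m, hm⟩ := hy
  refine isSetIn_of_subset_level hS (n := max n m) (fun z hz => ?_)
  simp only [ZFSet.mem_pair] at hz
  rcases hz with rfl | rfl
  · exact level_mono (le_max_left _ _) hn
  · exact level_mono (le_max_right _ _) hm

theorem IsSetIn.singleton (hS : IsBaseSet S) {x : ZFSet.{u}} (hx : InSuper S x) :
    IsSetIn S {x} := by
  obtain ⟨n, hn⟩ := hx
  refine isSetIn_of_subset_level hS (n := n) (fun z hz => ?_)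
  rw [ZFSet.mem_singleton.1 hz]
  exact hn

theorem InSuper.pair (hS : IsBaseSet S) {x y : ZFSet.{u}} (hx : InSuper S x)
    (hy : InSuper S y) : InSuper S (ZFSet.pair x y) :=
  (IsSetIn.insert_singleton hS (IsSetIn.singleton hS hx).1
    (IsSetIn.insert_singleton hS hx hy).1).1

theorem IsSetIn.prod (hS : IsBaseSet S) {A C : ZFSet.{u}} (hA : IsSetIn S A)
    (hC : IsSetIn S C) : IsSetIn S (A.prod C) := by
  refine ((hA.union hS hC).powerset hS |>.powerset hS).subset hS ?_
  intro z hz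
  unfold ZFSet.prod ZFSet.pairSep at hz
  exact (ZFSet.mem_sep.1 hz).1

theorem isSetIn_empty (hS : IsBaseSet S) : IsSetIn S ∅ :=
  isSetIn_of_subset_level hS (n := 0) (fun x hx => absurd hx (ZFSet.notMem_empty x))

theorem inSuper_val (hS : IsBaseSet S) {l : List ZFSet.{u}} (hl : ∀ x ∈ l, InSuper S x) (i : ℕ) :
    InSuper S (val l i) := by
  unfold val
  rcases lt_or_ge i l.length with h | h
  · rw [List.getD_eq_getElem _ _ h]
    exact hl _ (List.getElem_mem h)
  · rw [List.getD_eq_default _ _ h]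
    exact (isSetIn_empty hS).1

end Super

/-! ### Bounded formulas for ordered pairs and triples -/

namespace BFormula

/-- disjunction -/
def or (φ ψ : BFormula) : BFormula := neg (and (neg φ) (neg ψ))

/-- implication -/
def imp (φ ψ : BFormula) : BFormula := neg (and φ (neg ψ))

/-- bounded existential quantifier `∃ x ∈ x_j, φ` -/
def bex (j : ℕ) (φ : BFormula) : BFormula := neg (ball j (neg φ))

/-- `x_c = {x_i, x_j}` -/
def upair (c i j : ℕ) : BFormula :=
  and (mem i c) (and (mem j c) (ball c (or (eq 0 (i + 1)) (eq 0 (j + 1)))))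

/-- `x_p = (x_i, x_j)` -/
def pair (p i j : ℕ) : BFormula :=
  and (bex p (upair 0 (i + 1) (i + 1)))
    (and (bex p (upair 0 (i + 1) (j + 1)))
      (ball p (or (upair 0 (i + 1) (i + 1)) (upair 0 (i + 1) (j + 1)))))

/-- `(x_i, x_j) ∈ x_a` -/
def mem2 (i j a : ℕ) : BFormula := bex a (pair 0 (i + 1) (j + 1))

/-- `((x_i, x_j), x_k) ∈ x_a` -/
def mem3 (i j k a : ℕ) : BFormula :=
  bex a (bex 0 (bex 0 (and (pair 0 (i + 3) (j + 3)) (pair 2 0 (k + 3)))))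

/-- renaming of the free variables -/
def rename (f : ℕ → ℕ) : BFormula → BFormula
  | mem i j => mem (f i) (f j)
  | eq i j => eq (f i) (f j)
  | neg φ => neg (rename f φ)
  | and φ ψ => and (rename f φ) (rename f ψ)
  | ball j φ => ball (f j) (rename (fun i => Nat.casesOn i 0 (fun i => f i + 1)) φ)

/-- `k` universal quantifiers, all bounded by the same variable `x_j` -/
def ballN (j : ℕ) : ℕ → BFormula → BFormula
  | 0, φ => φ
  | k + 1, φ => ball j (ballN (j + 1) k φ)

end BFormula

section Holds

variable {S : ZFSet.{u}} {l : List ZFSet.{u}}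

@[simp] theorem val_cons_zero (x : ZFSet.{u}) : val (x :: l) 0 = x := rfl

@[simp] theorem val_cons_succ (x : ZFSet.{u}) (i : ℕ) : val (x :: l) (i + 1) = val l i := by
  simp [val]

@[simp] theorem val_cons_ofNat (x : ZFSet.{u}) (i : ℕ) [i.AtLeastTwo] :
    val (x :: l) (no_index (OfNat.ofNat i)) = val l (i - 1) := by
  obtain ⟨k, rfl⟩ : ∃ k, i = k + 1 := ⟨i - 1, by have := Nat.AtLeastTwo.prop (n := i); omega⟩
  exact val_cons_succ x k

@[simp] theorem val_cons_one (x : ZFSet.{u}) : val (x :: l) 1 = val l 0 := val_cons_succ x 0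

@[simp] theorem holds_mem (i j : ℕ) : Holds S (.mem i j) l ↔ val l i ∈ val l j := Iff.rfl
@[simp] theorem holds_eq (i j : ℕ) : Holds S (.eq i j) l ↔ val l i = val l j := Iff.rfl
@[simp] theorem holds_neg (φ : BFormula) : Holds S (.neg φ) l ↔ ¬ Holds S φ l := Iff.rfl
@[simp] theorem holds_and (φ ψ : BFormula) :
    Holds S (.and φ ψ) l ↔ Holds S φ l ∧ Holds S ψ l := Iff.rfl
@[simp] theorem holds_ball (j : ℕ) (φ : BFormula) :
    Holds S (.ball j φ) l ↔ ∀ x, InSuper S x → x ∈ val l j → Holds S φ (x :: l) := Iff.rfl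
@[simp] theorem holds_or (φ ψ : BFormula) :
    Holds S (.or φ ψ) l ↔ Holds S φ l ∨ Holds S ψ l := by
  simp only [BFormula.or, holds_neg, holds_and]; tauto
@[simp] theorem holds_imp (φ ψ : BFormula) :
    Holds S (.imp φ ψ) l ↔ (Holds S φ l → Holds S ψ l) := by
  simp only [BFormula.imp, holds_neg, holds_and]; tauto
@[simp] theorem holds_bex (j : ℕ) (φ : BFormula) :
    Holds S (.bex j φ) l ↔ ∃ x, InSuper S x ∧ x ∈ val l j ∧ Holds S φ (x :: l) := by
  simp only [BFormula.bex, holds_neg, holds_ball]; push Not; rfl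

theorem holds_upair (hS : IsBaseSet S) (hl : ∀ x ∈ l, InSuper S x) (c i j : ℕ) :
    Holds S (.upair c i j) l ↔ val l c = {val l i, val l j} := by
  simp only [BFormula.upair, holds_and, holds_mem, holds_ball, holds_or, holds_eq, val_cons_zero,
    val_cons_succ]
  constructor
  · rintro ⟨hi, hj, h⟩
    have hc : IsSetIn S (val l c) :=
      ⟨inSuper_val hS hl c, fun hc => hS.2 _ hc _ hi (inSuper_val hS hl i)⟩
    ext y
    rw [ZFSet.mem_pair]
    refine ⟨fun hy => h y (hc.inSuper_of_mem hy) hy, ?_⟩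
    rintro (rfl | rfl) <;> assumption
  · intro h
    rw [h]
    simp

theorem holds_pair (hS : IsBaseSet S) (hl : ∀ x ∈ l, InSuper S x) (p i j : ℕ) :
    Holds S (.pair p i j) l ↔ val l p = ZFSet.pair (val l i) (val l j) := by
  have key : ∀ x, InSuper S x → ∀ i j, Holds S (.upair 0 (i + 1) (j + 1)) (x :: l) ↔
      x = {val l i, val l j} := fun x hx i j => by
    rw [holds_upair hS (by simpa using ⟨hx, hl⟩)]
    simp
  have h1 : ∀ i j, InSuper S {val l i, val l j} := fun i j =>
    (IsSetIn.insert_singleton hS (inSuper_val hS hl i) (inSuper_val hS hl j)).1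
  have h2 : ({val l i, val l i} : ZFSet) = {val l i} := by ext; simp
  have h3 := h1 i i
  rw [h2] at h3
  simp only [BFormula.pair, holds_and, holds_bex, holds_ball, holds_or]
  constructor
  · rintro ⟨⟨x, hx, hxp, hx'⟩, ⟨y, hy, hyp, hy'⟩, h⟩
    rw [key x hx, h2] at hx'
    rw [key y hy] at hy'
    subst hx' hy'
    have hc : IsSetIn S (val l p) := ⟨inSuper_val hS hl p, fun hc => hS.2 _ hc _ hxp hx⟩
    ext z
    rw [ZFSet.pair, ZFSet.mem_pair]
    constructor
    · intro hz
      have hz' := hc.inSuper_of_mem hz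
      have := h z hz' hz
      rwa [key z hz', key z hz', h2] at this
    · rintro (rfl | rfl) <;> assumption
  · intro h
    rw [h]
    refine ⟨⟨_, h3, by simp [ZFSet.pair], ?_⟩, ⟨_, h1 i j, by simp [ZFSet.pair], ?_⟩, ?_⟩
    · rw [key _ h3, h2]
    · rw [key _ (h1 i j)]
    · intro x hx hx'
      rw [key x hx, key x hx, h2]
      simpa [ZFSet.pair] using hx'

theorem holds_mem2 (hS : IsBaseSet S) (hl : ∀ x ∈ l, InSuper S x) (i j a : ℕ) :
    Holds S (.mem2 i j a) l ↔ ZFSet.pair (val l i) (val l j) ∈ val l a := by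
  have hv := inSuper_val hS hl
  simp only [BFormula.mem2, holds_bex]
  constructor
  · rintro ⟨x, hx, hxa, h⟩
    rw [holds_pair hS (by simpa using ⟨hx, hl⟩)] at h
    simp only [val_cons_zero, val_cons_succ] at h
    rwa [← h]
  · intro h
    have hx := InSuper.pair hS (hv i) (hv j)
    refine ⟨_, hx, h, ?_⟩
    rw [holds_pair hS (by simpa using ⟨hx, hl⟩)]
    simp

theorem holds_mem3 (hS : IsBaseSet S) (hl : ∀ x ∈ l, InSuper S x) (i j k a : ℕ) :
    Holds S (.mem3 i j k a) l ↔
      ZFSet.pair (ZFSet.pair (val l i) (val l j)) (val l k) ∈ val l a := by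
  have hv := inSuper_val hS hl
  simp only [BFormula.mem3, holds_bex, holds_and]
  constructor
  · rintro ⟨p, hp, hpa, c, hc, hcp, q, hq, hqc, h1, h2⟩
    rw [holds_pair hS (by simpa using ⟨hq, hc, hp, hl⟩)] at h1 h2
    simp only [val_cons_zero, val_cons_succ] at h1 h2
    rwa [← h1, ← h2]
  · intro h
    have hq := InSuper.pair hS (hv i) (hv j)
    have hp := InSuper.pair hS hq (hv k)
    have hc := (IsSetIn.singleton hS hq).1
    refine ⟨_, hp, h, _, hc, by simp [ZFSet.pair], _, hq, by simp, ?_⟩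
    rw [holds_pair hS (by simpa using ⟨hq, hc, hp, hl⟩),
      holds_pair hS (by simpa using ⟨hq, hc, hp, hl⟩)]
    simp

theorem holds_rename (φ : BFormula) (f : ℕ → ℕ) (l l' : List ZFSet.{u})
    (h : ∀ i, val l' (f i) = val l i) : Holds S (φ.rename f) l' ↔ Holds S φ l := by
  induction φ generalizing f l l' with
  | mem i j => simp [BFormula.rename, h]
  | eq i j => simp [BFormula.rename, h]
  | neg φ ih => simp only [BFormula.rename, holds_neg, ih f l l' h]
  | and φ ψ ih1 ih2 => simp only [BFormula.rename, holds_and, ih1 f l l' h, ih2 f l l' h]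
  | ball j φ ih =>
    simp only [BFormula.rename, holds_ball, h]
    refine forall_congr' fun x => imp_congr_right fun _ => imp_congr_right fun _ => ?_
    refine ih _ _ _ fun i => ?_
    cases i with
    | zero => simp
    | succ i => simp [h]

theorem holds_ballN (φ : BFormula) (j k : ℕ) (l : List ZFSet.{u}) :
    Holds S (.ballN j k φ) l ↔ ∀ q : List ZFSet.{u}, q.length = k →
      (∀ x ∈ q, InSuper S x ∧ x ∈ val l j) → Holds S φ (q.reverse ++ l) := by
  induction k generalizing j l with
  | zero =>
    simp only [BFormula.ballN]
    constructor
    · intro h q hq _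
      rw [List.length_eq_zero_iff] at hq
      subst hq
      simpa using h
    · intro h
      simpa using h [] rfl (by simp)
  | succ k ih =>
    simp only [BFormula.ballN, holds_ball, ih, val_cons_succ]
    constructor
    · intro h q hq hq'
      match q, hq with
      | x :: q, hq =>
        have := h x (hq' x (by simp)).1 (hq' x (by simp)).2 q (by simpa using hq)
          (fun y hy => hq' y (by simp [hy]))
        simpa using this
    · intro h x hx hxj q hq hq'
      have := h (x :: q) (by simpa using hq) (by
        intro y hy
        rcases List.mem_cons.1 hy with rfl | hy
        · exact ⟨hx, hxj⟩
        · exact hq' y hy)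
      simpa using this

end Holds

/-! ### Internal entities -/

namespace NonstandardEmbedding

variable {S T : ZFSet.{u}} (E : NonstandardEmbedding S T)

/-- Internal entities: the elements of the sets `*C`, for sets `C` of the superstructure. -/
def Internal (x : ZFSet.{u}) : Prop := ∃ C, IsSetIn S C ∧ x ∈ E.star C

/-- Hyperfinite sets: the elements of `*𝒫_fin(A)`, for sets `A` of the superstructure. -/
def Hyperfinite (x : ZFSet.{u}) : Prop :=
  ∃ A, IsSetIn S A ∧ x ∈ E.star (A.powerset.sep fun y => (y : Set ZFSet.{u}).Finite)

theorem inSuper_base (hS : IsBaseSet S) : InSuper S S :=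
  (isSetIn_level hS 0).1

variable {E}

theorem star_mem_star {x y : ZFSet.{u}} (hx : InSuper S x) (hy : InSuper S y) :
    E.star x ∈ E.star y ↔ x ∈ y := by
  have := E.transfer (.mem 0 1) [x, y] (by simp [hx, hy])
  simpa using this.symm

theorem isSetIn_star {A : ZFSet.{u}} (hA : IsSetIn S A) : IsSetIn T (E.star A) := by
  refine ⟨E.inSuper_star A hA.1, fun h => hA.2 ?_⟩
  rw [← star_mem_star (E := E) hA.1 (inSuper_base E.isBaseSet_source)]
  exact E.star_base.symm ▸ h

theorem star_subset_star {A C : ZFSet.{u}} (hA : IsSetIn S A) (hC : IsSetIn S C) (h : A ⊆ C) :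
    E.star A ⊆ E.star C := by
  have := E.transfer (.ball 0 (.mem 0 2)) [A, C] (by simp [hA.1, hC.1])
  simp only [holds_ball, holds_mem, List.map, val_cons_zero, val_cons_ofNat, val_cons_one,
    Nat.reduceSub] at this
  exact fun x hx => this.1 (fun x _ hx => h hx) x ((isSetIn_star hA).inSuper_of_mem hx) hx

theorem star_empty : E.star ∅ = ∅ := by
  have h0 := isSetIn_empty E.isBaseSet_source
  have := E.transfer (.ball 0 (.neg (.eq 0 0))) [∅] (by simp [h0.1])
  simp only [holds_ball, holds_neg, holds_eq, not_true, List.map, val_cons_zero] at this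
  refine (ZFSet.eq_empty _).2 fun y hy => ?_
  exact this.1 (fun x _ hx => ZFSet.notMem_empty x hx) y
    ((isSetIn_star h0).inSuper_of_mem hy) hy

theorem Internal.inSuper {x : ZFSet.{u}} (h : E.Internal x) : InSuper T x := by
  obtain ⟨C, hC, hx⟩ := h
  exact (isSetIn_star hC).inSuper_of_mem hx

theorem internal_star {A : ZFSet.{u}} (hA : InSuper S A) : E.Internal (E.star A) := by
  have h := IsSetIn.singleton E.isBaseSet_source hA
  exact ⟨{A}, h, (star_mem_star hA h.1).2 (by simp)⟩

theorem internal_iff_level {x : ZFSet.{u}} :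
    E.Internal x ↔ ∃ n, x ∈ E.star (level S n) := by
  constructor
  · rintro ⟨C, hC, hx⟩
    obtain ⟨n, hn⟩ := exists_subset_level hC
    exact ⟨n, star_subset_star hC (isSetIn_level E.isBaseSet_source n) hn hx⟩
  · rintro ⟨n, hn⟩
    exact ⟨_, isSetIn_level E.isBaseSet_source n, hn⟩

theorem mem_star_level_of_mem {x y : ZFSet.{u}} {n : ℕ} (hx : x ∈ E.star (level S n))
    (hy : y ∈ x) (hyT : InSuper T y) : y ∈ E.star (level S n) := by
  have h := isSetIn_level E.isBaseSet_source n
  have := E.transfer (.ball 0 (.ball 0 (.mem 0 2))) [level S n] (by simp [h.1])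
  simp only [holds_ball, holds_mem, List.map, val_cons_zero, val_cons_ofNat, val_cons_one,
    Nat.reduceSub] at this
  exact this.1 (fun x _ hx y hy hyx => mem_level_of_mem E.isBaseSet_source hx hyx hy) x
    ((isSetIn_star h).inSuper_of_mem hx) hx y hyT hy

theorem Internal.mem {x y : ZFSet.{u}} (h : E.Internal x) (hx : x ∉ T) (hy : y ∈ x) :
    E.Internal y := by
  have hyT : InSuper T y := IsSetIn.inSuper_of_mem ⟨h.inSuper, hx⟩ hy
  obtain ⟨n, hn⟩ := internal_iff_level.1 h
  exact internal_iff_level.2 ⟨n, mem_star_level_of_mem hn hy hyT⟩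

/-- An internal subset of `*A` belongs to `*𝒫(A)`. -/
theorem Internal.mem_star_powerset {x A : ZFSet.{u}} (h : E.Internal x) (hx : x ∉ T)
    (hA : IsSetIn S A) (hxA : x ⊆ E.star A) : x ∈ E.star A.powerset := by
  obtain ⟨C, hC, hxC⟩ := h
  have hP := hA.powerset E.isBaseSet_source
  have := E.transfer (.ball 0 (.imp (.and (.neg (.mem 0 4)) (.ball 0 (.mem 0 3))) (.mem 0 3)))
    [C, A, A.powerset, S]
    (by simp [hC.1, hA.1, hP.1, inSuper_base E.isBaseSet_source])
  simp only [holds_ball, holds_mem, holds_imp, holds_and, holds_neg, List.map, val_cons_zero,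
    val_cons_ofNat, val_cons_one, Nat.reduceSub, E.star_base] at this
  refine this.1 ?_ x ((isSetIn_star hC).inSuper_of_mem hxC) hxC ⟨hx, fun y _ hy => hxA hy⟩
  rintro c hc - ⟨hcS, h⟩
  rw [ZFSet.mem_powerset]
  exact fun y hy => h y (IsSetIn.inSuper_of_mem ⟨hc, hcS⟩ hy) hy

/-- The Internal Definition Principle. -/
theorem internal_sep (φ : BFormula) {A : ZFSet.{u}} (hA : IsSetIn S A) (p : List ZFSet.{u})
    (hp : ∀ x ∈ p, E.Internal x) :
    E.Internal ((E.star A).sep fun x => Holds T φ (x :: p)) := by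
  have hS := E.isBaseSet_source
  have hT := E.isBaseSet_target
  -- a common level for the parameters
  obtain ⟨n, hn⟩ : ∃ n, ∀ x ∈ p, x ∈ E.star (level S n) := by
    clear φ
    induction p with
    | nil => exact ⟨0, by simp⟩
    | cons a p ih =>
      obtain ⟨n, hn⟩ := ih fun x hx => hp x (by simp [hx])
      obtain ⟨m, hm⟩ := internal_iff_level.1 (hp a (by simp))
      have hle : ∀ i ≤ max m n, E.star (level S i) ⊆ E.star (level S (max m n)) := fun i hi =>
        star_subset_star (isSetIn_level hS _) (isSetIn_level hS _) (level_mono hi)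
      refine ⟨max m n, fun x hx => ?_⟩
      rcases List.mem_cons.1 hx with rfl | hx
      · exact hle m (le_max_left _ _) hm
      · exact hle n (le_max_right _ _) (hn x hx)
  set N := level S n
  have hN : IsSetIn S N := isSetIn_level hS n
  have hP := hA.powerset hS
  set k := p.length with hk
  -- variables: `x, b, (parameters), N, A, 𝒫(A)`
  let f : ℕ → ℕ := fun i => Nat.casesOn i 0 (fun i => if i < k then i + 2 else i + k + 10)
  let ψ : BFormula := .and
    (.imp (.mem 0 1) (φ.rename f)) (.imp (φ.rename f) (.mem 0 1))
  let χ : BFormula := .ballN 0 k (.bex (k + 2) (.ball (k + 2) ψ))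
  have hval : ∀ (x b : ZFSet.{u}) (q l : List ZFSet.{u}), q.length = k → l.length = 3 → ∀ i,
      val (x :: b :: (q ++ l)) (f i) = val (x :: q) i := by
    intro x b q l hq hl i
    cases i with
    | zero => rfl
    | succ i =>
      simp only [f, val_cons_succ]
      split_ifs with h
      · simp [val, List.getElem?_append_left (hq ▸ h)]
      · push Not at h
        have h1 : val q i = ∅ := by
          unfold val
          exact List.getD_eq_default _ _ (by omega)
        have h2 : val (x :: b :: (q ++ l)) (i + k + 10) = ∅ := by
          unfold val
          exact List.getD_eq_default _ _ (by simp; omega)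
        rw [h1, h2]
  have hA' : ∀ (q : List ZFSet.{u}) (a b c : ZFSet.{u}), q.length = k →
      val (q ++ [a, b, c]) (k + 1) = b ∧ val (q ++ [a, b, c]) (k + 2) = c := by
    intro q a b c hq
    simp [val, ← hq]
  have key := E.transfer χ [N, A, A.powerset] (by simp [hN.1, hA.1, hP.1])
  simp only [χ, List.map, holds_ballN] at key
  have hstd : Holds S χ [N, A, A.powerset] := by
    simp only [χ, holds_ballN]
    intro q hq hqN
    have hq' : q.reverse.length = k := by simp [hq]
    rw [holds_bex, (hA' _ N A A.powerset hq').2]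
    have hb : IsSetIn S (A.sep fun x => Holds S φ (x :: q.reverse)) :=
      hA.subset hS (fun x hx => (ZFSet.mem_sep.1 hx).1)
    refine ⟨A.sep fun x => Holds S φ (x :: q.reverse), hb.1, ?_, ?_⟩
    · rw [ZFSet.mem_powerset]
      exact fun x hx => (ZFSet.mem_sep.1 hx).1
    · rw [holds_ball, val_cons_succ, (hA' _ N A A.powerset hq').1]
      intro x hx hxA
      simp only [ψ, holds_and, holds_imp, holds_mem, val_cons_zero, val_cons_one,
        holds_rename φ f _ _ (hval x _ q.reverse [N, A, A.powerset] hq' rfl), ZFSet.mem_sep]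
      tauto
  have hns := key.1 (by simpa only [χ, holds_ballN] using hstd) p.reverse (by simp [hk]) (by
    intro x hx
    have hx' := hn x (by simpa using hx)
    exact ⟨(isSetIn_star hN).inSuper_of_mem hx', hx'⟩)
  rw [List.reverse_reverse, holds_bex, (hA' p _ _ _ hk.symm).2] at hns
  obtain ⟨b, hb, hbP, h⟩ := hns
  rw [holds_ball, val_cons_succ, (hA' p _ _ _ hk.symm).1] at h
  have hsub : b ⊆ E.star A ∧ b ∉ T := by
    have := E.transfer (.ball 1 (.and (.ball 0 (.mem 0 2)) (.neg (.mem 0 3)))) [A, A.powerset, S]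
      (by simp [hA.1, hP.1, inSuper_base hS])
    simp only [holds_ball, holds_and, holds_neg, holds_mem, List.map, val_cons_zero,
      val_cons_ofNat, val_cons_one, Nat.reduceSub, E.star_base] at this
    have h2 := this.1 (by
      intro x hx hxP
      rw [ZFSet.mem_powerset] at hxP
      exact ⟨fun y _ hy => hxP hy, (hA.subset hS hxP).2⟩) b hb hbP
    exact ⟨fun y hy => h2.1 y (IsSetIn.inSuper_of_mem ⟨hb, h2.2⟩ hy) hy, h2.2⟩
  have hbe : b = (E.star A).sep fun x => Holds T φ (x :: p) := by
    ext x
    rw [ZFSet.mem_sep]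
    have hx' : x ∈ E.star A → (x ∈ b ↔ Holds T φ (x :: p)) := fun hx => by
      have := h x ((isSetIn_star hA).inSuper_of_mem hx) hx
      simp only [ψ, holds_and, holds_imp, holds_mem, val_cons_zero, val_cons_one,
        holds_rename φ f _ _ (hval x b p [E.star N, E.star A, E.star A.powerset] hk.symm rfl)] at this
      exact ⟨this.1, this.2⟩
    exact ⟨fun hx => ⟨hsub.1 hx, (hx' (hsub.1 hx)).1 hx⟩, fun hx => (hx' hx.1).2 hx.2⟩
  rw [← hbe]
  exact ⟨_, hP, hbP⟩

end NonstandardEmbedding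

/-! ### Hyperintegers -/

namespace NonstandardEmbedding

variable {S T : ZFSet.{u}} (E : NonstandardEmbedding S T)

/-- The set of integers, as a set of the superstructure over `S`. -/
def intSet : ZFSet.{u} := ZFSet.range E.int

/-- The graph `{((a, b), a + b)}` of the addition of integers. -/
def intAdd : ZFSet.{u} :=
  ZFSet.range fun p : ℤ × ℤ => ZFSet.pair (ZFSet.pair (E.int p.1) (E.int p.2)) (E.int (p.1 + p.2))

/-- The set `{(a, b) | a ≤ b}` of pairs of integers. -/
def intLE : ZFSet.{u} :=
  ZFSet.range fun p : {p : ℤ × ℤ // p.1 ≤ p.2} => ZFSet.pair (E.int p.1.1) (E.int p.1.2)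

variable {E}

theorem inSuper_int (n : ℤ) : InSuper S (E.int n) := ⟨0, E.int_mem n⟩

theorem isSetIn_intSet : IsSetIn S E.intSet := by
  refine isSetIn_of_subset_level E.isBaseSet_source (n := 0) fun x hx => ?_
  obtain ⟨n, rfl⟩ := ZFSet.mem_range.1 hx
  exact E.int_mem n

theorem int_mem_intSet (n : ℤ) : E.int n ∈ E.intSet :=
  ZFSet.mem_range.2 ⟨n, rfl⟩

theorem isSetIn_intAdd : IsSetIn S E.intAdd := by
  have h := isSetIn_intSet (E := E)
  refine ((h.prod E.isBaseSet_source h).prod E.isBaseSet_source h).subset E.isBaseSet_source ?_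
  intro x hx
  obtain ⟨n, rfl⟩ := ZFSet.mem_range.1 hx
  exact ZFSet.pair_mem_prod.2 ⟨ZFSet.pair_mem_prod.2 ⟨int_mem_intSet _, int_mem_intSet _⟩,
    int_mem_intSet _⟩

theorem mem_intAdd {a b c : ℤ} :
    ZFSet.pair (ZFSet.pair (E.int a) (E.int b)) (E.int c) ∈ E.intAdd ↔ c = a + b := by
  simp only [intAdd, ZFSet.mem_range, Prod.exists, ZFSet.pair_inj, E.int_injective.eq_iff]
  constructor
  · rintro ⟨a, b, ⟨rfl, rfl⟩, rfl⟩
    rfl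
  · rintro rfl
    exact ⟨a, b, ⟨rfl, rfl⟩, rfl⟩

variable (E)

/-- The set `*ℤ` of hyperintegers. -/
@[ext]
structure HyperInt : Type (u + 1) where
  /-- the underlying entity -/
  val : ZFSet.{u}
  mem : val ∈ E.star E.intSet

/-- The sum of the hyperintegers `x` and `y` is `z`, that is, `((x, y), z)` belongs to the
extension of the graph of the addition of integers. -/
def IsSum (x y z : E.HyperInt) : Prop :=
  ZFSet.pair (ZFSet.pair x.val y.val) z.val ∈ E.star E.intAdd

variable {E}

theorem HyperInt.inSuper (x : E.HyperInt) : InSuper T x.1 :=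
  (isSetIn_star isSetIn_intSet).inSuper_of_mem x.2

instance : Zero E.HyperInt :=
  ⟨⟨E.star (E.int 0), (star_mem_star (inSuper_int 0) isSetIn_intSet.1).2 (int_mem_intSet 0)⟩⟩

instance : One E.HyperInt :=
  ⟨⟨E.star (E.int 1), (star_mem_star (inSuper_int 1) isSetIn_intSet.1).2 (int_mem_intSet 1)⟩⟩

instance : LE E.HyperInt := ⟨fun x y => ZFSet.pair x.val y.val ∈ E.star E.intLE⟩

theorem exists_isSum (x y : E.HyperInt) : ∃ z, E.IsSum x y z := by
  have hZ := (isSetIn_intSet (E := E)).1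
  have hA := (isSetIn_intAdd (E := E)).1
  have hl : ∀ x ∈ [E.intSet, E.intAdd], InSuper S x := by simp [hZ, hA]
  have hl' : ∀ x ∈ [E.star E.intSet, E.star E.intAdd], InSuper T x := by
    simp [E.inSuper_star _ hZ, E.inSuper_star _ hA]
  have := (E.transfer (.ball 0 (.ball 1 (.bex 2 (.mem3 2 1 0 4)))) _ hl).1 (by
    rw [holds_ball]
    intro x hx hx'
    rw [holds_ball]
    intro y hy hy'
    rw [holds_bex]
    obtain ⟨a, rfl⟩ := ZFSet.mem_range.1 hx'
    obtain ⟨b, rfl⟩ := ZFSet.mem_range.1 hy'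
    refine ⟨E.int (a + b), inSuper_int _, int_mem_intSet _, ?_⟩
    rw [holds_mem3 E.isBaseSet_source (by simp [hZ, hA, inSuper_int])]
    exact mem_intAdd.2 rfl) x.1 x.inSuper x.2 y.1 y.inSuper y.2
  rw [holds_bex] at this
  obtain ⟨z, hz, hz', h⟩ := this
  rw [holds_mem3 E.isBaseSet_target (by
    simp [E.inSuper_star _ hZ, E.inSuper_star _ hA, x.inSuper, y.inSuper, hz])] at h
  exact ⟨⟨z, hz'⟩, h⟩

/-- A universally quantified Horn-type consequence of addition facts is transferred. -/
theorem transfer_add (k : ℕ) (φ : BFormula)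
    (h : ∀ q : List ℤ, q.length = k →
      Holds S φ (q.map E.int ++ [E.intSet, E.intAdd, E.int 0]))
    (q : List E.HyperInt) (hq : q.length = k) :
    Holds T φ (q.map HyperInt.val ++ [E.star E.intSet, E.star E.intAdd, (0 : E.HyperInt).1]) := by
  have hZ := (isSetIn_intSet (E := E)).1
  have hA := (isSetIn_intAdd (E := E)).1
  have := (E.transfer (.ballN 0 k φ) [E.intSet, E.intAdd, E.int 0]
    (by simp [hZ, hA, inSuper_int])).1 (by
      rw [holds_ballN]
      intro r hr hr'
      obtain ⟨q', rfl⟩ : ∃ q' : List ℤ, q'.map E.int = r := by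
        clear hr
        induction r with
        | nil => exact ⟨[], rfl⟩
        | cons a r ih =>
          obtain ⟨q', rfl⟩ := ih fun x hx => hr' x (by simp [hx])
          obtain ⟨n, rfl⟩ := ZFSet.mem_range.1 (hr' a (by simp)).2
          exact ⟨n :: q', rfl⟩
      rw [← List.map_reverse]
      exact h _ (by simpa using hr))
  rw [holds_ballN] at this
  have := this (q.map HyperInt.val).reverse (by rw [List.length_reverse, List.length_map]; exact hq) (by
    intro x hx
    rw [List.mem_reverse, List.mem_map] at hx
    obtain ⟨y, -, rfl⟩ := hx
    exact ⟨y.inSuper, y.2⟩)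
  rwa [List.reverse_reverse] at this

theorem holds_add (q : List ℤ) (i j k : ℕ) :
    Holds S (.mem3 i j k (q.length + 1)) (q.map E.int ++ [E.intSet, E.intAdd, E.int 0]) ↔
      ZFSet.pair (ZFSet.pair (val (q.map E.int ++ [E.intSet, E.intAdd, E.int 0]) i)
        (val (q.map E.int ++ [E.intSet, E.intAdd, E.int 0]) j))
        (val (q.map E.int ++ [E.intSet, E.intAdd, E.int 0]) k) ∈ E.intAdd := by
  have hZ := (isSetIn_intSet (E := E)).1
  have hA := (isSetIn_intAdd (E := E)).1
  rw [holds_mem3 E.isBaseSet_source]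
  · simp [val]
  · intro x hx
    simp only [List.mem_append, List.mem_map, List.mem_cons, List.not_mem_nil, or_false] at hx
    rcases hx with ⟨n, -, rfl⟩ | rfl | rfl | rfl <;> simp [hZ, hA, inSuper_int]

theorem holds_star_add (q : List E.HyperInt) (i j k : ℕ) :
    Holds T (.mem3 i j k (q.length + 1))
      (q.map HyperInt.val ++ [E.star E.intSet, E.star E.intAdd, (0 : E.HyperInt).1]) ↔
      ZFSet.pair (ZFSet.pair
        (val (q.map HyperInt.val ++ [E.star E.intSet, E.star E.intAdd, (0 : E.HyperInt).1]) i)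
        (val (q.map HyperInt.val ++ [E.star E.intSet, E.star E.intAdd, (0 : E.HyperInt).1]) j))
        (val (q.map HyperInt.val ++ [E.star E.intSet, E.star E.intAdd, (0 : E.HyperInt).1]) k) ∈
        E.star E.intAdd := by
  have hZ := E.inSuper_star _ (isSetIn_intSet (E := E)).1
  have hA := E.inSuper_star _ (isSetIn_intAdd (E := E)).1
  rw [holds_mem3 E.isBaseSet_target]
  · have : val (q.map HyperInt.val ++ [E.star E.intSet, E.star E.intAdd, (0 : E.HyperInt).1])
        (q.length + 1) = E.star E.intAdd := by
      have h1 : (q.map HyperInt.val).length = q.length := by simp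
      rw [← h1, Nonstandard.val, List.getD_append_right _ _ _ _ (by omega)]
      simp
    rw [this]
  · intro x hx
    rw [List.mem_append, List.mem_map] at hx
    simp only [List.mem_cons, List.not_mem_nil, or_false] at hx
    rcases hx with ⟨n, -, rfl⟩ | rfl | rfl | rfl
    · exact n.inSuper
    · exact hZ
    · exact hA
    · exact (0 : E.HyperInt).inSuper

theorem IsSum.unique {x y z w : E.HyperInt} (h1 : E.IsSum x y z) (h2 : E.IsSum x y w) :
    z = w := by
  have h := transfer_add (E := E) 4
    (.imp (.and (.mem3 0 1 2 5) (.mem3 0 1 3 5)) (.eq 2 3)) (by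
      intro q hq
      match q, hq with
      | [a, b, c, d], _ =>
        have h1 := holds_add (E := E) [a, b, c, d] 0 1 2
        have h2 := holds_add (E := E) [a, b, c, d] 0 1 3
        simp only [List.length_cons, List.length_nil] at h1 h2
        rw [holds_imp, holds_and, h1, h2, holds_eq]
        simp [mem_intAdd]
        rintro rfl rfl
        rfl) [x, y, z, w] rfl
  have h3 := holds_star_add [x, y, z, w] 0 1 2
  have h4 := holds_star_add [x, y, z, w] 0 1 3
  simp only [List.length_cons, List.length_nil] at h3 h4
  rw [holds_imp, holds_and, h3, h4] at h
  exact HyperInt.ext (h ⟨h1, h2⟩)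

instance : Add E.HyperInt := ⟨fun x y => (exists_isSum x y).choose⟩

theorem isSum_iff {x y z : E.HyperInt} : E.IsSum x y z ↔ x + y = z :=
  ⟨fun h => IsSum.unique (exists_isSum x y).choose_spec h,
    fun h => h ▸ (exists_isSum x y).choose_spec⟩

theorem HyperInt.add_comm' (x y : E.HyperInt) : x + y = y + x := by
  have h := transfer_add (E := E) 3
    (.imp (.mem3 0 1 2 4) (.mem3 1 0 2 4)) (by
      intro q hq
      match q, hq with
      | [a, b, c], _ =>
        have h1 := holds_add (E := E) [a, b, c] 0 1 2
        have h2 := holds_add (E := E) [a, b, c] 1 0 2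
        simp only [List.length_cons, List.length_nil] at h1 h2
        rw [holds_imp, h1, h2]
        simp [mem_intAdd]
        rintro rfl
        exact add_comm a b) [x, y, x + y] rfl
  have h3 := holds_star_add [x, y, x + y] 0 1 2
  have h4 := holds_star_add [x, y, x + y] 1 0 2
  simp only [List.length_cons, List.length_nil] at h3 h4
  rw [holds_imp, h3, h4] at h
  exact (isSum_iff.1 (h (isSum_iff.2 rfl))).symm

theorem HyperInt.add_assoc' (x y z : E.HyperInt) : x + y + z = x + (y + z) := by
  have h := transfer_add (E := E) 6
    (.imp (.and (.mem3 0 1 3 7) (.and (.mem3 3 2 4 7) (.mem3 1 2 5 7))) (.mem3 0 5 4 7)) (by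
      intro q hq
      match q, hq with
      | [a, b, c, d, e, f], _ =>
        have h1 := holds_add (E := E) [a, b, c, d, e, f] 0 1 3
        have h2 := holds_add (E := E) [a, b, c, d, e, f] 3 2 4
        have h3 := holds_add (E := E) [a, b, c, d, e, f] 1 2 5
        have h4 := holds_add (E := E) [a, b, c, d, e, f] 0 5 4
        simp only [List.length_cons, List.length_nil] at h1 h2 h3 h4
        rw [holds_imp, holds_and, holds_and, h1, h2, h3, h4]
        simp [mem_intAdd]
        rintro rfl rfl rfl
        exact add_assoc a b c) [x, y, z, x + y, x + y + z, y + z] rfl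
  have h1 := holds_star_add [x, y, z, x + y, x + y + z, y + z] 0 1 3
  have h2 := holds_star_add [x, y, z, x + y, x + y + z, y + z] 3 2 4
  have h3 := holds_star_add [x, y, z, x + y, x + y + z, y + z] 1 2 5
  have h4 := holds_star_add [x, y, z, x + y, x + y + z, y + z] 0 5 4
  simp only [List.length_cons, List.length_nil] at h1 h2 h3 h4
  rw [holds_imp, holds_and, holds_and, h1, h2, h3, h4] at h
  exact (isSum_iff.1 (h ⟨isSum_iff.2 rfl, isSum_iff.2 rfl, isSum_iff.2 rfl⟩)).symm

theorem HyperInt.zero_add' (x : E.HyperInt) : 0 + x = x := by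
  have h := transfer_add (E := E) 1 (.mem3 3 0 0 2) (by
      intro q hq
      match q, hq with
      | [a], _ =>
        have h1 := holds_add (E := E) [a] 3 0 0
        simp only [List.length_cons, List.length_nil] at h1
        rw [h1]
        simp [mem_intAdd]) [x] rfl
  have h1 := holds_star_add [x] 3 0 0
  simp only [List.length_cons, List.length_nil] at h1
  rw [h1] at h
  exact isSum_iff.1 h

theorem HyperInt.exists_neg (x : E.HyperInt) : ∃ y, y + x = 0 := by
  have hZ := E.inSuper_star _ (isSetIn_intSet (E := E)).1
  have hA := E.inSuper_star _ (isSetIn_intAdd (E := E)).1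
  have h := transfer_add (E := E) 1 (.bex 1 (.mem3 0 1 4 3)) (by
      intro q hq
      match q, hq with
      | [a], _ =>
        rw [holds_bex]
        refine ⟨E.int (-a), inSuper_int _, int_mem_intSet _, ?_⟩
        have h1 := holds_add (E := E) [-a, a] 0 1 4
        simp only [List.length_cons, List.length_nil] at h1
        exact h1.2 (mem_intAdd.2 (by simp))) [x] rfl
  rw [holds_bex] at h
  obtain ⟨y, -, hy, h⟩ := h
  refine ⟨⟨y, hy⟩, ?_⟩
  have h1 := holds_star_add [⟨y, hy⟩, x] 0 1 4
  simp only [List.length_cons, List.length_nil] at h1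
  exact isSum_iff.1 (h1.1 h)

instance : Neg E.HyperInt := ⟨fun x => x.exists_neg.choose⟩

instance : AddCommGroup E.HyperInt where
  toAddGroup := AddGroup.ofLeftAxioms HyperInt.add_assoc' HyperInt.zero_add'
    fun x => x.exists_neg.choose_spec
  add_comm := HyperInt.add_comm'

/-! ### Hyperfinite sets -/

theorem isSetIn_fin (hS : IsBaseSet S) {A : ZFSet.{u}} (hA : IsSetIn S A) :
    IsSetIn S (A.powerset.sep fun y => (y : Set ZFSet.{u}).Finite) :=
  (hA.powerset hS).subset hS
    (fun _ hx => (ZFSet.mem_sep.1 hx).1)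

theorem hyperfinite_empty : E.Hyperfinite ∅ := by
  have h0 := isSetIn_empty E.isBaseSet_source
  refine ⟨∅, h0, ?_⟩
  have := (star_mem_star (E := E) h0.1 (isSetIn_fin E.isBaseSet_source h0).1).2
    (ZFSet.mem_sep.2 ⟨by simp, by simp⟩)
  rwa [star_empty] at this

theorem Hyperfinite.union {x y : ZFSet.{u}} (hx : E.Hyperfinite x) (hy : E.Hyperfinite y) :
    E.Hyperfinite (x ∪ y) := by
  obtain ⟨A, hA, hxA⟩ := hx
  obtain ⟨C, hC, hyC⟩ := hy
  have hS := E.isBaseSet_source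
  have hAC := hA.union hS hC
  have hF1 := isSetIn_fin E.isBaseSet_source hA
  have hF2 := isSetIn_fin E.isBaseSet_source hC
  have hF := isSetIn_fin E.isBaseSet_source hAC
  refine ⟨A ∪ C, hAC, ?_⟩
  set F1 := A.powerset.sep fun y => (y : Set ZFSet.{u}).Finite
  set F2 := C.powerset.sep fun y => (y : Set ZFSet.{u}).Finite
  set F := (A ∪ C).powerset.sep fun y => (y : Set ZFSet.{u}).Finite
  -- `∀ x ∈ F1, ∀ y ∈ F2, ∃ z ∈ F, z ∉ S ∧ x ⊆ z ∧ y ⊆ z ∧ z ⊆ x ∪ y`, and `x, y ∉ S`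
  have key := (E.transfer (.ball 0 (.ball 2 (.and (.and (.neg (.mem 0 5)) (.neg (.mem 1 5)))
    (.bex 4 (.and (.neg (.mem 0 6))
    (.and (.ball 2 (.mem 0 1)) (.and (.ball 1 (.mem 0 1))
      (.ball 0 (.or (.mem 0 3) (.mem 0 2))))))))))
    [F1, F2, F, S] (by simp [hF1.1, hF2.1, hF.1, inSuper_base hS])).1 (by
      rw [holds_ball]
      intro x hx hx'
      rw [holds_ball]
      intro y hy hy'
      have hx2 := ZFSet.mem_sep.1 (show x ∈ F1 from hx')
      have hy2 := ZFSet.mem_sep.1 (show y ∈ F2 from hy')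
      have hxs := hA.subset hS (ZFSet.mem_powerset.1 hx2.1)
      have hys := hC.subset hS (ZFSet.mem_powerset.1 hy2.1)
      have hxy := hxs.union hS hys
      rw [holds_and, holds_bex]
      refine ⟨⟨hys.2, hxs.2⟩, x ∪ y, hxy.1, ?_, hxy.2, ?_⟩
      · change x ∪ y ∈ F
        refine ZFSet.mem_sep.2 ⟨?_, ?_⟩
        · rw [ZFSet.mem_powerset]
          intro z hz
          rcases ZFSet.mem_union.1 hz with hz | hz
          · exact ZFSet.mem_union.2 (Or.inl (ZFSet.mem_powerset.1 hx2.1 hz))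
          · exact ZFSet.mem_union.2 (Or.inr (ZFSet.mem_powerset.1 hy2.1 hz))
        · rw [ZFSet.coe_union]
          exact hx2.2.union hy2.2
      · simp only [holds_and, holds_ball, holds_or, holds_mem, val_cons_zero, val_cons_ofNat,
          val_cons_one, Nat.reduceSub, ZFSet.mem_union]
        tauto)
  have hxT := (isSetIn_star (E := E) hF1).inSuper_of_mem hxA
  have hyT := (isSetIn_star (E := E) hF2).inSuper_of_mem hyC
  have := key x hxT hxA y hyT hyC
  rw [holds_and, holds_bex] at this
  obtain ⟨⟨hy1, hx1⟩, z, hz, hzF, hz1, h⟩ := this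
  simp only [holds_and, holds_neg, holds_ball, holds_or, holds_mem, val_cons_zero, val_cons_ofNat,
    val_cons_one, Nat.reduceSub, List.map, E.star_base] at h hy1 hx1 hz1 hzF
  have : x ∪ y = z := by
    have hx2 : IsSetIn T x := ⟨hxT, hx1⟩
    have hy2 : IsSetIn T y := ⟨hyT, hy1⟩
    have hz2 : IsSetIn T z := ⟨hz, hz1⟩
    ext w
    rw [ZFSet.mem_union]
    constructor
    · rintro (hw | hw)
      · exact h.1 w (hx2.inSuper_of_mem hw) hw
      · exact h.2.1 w (hy2.inSuper_of_mem hw) hw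
    · exact fun hw => h.2.2 w (hz2.inSuper_of_mem hw) hw
  rw [this]
  exact hzF

end NonstandardEmbedding

/-! ## Internal Dedekind rings -/

/-- The graph `{((x, y), f x y)}` of a binary operation on a set. -/
def opGraph (D : ZFSet.{u}) (f : {x // x ∈ D} → {x // x ∈ D} → {x // x ∈ D}) : ZFSet.{u} :=
  ((D.prod D).prod D).sep fun t =>
    ∃ x y : {x // x ∈ D}, t = ZFSet.pair (ZFSet.pair x.1 y.1) (f x y).1

/-- A ring with underlying set `D`, encoded as the triple `(D, +, ·)` of sets. -/
def ringCode (D : ZFSet.{u}) [CommRing {x // x ∈ D}] : ZFSet.{u} :=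
  ZFSet.pair D (ZFSet.pair (opGraph D (· + ·)) (opGraph D (· * ·)))

/-- `t` is (the code of) a standard Dedekind domain whose underlying set is a set of the
superstructure over `S`. -/
def IsDedekindCode (S t : ZFSet.{u}) : Prop :=
  ∃ (D : ZFSet.{u}) (_ : CommRing {x // x ∈ D}),
    IsSetIn S D ∧ IsDedekindDomain {x // x ∈ D} ∧ t = ringCode D

/-- An internal Dedekind ring: the notion obtained from that of a Dedekind domain by transfer.
It is a ring `B` whose code `(B, +, ·)` is an element of `*𝒟` for some set `𝒟` of (codes of)
Dedekind domains of the superstructure over `S`. -/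
structure InternalDedekindRing {S T : ZFSet.{u}} (E : NonstandardEmbedding S T) where
  /-- the underlying set -/
  carrier : ZFSet.{u}
  commRing : CommRing {x // x ∈ carrier}
  exists_family : ∃ 𝒟, IsSetIn S 𝒟 ∧ (∀ t ∈ 𝒟, IsDedekindCode S t) ∧
    ringCode carrier ∈ E.star 𝒟

theorem pair_mem_opGraph {D : ZFSet.{u}} {f : {x // x ∈ D} → {x // x ∈ D} → {x // x ∈ D}}
    {x y z : {x // x ∈ D}} :
    ZFSet.pair (ZFSet.pair x.1 y.1) z.1 ∈ opGraph D f ↔ f x y = z := by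
  rw [opGraph, ZFSet.mem_sep]
  constructor
  · rintro ⟨-, x', y', h⟩
    rw [ZFSet.pair_inj, ZFSet.pair_inj] at h
    obtain ⟨⟨h1, h2⟩, h3⟩ := h
    rw [Subtype.ext h1, Subtype.ext h2]
    exact (Subtype.ext h3).symm
  · rintro rfl
    exact ⟨ZFSet.pair_mem_prod.2 ⟨ZFSet.pair_mem_prod.2 ⟨x.2, y.2⟩, (f x y).2⟩, x, y, rfl⟩

theorem isSetIn_opGraph {S D : ZFSet.{u}} (hS : IsBaseSet S) (hD : IsSetIn S D)
    (f : {x // x ∈ D} → {x // x ∈ D} → {x // x ∈ D}) : IsSetIn S (opGraph D f) :=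
  ((hD.prod hS hD).prod hS hD).subset hS fun _ h => (ZFSet.mem_sep.1 h).1

namespace InternalDedekindRing

open NonstandardEmbedding

variable {S T : ZFSet.{u}} {E : NonstandardEmbedding S T} (B : InternalDedekindRing E)

/-- The type of elements of `B`. -/
abbrev Elem : Type (u + 1) := {x // x ∈ B.carrier}

instance : CommRing B.Elem := B.commRing

theorem internal_aux : IsSetIn T B.carrier ∧ E.Internal B.carrier ∧
    E.Internal (opGraph B.carrier fun x y : B.Elem => x + y) ∧
    E.Internal (opGraph B.carrier fun x y : B.Elem => x * y) ∧
    ∃ n, B.carrier ⊆ E.star (level S n) := by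
  obtain ⟨𝒟, h𝒟, hD, hB⟩ := B.exists_family
  have hS := E.isBaseSet_source
  have hT := E.isBaseSet_target
  have hBT := (isSetIn_star h𝒟).inSuper_of_mem hB
  -- every element of `𝒟` has the form `(D, (a, m))` with nonempty `D`
  have key := (E.transfer (.ball 0 (.bex 0 (.bex 0 (.bex 1 (.bex 0 (.bex 0 (.bex 1
      (.and (.pair 6 4 3) (.and (.pair 3 1 0) (.bex 4 (.eq 0 0))))))))))) [𝒟]
      (by simp [h𝒟.1])).1 (by
    rw [holds_ball]
    intro t ht ht'
    obtain ⟨D, hR, hDS, hDD, rfl⟩ := hD t ht'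
    have ha := (isSetIn_opGraph hS hDS fun x y => x + y).1
    have hm := (isSetIn_opGraph hS hDS fun x y => x * y).1
    have hP := InSuper.pair hS ha hm
    have hc := (IsSetIn.insert_singleton hS hDS.1 hP).1
    have hd := (IsSetIn.insert_singleton hS ha hm).1
    have hz := hDS.inSuper_of_mem (0 : {x // x ∈ D}).2
    simp only [holds_bex]
    refine ⟨{D, _}, hc, by simp [ringCode, ZFSet.pair], D, hDS.1, by simp, _, hP, by simp,
      {_, _}, hd, by simp [ZFSet.pair], _, ha, by simp, _, hm, by simp, ?_⟩
    have hl : ∀ x ∈ [opGraph D fun x y => x * y, opGraph D fun x y => x + y,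
        {opGraph D fun x y => x + y, opGraph D fun x y => x * y},
        ZFSet.pair (opGraph D fun x y => x + y) (opGraph D fun x y => x * y), D,
        {D, ZFSet.pair (opGraph D fun x y => x + y) (opGraph D fun x y => x * y)}, ringCode D, 𝒟],
        InSuper S x := by
      simp only [List.mem_cons, List.not_mem_nil, or_false, forall_eq_or_imp, forall_eq]
      exact ⟨hm, ha, hd, hP, hDS.1, hc, ht, h𝒟.1⟩
    rw [holds_and, holds_and, holds_pair hS hl, holds_pair hS hl, holds_bex]
    exact ⟨rfl, rfl, _, hz, (0 : {x // x ∈ D}).2, rfl⟩) _ hBT hB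
  simp only [holds_bex] at key
  obtain ⟨c, hc, hct, D, hDT, hDc, P, hPT, hPc, d, hd, hdP, a, ha, had, m, hm, hmd, h⟩ := key
  have hl : ∀ x ∈ [m, a, d, P, D, c, ringCode B.carrier, E.star 𝒟], InSuper T x := by
    simp only [List.mem_cons, List.not_mem_nil, or_false, forall_eq_or_imp, forall_eq]
    exact ⟨hm, ha, hd, hPT, hDT, hc, hBT, (isSetIn_star h𝒟).1⟩
  rw [holds_and, holds_and, List.map, List.map, holds_pair hT hl, holds_pair hT hl,
    holds_bex] at h
  obtain ⟨h1, h2, z, hz, hzD, -⟩ := h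
  simp only [val_cons_zero, val_cons_ofNat, val_cons_one, Nat.reduceSub]
    at h1 h2 hct hDc hPc hdP had hmd hzD
  rw [h2, ringCode, ZFSet.pair_inj, ZFSet.pair_inj] at h1
  obtain ⟨rfl, rfl, rfl⟩ := h1
  obtain ⟨n, hn⟩ := internal_iff_level.1 ⟨𝒟, h𝒟, hB⟩
  have hcn := mem_star_level_of_mem hn hct hc
  have hDn := mem_star_level_of_mem hcn hDc hDT
  have hPn := mem_star_level_of_mem hcn hPc hPT
  have hdn := mem_star_level_of_mem hPn hdP hd
  have hset : IsSetIn T B.carrier := ⟨hDT, fun h => hT.2 _ h z hzD hz⟩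
  exact ⟨hset, internal_iff_level.2 ⟨n, hDn⟩,
    internal_iff_level.2 ⟨n, mem_star_level_of_mem hdn had ha⟩,
    internal_iff_level.2 ⟨n, mem_star_level_of_mem hdn hmd hm⟩,
    n, fun x hx => mem_star_level_of_mem hDn hx (hset.inSuper_of_mem hx)⟩

/-- The subset of `B` underlying an ideal, as an entity. -/
def idealCode (I : Ideal B.Elem) : ZFSet.{u} :=
  B.carrier.sep fun x => ∃ h : x ∈ B.carrier, (⟨x, h⟩ : B.Elem) ∈ I

/-- The set `ℳ` of (nonzero) internal maximal ideals of `B`. -/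
def InternalMax : Type (u + 1) :=
  {𝔭 : Ideal B.Elem // 𝔭.IsMaximal ∧ 𝔭 ≠ ⊥ ∧ E.Internal (B.idealCode 𝔭)}

/-- A set of internal maximal ideals, as an entity. -/
def setCode (H : Set B.InternalMax) : ZFSet.{u} :=
  B.carrier.powerset.sep fun x => ∃ 𝔭 ∈ H, x = B.idealCode 𝔭.1

/-- The lattice `ℒ = *𝒫_fin(ℳ)` of hyperfinite subsets of `ℳ`. -/
def hyperfiniteSubsets : Set (Set B.InternalMax) := {H | E.Hyperfinite (B.setCode H)}

variable {B}

theorem mem_idealCode {I : Ideal B.Elem} {x : B.Elem} : x.1 ∈ B.idealCode I ↔ x ∈ I := by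
  rw [idealCode, ZFSet.mem_sep]
  exact ⟨fun h => h.2.2, fun h => ⟨x.2, x.2, h⟩⟩

theorem idealCode_subset (I : Ideal B.Elem) : B.idealCode I ⊆ B.carrier :=
  fun _ h => (ZFSet.mem_sep.1 h).1

theorem idealCode_injective : Function.Injective B.idealCode := by
  intro I J h
  ext x
  rw [← mem_idealCode, ← mem_idealCode, h]

theorem mem_setCode {H : Set B.InternalMax} {x : ZFSet.{u}} :
    x ∈ B.setCode H ↔ ∃ 𝔭 ∈ H, x = B.idealCode 𝔭.1 := by
  rw [setCode, ZFSet.mem_sep, ZFSet.mem_powerset]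
  refine ⟨fun h => h.2, fun h => ⟨?_, h⟩⟩
  obtain ⟨𝔭, -, rfl⟩ := h
  exact idealCode_subset _

theorem union_mem_hyperfiniteSubsets {H K : Set B.InternalMax}
    (hH : H ∈ B.hyperfiniteSubsets) (hK : K ∈ B.hyperfiniteSubsets) :
    H ∪ K ∈ B.hyperfiniteSubsets := by
  have : B.setCode (H ∪ K) = B.setCode H ∪ B.setCode K := by
    ext x
    simp only [mem_setCode, ZFSet.mem_union, Set.mem_union]
    constructor
    · rintro ⟨𝔭, h | h, rfl⟩
      · exact Or.inl ⟨𝔭, h, rfl⟩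
      · exact Or.inr ⟨𝔭, h, rfl⟩
    · rintro (⟨𝔭, h, rfl⟩ | ⟨𝔭, h, rfl⟩)
      · exact ⟨𝔭, Or.inl h, rfl⟩
      · exact ⟨𝔭, Or.inr h, rfl⟩
  rw [hyperfiniteSubsets, Set.mem_ofPred_eq, this]
  exact Hyperfinite.union hH hK

theorem empty_mem_hyperfiniteSubsets : ∅ ∈ B.hyperfiniteSubsets := by
  have : B.setCode ∅ = ∅ := (ZFSet.eq_empty _).2 fun x hx => by simp [mem_setCode] at hx
  rw [hyperfiniteSubsets, Set.mem_ofPred_eq, this]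
  exact hyperfinite_empty

theorem elem_inSuper (x : B.Elem) : InSuper T x.1 := B.internal_aux.1.inSuper_of_mem x.2

theorem elem_internal (x : B.Elem) : E.Internal x.1 :=
  B.internal_aux.2.1.mem B.internal_aux.1.2 x.2

theorem idealCode_notMem (I : Ideal B.Elem) : B.idealCode I ∉ T := fun h =>
  E.isBaseSet_target.2 _ h _ (mem_idealCode.2 I.zero_mem) (elem_inSuper 0)

/-- The set of internal maximal ideals is internal. -/
theorem internal_setCode_univ : E.Internal (B.setCode Set.univ) := by
  obtain ⟨hRT, hR, ha, hm, n, hn⟩ := B.internal_aux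
  have hS := E.isBaseSet_source
  have hT := E.isBaseSet_target
  have hlev := isSetIn_level hS n
  set l : List ZFSet.{u} := [B.carrier, opGraph B.carrier fun x y : B.Elem => x + y,
      opGraph B.carrier fun x y : B.Elem => x * y, (0 : B.Elem).1, (1 : B.Elem).1] with hl
  have hlT : ∀ x ∈ l, E.Internal x := by
    intro x hx
    simp only [hl, List.mem_cons, List.not_mem_nil, or_false] at hx
    rcases hx with rfl | rfl | rfl | rfl | rfl
    · exact hR
    · exact ha
    · exact hm
    · exact elem_internal 0
    · exact elem_internal 1
  let φadd : BFormula := .ball 0 (.ball 1 (.ball 3 (.imp (.mem3 2 1 0 5) (.mem 0 3))))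
  let φmul : BFormula := .ball 1 (.ball 1 (.ball 3 (.imp (.mem3 2 1 0 6) (.mem 0 3))))
  let φmax : BFormula := .ball 1 (.imp (.neg (.mem 0 1))
      (.bex 2 (.bex 2 (.bex 4 (.and (.mem3 3 2 0 7) (.mem3 0 1 9 6))))))
  let φ : BFormula := .and (.ball 0 (.mem 0 2)) (.and (.mem 4 0) (.and φadd (.and φmul
    (.and (.neg (.mem 5 0)) (.and φmax (.bex 0 (.neg (.eq 0 5))))))))
  have h := internal_sep (E := E) φ (hlev.powerset hS) l hlT
  convert h using 1
  ext I
  rw [ZFSet.mem_sep, mem_setCode]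
  have hladd : ∀ I x y z, InSuper T I → InSuper T x → InSuper T y → InSuper T z →
      ∀ w ∈ z :: y :: x :: I :: l, InSuper T w := by
    intro I x y z hI hx hy hz w hw
    simp only [List.mem_cons] at hw
    rcases hw with rfl | rfl | rfl | rfl | hw
    · exact hz
    · exact hy
    · exact hx
    · exact hI
    · exact (hlT w hw).inSuper
  have hadd : InSuper T I → I ⊆ B.carrier → (Holds T φadd (I :: l) ↔
      ∀ x y : B.Elem, x.1 ∈ I → y.1 ∈ I → (x + y).1 ∈ I) := by
    intro hI hIR
    simp only [φadd, holds_ball, holds_imp]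
    constructor
    · intro h x y hx hy
      have := h x.1 (elem_inSuper x) hx y.1 (elem_inSuper y) hy (x + y).1 (elem_inSuper _)
        (x + y).2
      rw [holds_mem3 hT (hladd _ _ _ _ hI (elem_inSuper x) (elem_inSuper y) (elem_inSuper _))]
        at this
      exact this ((pair_mem_opGraph (f := fun x y : B.Elem => x + y)).2 rfl)
    · intro h x hxT hx y hyT hy z hzT hz
      rw [holds_mem3 hT (hladd _ _ _ _ hI hxT hyT hzT)]
      intro h'
      have h1 := (pair_mem_opGraph (f := fun x y : B.Elem => x + y) (x := ⟨x, hIR hx⟩)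
        (y := ⟨y, hIR hy⟩) (z := ⟨z, hz⟩)).1 h'
      have h2 := h ⟨x, hIR hx⟩ ⟨y, hIR hy⟩ hx hy
      rwa [h1] at h2
  have hmul : InSuper T I → I ⊆ B.carrier → (Holds T φmul (I :: l) ↔
      ∀ x y : B.Elem, y.1 ∈ I → (x * y).1 ∈ I) := by
    intro hI hIR
    simp only [φmul, holds_ball, holds_imp]
    constructor
    · intro h x y hy
      have := h x.1 (elem_inSuper x) x.2 y.1 (elem_inSuper y) hy (x * y).1 (elem_inSuper _)
        (x * y).2
      rw [holds_mem3 hT (hladd _ _ _ _ hI (elem_inSuper x) (elem_inSuper y) (elem_inSuper _))]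
        at this
      exact this ((pair_mem_opGraph (f := fun x y : B.Elem => x * y)).2 rfl)
    · intro h x hxT hx y hyT hy z hzT hz
      rw [holds_mem3 hT (hladd _ _ _ _ hI hxT hyT hzT)]
      intro h'
      have h1 := (pair_mem_opGraph (f := fun x y : B.Elem => x * y) (x := ⟨x, hx⟩)
        (y := ⟨y, hIR hy⟩) (z := ⟨z, hz⟩)).1 h'
      have h2 := h ⟨x, hx⟩ ⟨y, hIR hy⟩ hy
      rwa [h1] at h2
  have hmax : InSuper T I → I ⊆ B.carrier → (Holds T φmax (I :: l) ↔
      ∀ x : B.Elem, x.1 ∉ I → ∃ y i : B.Elem, i.1 ∈ I ∧ x * y + i = 1) := by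
    intro hI hIR
    have hl4 : ∀ x y i w, InSuper T x → InSuper T y → InSuper T i → InSuper T w →
        ∀ v ∈ w :: i :: y :: x :: I :: l, InSuper T v := by
      intro x y i w hx hy hi hw v hv
      rcases List.mem_cons.1 hv with rfl | hv
      · exact hw
      · rcases List.mem_cons.1 hv with rfl | hv
        · exact hi
        · rcases List.mem_cons.1 hv with rfl | hv
          · exact hy
          · rcases List.mem_cons.1 hv with rfl | hv
            · exact hx
            · rcases List.mem_cons.1 hv with rfl | hv
              · exact hI
              · exact (hlT v hv).inSuper
    simp only [φmax, holds_ball, holds_imp, holds_neg, holds_bex, holds_and]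
    constructor
    · intro h x hx
      obtain ⟨y, hyT, hy, i, hiT, hi, w, hwT, hw, h1, h2⟩ := h x.1 (elem_inSuper x) x.2 hx
      rw [holds_mem3 hT (hl4 _ _ _ _ (elem_inSuper x) hyT hiT hwT)] at h1 h2
      have h1' := (pair_mem_opGraph (f := fun x y : B.Elem => x * y) (x := x)
        (y := ⟨y, hy⟩) (z := ⟨w, hw⟩)).1 h1
      have h2' := (pair_mem_opGraph (f := fun x y : B.Elem => x + y) (x := ⟨w, hw⟩)
        (y := ⟨i, hIR hi⟩) (z := 1)).1 h2
      exact ⟨⟨y, hy⟩, ⟨i, hIR hi⟩, hi, (congrArg (· + (⟨i, hIR hi⟩ : B.Elem)) h1').trans h2'⟩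
    · intro h x hxT hx hxI
      obtain ⟨y, i, hi, h1⟩ := h ⟨x, hx⟩ hxI
      obtain ⟨w, hw⟩ : ∃ w : B.Elem, (⟨x, hx⟩ : B.Elem) * y = w := ⟨_, rfl⟩
      rw [hw] at h1
      refine ⟨y.1, elem_inSuper y, y.2, i.1, elem_inSuper i, hi, w.1, elem_inSuper _, w.2, ?_⟩
      rw [holds_mem3 hT (hl4 _ _ _ _ hxT (elem_inSuper y) (elem_inSuper i) (elem_inSuper _)),
        holds_mem3 hT (hl4 _ _ _ _ hxT (elem_inSuper y) (elem_inSuper i) (elem_inSuper _))]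
      exact ⟨(pair_mem_opGraph (f := fun x y : B.Elem => x * y) (x := ⟨x, hx⟩)).2 hw,
        (pair_mem_opGraph (f := fun x y : B.Elem => x + y) (z := 1)).2 h1⟩
  constructor
  · rintro ⟨⟨𝔭, hp1, hp2, hp3⟩, -, rfl⟩
    have hsub := idealCode_subset 𝔭
    have hI := hp3.inSuper
    refine ⟨hp3.mem_star_powerset (idealCode_notMem 𝔭) hlev (fun x hx => hn (hsub hx)),
      fun x _ hx => hsub hx, mem_idealCode.2 𝔭.zero_mem, (hadd hI hsub).2 ?_, (hmul hI hsub).2 ?_,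
      fun h => hp1.ne_top ((Ideal.eq_top_iff_one 𝔭).2 (mem_idealCode.1 h)), (hmax hI hsub).2 ?_, ?_⟩
    · intro x y hx hy
      rw [mem_idealCode] at hx hy ⊢
      exact 𝔭.add_mem hx hy
    · intro x y hy
      rw [mem_idealCode] at hy ⊢
      exact 𝔭.mul_mem_left x hy
    · intro x hx
      rw [mem_idealCode] at hx
      obtain ⟨y, i, hi, h⟩ := hp1.exists_inv hx
      exact ⟨y, i, mem_idealCode.2 hi, by rw [mul_comm, h]⟩
    · obtain ⟨x, hx, hx0⟩ := Submodule.exists_mem_ne_zero_of_ne_bot hp2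
      rw [holds_bex]
      exact ⟨x.1, elem_inSuper x, mem_idealCode.2 hx, fun h => hx0 (Subtype.ext h)⟩
  · rintro ⟨hIP, h1, h2, h3, h4, h5, h6, h7⟩
    have hP := hlev.powerset hS
    have hIi : E.Internal I := ⟨_, hP, hIP⟩
    have hI := hIi.inSuper
    have h0I : (0 : B.Elem).1 ∈ I := h2
    have hIT : IsSetIn T I := ⟨hI, fun h => hT.2 _ h _ h0I (elem_inSuper 0)⟩
    have hsub : I ⊆ B.carrier := fun x hx => h1 x (hIT.inSuper_of_mem hx) hx
    rw [hadd hI hsub] at h3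
    rw [hmul hI hsub] at h4
    rw [hmax hI hsub] at h6
    let 𝔭 : Ideal B.Elem :=
      { carrier := {x | x.1 ∈ I}
        add_mem' := fun {x y} hx hy => h3 x y hx hy
        zero_mem' := h0I
        smul_mem' := fun x y hy => h4 x y hy }
    have hcode : I = B.idealCode 𝔭 := by
      ext x
      constructor
      · exact fun hx => (mem_idealCode (I := 𝔭) (x := ⟨x, hsub hx⟩)).2 hx
      · exact fun hx => (mem_idealCode (I := 𝔭) (x := ⟨x, idealCode_subset _ hx⟩)).1 hx
    refine ⟨⟨𝔭, ?_, ?_, hcode ▸ hIi⟩, trivial, hcode⟩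
    · rw [Ideal.isMaximal_iff]
      refine ⟨h5, fun J x hJ hx hxJ => ?_⟩
      obtain ⟨y, i, hi, h⟩ := h6 x hx
      rw [← h]
      exact J.add_mem (J.mul_mem_right y hxJ) (hJ hi)
    · rw [holds_bex] at h7
      obtain ⟨x, hxT, hx, hx0⟩ := h7
      intro hbot
      have : (⟨x, hsub hx⟩ : B.Elem) ∈ 𝔭 := hx
      rw [hbot, Ideal.mem_bot] at this
      exact hx0 (congrArg Subtype.val this)

end InternalDedekindRing

/-! ### Internal Weil divisors -/

namespace InternalDedekindRing

open NonstandardEmbedding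

variable {S T : ZFSet.{u}} {E : NonstandardEmbedding S T} (B : InternalDedekindRing E)

/-- The graph of a function `ℳ → *ℤ`, as an entity. -/
def divGraph (d : B.InternalMax → E.HyperInt) : ZFSet.{u} :=
  ((B.setCode Set.univ).prod (E.star E.intSet)).sep fun t =>
    ∃ 𝔭, t = ZFSet.pair (B.idealCode 𝔭.1) (d 𝔭).val

/-- `d` is an internal Weil divisor: an internal function `ℳ → *ℤ` which is zero outside a
hyperfinite subset of `ℳ`. -/
def IsInternalDivisor (d : B.InternalMax → E.HyperInt) : Prop :=
  E.Internal (B.divGraph d) ∧ ∃ H ∈ B.hyperfiniteSubsets, ∀ 𝔭 ∉ H, d 𝔭 = 0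

variable {B}

theorem pair_mem_divGraph {d : B.InternalMax → E.HyperInt} {𝔭 : B.InternalMax} {z : E.HyperInt} :
    ZFSet.pair (B.idealCode 𝔭.1) z.val ∈ B.divGraph d ↔ d 𝔭 = z := by
  rw [divGraph, ZFSet.mem_sep]
  constructor
  · rintro ⟨-, 𝔮, h⟩
    rw [ZFSet.pair_inj] at h
    rw [Subtype.ext (idealCode_injective h.1)]
    exact (HyperInt.ext h.2).symm
  · rintro rfl
    exact ⟨ZFSet.pair_mem_prod.2 ⟨mem_setCode.2 ⟨𝔭, trivial, rfl⟩, (d 𝔭).mem⟩, 𝔭, rfl⟩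

/-- A common standard set containing all pairs `(𝔭, n)`. -/
theorem exists_ambient : ∃ A, IsSetIn S A ∧
    ∀ (𝔭 : B.InternalMax) (z : E.HyperInt), ZFSet.pair (B.idealCode 𝔭.1) z.val ∈ E.star A := by
  obtain ⟨-, -, -, -, n, hn⟩ := B.internal_aux
  have hS := E.isBaseSet_source
  have hT := E.isBaseSet_target
  have hlev := isSetIn_level hS n
  have hP := hlev.powerset hS
  have hZ := isSetIn_intSet (E := E)
  have hA := hP.prod hS hZ
  refine ⟨_, hA, fun 𝔭 z => ?_⟩
  have key := (E.transfer (.ball 0 (.ball 2 (.mem2 1 0 4)))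
    [(level S n).powerset, E.intSet, (level S n).powerset.prod E.intSet]
    (by simp [hP.1, hZ.1, hA.1])).1 (by
      rw [holds_ball]
      intro x hx hx'
      rw [holds_ball]
      intro y hy hy'
      rw [holds_mem2 hS (by simp [hP.1, hZ.1, hA.1, hx, hy])]
      exact ZFSet.pair_mem_prod.2 ⟨hx', hy'⟩) _ 𝔭.2.2.2.inSuper
    (𝔭.2.2.2.mem_star_powerset (idealCode_notMem 𝔭.1) hlev
      (fun x hx => hn (idealCode_subset _ hx))) _ z.inSuper z.mem
  rwa [holds_mem2 hT (by
    simp [E.inSuper_star _ hP.1, E.inSuper_star _ hZ.1, E.inSuper_star _ hA.1, z.inSuper,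
      𝔭.2.2.2.inSuper])] at key

theorem isInternalDivisor_zero : B.IsInternalDivisor 0 := by
  have hT := E.isBaseSet_target
  refine ⟨?_, ∅, empty_mem_hyperfiniteSubsets, fun _ _ => rfl⟩
  obtain ⟨A, hA, h⟩ := exists_ambient (B := B)
  have h0 : E.Internal (0 : E.HyperInt).val := internal_star (inSuper_int 0)
  have hM := B.internal_setCode_univ
  have := internal_sep (E := E) (.bex 1 (.pair 1 0 3)) hA
    [B.setCode Set.univ, (0 : E.HyperInt).val] (by
      intro x hx
      simp only [List.mem_cons, List.not_mem_nil, or_false] at hx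
      rcases hx with rfl | rfl
      · exact hM
      · exact h0)
  convert this using 1
  ext x
  rw [divGraph, ZFSet.mem_sep, ZFSet.mem_sep, holds_bex]
  have hl : InSuper T x → ∀ I, InSuper T I →
      ∀ w ∈ [I, x, B.setCode Set.univ, (0 : E.HyperInt).val], InSuper T w := by
    intro hx I hI w hw
    simp only [List.mem_cons, List.not_mem_nil, or_false] at hw
    rcases hw with rfl | rfl | rfl | rfl
    exacts [hI, hx, hM.inSuper, h0.inSuper]
  constructor
  · rintro ⟨-, 𝔭, rfl⟩
    refine ⟨h 𝔭 0, B.idealCode 𝔭.1, 𝔭.2.2.2.inSuper, mem_setCode.2 ⟨𝔭, trivial, rfl⟩, ?_⟩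
    rw [holds_pair hT (hl (InSuper.pair hT 𝔭.2.2.2.inSuper h0.inSuper) _ 𝔭.2.2.2.inSuper)]
    rfl
  · rintro ⟨hxA, I, hI, hIM, hp⟩
    rw [holds_pair hT (hl ((isSetIn_star hA).inSuper_of_mem hxA) I hI)] at hp
    obtain ⟨𝔭, -, rfl⟩ := mem_setCode.1 hIM
    have hx : x = ZFSet.pair (B.idealCode 𝔭.1) (0 : E.HyperInt).val := hp
    exact ⟨hx ▸ ZFSet.pair_mem_prod.2 ⟨hIM, (0 : E.HyperInt).mem⟩, 𝔭, hx⟩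

theorem IsInternalDivisor.sub {d e : B.InternalMax → E.HyperInt} (hd : B.IsInternalDivisor d)
    (he : B.IsInternalDivisor e) : B.IsInternalDivisor (d - e) := by
  have hT := E.isBaseSet_target
  obtain ⟨hd, H, hH, hdH⟩ := hd
  obtain ⟨he, K, hK, heK⟩ := he
  refine ⟨?_, H ∪ K, union_mem_hyperfiniteSubsets hH hK, fun 𝔭 h => ?_⟩
  swap
  · simp only [Set.mem_union, not_or] at h
    rw [Pi.sub_apply, hdH 𝔭 h.1, heK 𝔭 h.2, sub_zero]
  obtain ⟨A, hA, h⟩ := exists_ambient (B := B)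
  have hM := B.internal_setCode_univ
  have hZ := internal_star (E := E) (isSetIn_intSet (E := E)).1
  have hP := internal_star (E := E) (isSetIn_intAdd (E := E)).1
  set l := [B.setCode Set.univ, E.star E.intSet, E.star E.intAdd, B.divGraph d, B.divGraph e]
    with hl
  have hlI : ∀ x ∈ l, E.Internal x := by
    intro x hx
    simp only [hl, List.mem_cons, List.not_mem_nil, or_false] at hx
    rcases hx with rfl | rfl | rfl | rfl | rfl
    exacts [hM, hZ, hP, hd, he]
  -- `∃ 𝔭 ∈ ℳ, ∃ x y z ∈ *ℤ, (𝔭, x) ∈ d, (𝔭, y) ∈ e, z + y = x, t = (𝔭, z)`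
  have := internal_sep (E := E) (.bex 1 (.bex 3 (.bex 4 (.bex 5 (.and (.mem2 3 2 8)
    (.and (.mem2 3 1 9) (.and (.mem3 0 1 2 7) (.pair 4 3 0)))))))) hA l hlI
  convert this using 1
  ext t
  rw [divGraph, ZFSet.mem_sep, ZFSet.mem_sep]
  simp only [holds_bex, holds_and]
  have hl' : InSuper T t → ∀ (𝔭 : B.InternalMax) (x y z : E.HyperInt),
      ∀ w ∈ z.val :: y.val :: x.val :: B.idealCode 𝔭.1 :: t :: l, InSuper T w := by
    intro ht 𝔭 x y z w hw
    simp only [List.mem_cons] at hw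
    rcases hw with rfl | rfl | rfl | rfl | rfl | hw
    exacts [z.inSuper, y.inSuper, x.inSuper, 𝔭.2.2.2.inSuper, ht, (hlI w hw).inSuper]
  constructor
  · rintro ⟨-, 𝔭, rfl⟩
    have ht := InSuper.pair hT 𝔭.2.2.2.inSuper ((d - e) 𝔭).inSuper
    refine ⟨h 𝔭 _, B.idealCode 𝔭.1, 𝔭.2.2.2.inSuper, mem_setCode.2 ⟨𝔭, trivial, rfl⟩,
      (d 𝔭).val, (d 𝔭).inSuper, (d 𝔭).mem, (e 𝔭).val, (e 𝔭).inSuper, (e 𝔭).mem,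
      ((d - e) 𝔭).val, ((d - e) 𝔭).inSuper, ((d - e) 𝔭).mem, ?_⟩
    have hlt := hl' ht 𝔭 (d 𝔭) (e 𝔭) ((d - e) 𝔭)
    rw [holds_mem2 hT hlt, holds_mem2 hT hlt, holds_mem3 hT hlt, holds_pair hT hlt]
    refine ⟨pair_mem_divGraph.2 rfl, pair_mem_divGraph.2 rfl, isSum_iff.2 ?_, rfl⟩
    exact sub_add_cancel _ _
  · rintro ⟨htA, I, hI, hIM, x, hx, hxZ, y, hy, hyZ, z, hz, hzZ, h1, h2, h3, h4⟩
    obtain ⟨𝔭, -, rfl⟩ := mem_setCode.1 hIM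
    have ht := (isSetIn_star hA).inSuper_of_mem htA
    have hlt := hl' ht 𝔭 ⟨x, hxZ⟩ ⟨y, hyZ⟩ ⟨z, hzZ⟩
    rw [holds_mem2 hT hlt] at h1 h2
    rw [holds_mem3 hT hlt] at h3
    rw [holds_pair hT hlt] at h4
    have h1' := (pair_mem_divGraph (z := ⟨x, hxZ⟩)).1 h1
    have h2' := (pair_mem_divGraph (z := ⟨y, hyZ⟩)).1 h2
    have h3' := (isSum_iff (x := ⟨z, hzZ⟩) (y := ⟨y, hyZ⟩) (z := ⟨x, hxZ⟩)).1 h3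
    have hz' : (d - e) 𝔭 = ⟨z, hzZ⟩ := by
      rw [Pi.sub_apply, h1', h2', ← h3', add_sub_cancel_right]
    have ht' : t = ZFSet.pair (B.idealCode 𝔭.1) z := h4
    refine ⟨ht' ▸ ZFSet.pair_mem_prod.2 ⟨hIM, hzZ⟩, 𝔭, ?_⟩
    rw [hz']
    exact ht'

variable (B)

/-- The group `*⨁_ℳ *ℤ` of internal Weil divisors of `B`, with pointwise addition. -/
def WeilDiv : AddSubgroup (B.InternalMax → E.HyperInt) :=
  AddSubgroup.ofSub {d | B.IsInternalDivisor d} ⟨0, isInternalDivisor_zero⟩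
    fun d hd e he => by
      have := IsInternalDivisor.sub hd he
      rwa [sub_eq_add_neg] at this

theorem mem_WeilDiv {d : B.InternalMax → E.HyperInt} :
    d ∈ B.WeilDiv ↔ B.IsInternalDivisor d := Iff.rfl

/-! ### Maximal filters on `ℒ` and the ordered groups `(*⨁_ℳ *ℤ) / ℱ` -/

/-- Proper (nonempty) filters on the lattice `ℒ` of hyperfinite subsets of `ℳ`. -/
structure IsProperFilter (F : Set (Set B.InternalMax)) : Prop where
  subset : F ⊆ B.hyperfiniteSubsets
  nonempty : F.Nonempty
  inter_mem : ∀ H ∈ F, ∀ K ∈ F, H ∩ K ∈ F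
  mem_of_superset : ∀ H ∈ F, ∀ K ∈ B.hyperfiniteSubsets, H ⊆ K → K ∈ F
  proper : F ≠ B.hyperfiniteSubsets

/-- Maximal filters (ultrafilters) on `ℒ`: the maximal elements among the proper filters. -/
def MaximalFilter : Type (u + 1) := {F : Set (Set B.InternalMax) // Maximal B.IsProperFilter F}

variable {B}

/-- The subgroup of the internal Weil divisors that are identified with zero modulo `ℱ`, that is,
vanish on some element of `ℱ`. -/
def nullDiv (F : B.MaximalFilter) : AddSubgroup B.WeilDiv where
  carrier := {d | ∃ H ∈ F.1, ∀ 𝔭 ∈ H, d.1 𝔭 = 0}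
  zero_mem' := by
    obtain ⟨H, hH⟩ := F.2.prop.nonempty
    exact ⟨H, hH, fun _ _ => rfl⟩
  add_mem' := by
    rintro d e ⟨H, hH, hd⟩ ⟨K, hK, he⟩
    refine ⟨H ∩ K, F.2.prop.inter_mem H hH K hK, fun 𝔭 h => ?_⟩
    rw [AddSubgroup.coe_add, Pi.add_apply, hd 𝔭 h.1, he 𝔭 h.2, add_zero]
  neg_mem' := by
    rintro d ⟨H, hH, hd⟩
    refine ⟨H, hH, fun 𝔭 h => ?_⟩
    rw [AddSubgroup.coe_neg, Pi.neg_apply, hd 𝔭 h, neg_zero]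

/-- The group `(*⨁_ℳ *ℤ) / ℱ`: internal Weil divisors are identified if they coincide on some
element of `ℱ`. -/
def DivMod (F : B.MaximalFilter) : Type (u + 1) := B.WeilDiv ⧸ nullDiv F

instance (F : B.MaximalFilter) : AddCommGroup (DivMod F) :=
  inferInstanceAs (AddCommGroup (B.WeilDiv ⧸ nullDiv F))

/-- The class of an internal Weil divisor modulo `ℱ`. -/
def DivMod.mk (F : B.MaximalFilter) : B.WeilDiv →+ DivMod F := QuotientAddGroup.mk' (nullDiv F)

/-- The order of `(*⨁_ℳ *ℤ) / ℱ`: `[d] ≤ [e]` iff `d ≤ e` holds on some element of `ℱ`. -/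
instance (F : B.MaximalFilter) : LE (DivMod F) :=
  ⟨fun x y => ∃ d e : B.WeilDiv, DivMod.mk F d = x ∧ DivMod.mk F e = y ∧
    ∃ H ∈ F.1, ∀ 𝔭 ∈ H, d.1 𝔭 ≤ e.1 𝔭⟩

instance (F : B.MaximalFilter) : LT (DivMod F) := ⟨fun x y => x ≤ y ∧ x ≠ y⟩

/-- Convex (isolated) subgroups. -/
def IsConvexSubgroup {F : B.MaximalFilter} (U : AddSubgroup (DivMod F)) : Prop :=
  ∀ x ∈ U, ∀ y, 0 ≤ y → y ≤ x → y ∈ U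

variable (B)

/-- The pairs `(ℱ, U)` of a maximal filter `ℱ` on `ℒ` and a proper convex subgroup `U` of
`(*⨁_ℳ *ℤ) / ℱ`. -/
def FilterConvexPair : Type (u + 1) :=
  (F : B.MaximalFilter) × {U : AddSubgroup (DivMod F) // IsConvexSubgroup U ∧ U ≠ ⊤}

variable {B}

/-! ### Principal divisors -/

/-- `P` is the internal sequence `n ↦ 𝔭ⁿ` (`n ∈ *ℕ`) of internal powers of `𝔭`, given by internal
recursion and extended by `𝔭ⁿ = B` for `n ≤ 0`. -/
def IsPowerSeq (𝔭 : Ideal B.Elem) (P : E.HyperInt → Ideal B.Elem) : Prop :=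
  E.Internal (((E.star E.intSet).prod B.carrier.powerset).sep fun t =>
    ∃ n : E.HyperInt, t = ZFSet.pair n.val (B.idealCode (P n))) ∧
  (∀ n ≤ 0, P n = ⊤) ∧ ∀ n, 0 ≤ n → P (n + 1) = P n * 𝔭

/-- `v_𝔭(a) = n`, that is, `a ∈ 𝔭ⁿ` and `a ∉ 𝔭ⁿ⁺¹`. -/
def IsOrd (𝔭 : Ideal B.Elem) (a : B.Elem) (n : E.HyperInt) : Prop :=
  ∃ P, IsPowerSeq 𝔭 P ∧ a ∈ P n ∧ a ∉ P (n + 1)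

/-- `d` is the divisor of `a`, that is, `d(𝔭) = v_𝔭(a)` for all `𝔭 ∈ ℳ`. -/
def IsDivisorOf (a : B.Elem) (d : B.WeilDiv) : Prop := ∀ 𝔭 : B.InternalMax, IsOrd 𝔭.1 a (d.1 𝔭)

end InternalDedekindRing

/-! ## Valuations of the quotient field -/

/-- A nontrivial valuation of `L` that is nonnegative on the subring `B`. Mathlib's valuations are
written multiplicatively, so nonnegative means `v b ≤ 1`. -/
structure CenteredValuation (B : Type*) (L : Type w) [CommRing B] [Field L] [Algebra B L] where
  /-- the value group, together with the value `0` of `0` -/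
  Γ : Type w
  [inst : LinearOrderedCommGroupWithZero Γ]
  /-- the valuation -/
  v : Valuation L Γ
  nontrivial : v.IsNontrivial
  le_one : ∀ b : B, v (algebraMap B L b) ≤ 1

attribute [instance] CenteredValuation.inst

/-- Equivalence of valuations. -/
instance centeredValuationSetoid (B : Type*) (L : Type w) [CommRing B] [Field L] [Algebra B L] :
    Setoid (CenteredValuation B L) where
  r v w := v.v.IsEquiv w.v
  iseqv := ⟨fun _ => Valuation.IsEquiv.refl, fun h => h.symm, fun h h' => h.trans h'⟩

/-- The set of nontrivial valuations (up to equivalence) of `L` that are nonnegative on `B`. -/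
def CenteredValuationClass (B : Type*) (L : Type w) [CommRing B] [Field L] [Algebra B L] :=
  Quotient (centeredValuationSetoid B L)

end Nonstandard

end

noncomputable section

namespace Nonstandard

universe v₁ v₂ v₃

/-! ## Typed transfer -/

/-! The bijection between primes and valuations rests on the Prüfer property. In a Dedekind domain
`(a, b)` is invertible, so there are `s + t = 1` with `b ∣ s a` and `a ∣ t b`. This is a statement
about elements, so it transfers to `B`. At any prime of `B`, internal or not, one of `s`, `t` is a
unit; hence every localization is a valuation ring, and a valuation that is nonnegative on `B` has
the localization at its center as valuation ring (`exists_equiv_centeredValuationClass`).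

The bijection with pairs `(ℱ, U)` uses three transferred facts on orders: orders detect divisibility
(`dvd_of_ord_le`); nonnegative values on a hyperfinite set are the orders of some nonzero element
(`exists_ord_eq`); and for `c ≠ 0` and hyperfinite `H` there is `e + f = 1` with `e` divisible by
`c` on `H` and `f` divisible by `c` off `H` (`exists_idempotent_mod`).

Maximality of `ℱ` makes the group of divisors modulo `ℱ` linearly ordered, and `a ↦ [div a]` behaves
like a valuation on `B`. So the elements whose class lies outside `U`, together with `0`, form a
prime ideal. By approximation every nonnegative class is some `[div a]`, so this ideal is nonzero
and determines `U`. It determines `ℱ` too: for two different filters, the splitting `e + f = 1` on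
disjoint members would put `1` into the ideal (`subset_of_idealOfPair_eq`).

Conversely, let `𝔮` be a nonzero prime and `0 ≠ c ∈ 𝔮`. The sets `H` off which `c` divides, in terms
of orders, some `s ∉ 𝔮` form a maximal filter (`maximal_filterOf`) that does not change when `c` is
replaced by a nonzero multiple. The convex hull of the classes of elements outside `𝔮` is the
subgroup. If `a ∈ 𝔮` had its class in that subgroup, then `a` would divide a product of two elements
outside `𝔮` (`ofElem_mem_subgroupOf_iff`).

To transfer without writing bounded formulas each time, `Ev` evaluates a Lean predicate at a
nonstandard point and commutes with connectives and quantifiers. `B` is the point `base` of the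
extended index set of a standard family of Dedekind domains, and facts proved for every ring of the
family are evaluated there. Finally `IsPowerSeq.eq_internalPow` shows by internal induction that
internal powers are unique, which matches the orders defined by transfer with `IsOrd`. -/

/-- A type whose elements are coded by entities of bounded rank of the superstructure over `S`. -/
class Coded (S : ZFSet.{u}) (α : Type v₁) where
  /-- the entity coding an element -/
  code : α → ZFSet.{u}
  code_injective : Function.Injective code
  /-- a bound for the ranks of the codes -/
  rank : ℕ
  code_mem : ∀ a, code a ∈ level S rank

namespace Coded

variable {S : ZFSet.{u}}

/-- The set of codes of the elements of `R`. -/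
def ext (S : ZFSet.{u}) {α : Type v₁} [Coded S α] (R : Set α) : ZFSet.{u} :=
  (level S (rank S α)).sep fun x => ∃ a ∈ R, code S a = x

variable {α : Type v₁} {β : Type v₂} [Coded S α] [Coded S β]

theorem mem_ext {R : Set α} {x : ZFSet.{u}} : x ∈ ext S R ↔ ∃ a ∈ R, code S a = x := by
  rw [ext, ZFSet.mem_sep]
  refine ⟨fun h => h.2, fun h => ⟨?_, h⟩⟩
  obtain ⟨a, -, rfl⟩ := h
  exact code_mem a

@[simp] theorem code_mem_ext {R : Set α} {a : α} : code S a ∈ ext S R ↔ a ∈ R := by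
  rw [mem_ext]
  exact ⟨fun ⟨b, hb, h⟩ => code_injective h ▸ hb, fun h => ⟨a, h, rfl⟩⟩

theorem isSetIn_ext (hS : IsBaseSet S) (R : Set α) : IsSetIn S (ext S R) :=
  isSetIn_of_subset_level hS fun _ h => (ZFSet.mem_sep.1 h).1

theorem inSuper_ext (hS : IsBaseSet S) (R : Set α) : InSuper S (ext S R) := (isSetIn_ext hS R).1

theorem inSuper_code (a : α) : InSuper S (code S a) := ⟨_, code_mem a⟩

theorem ext_injective : Function.Injective (ext S (α := α)) := by
  intro R Q h
  ext a
  rw [← code_mem_ext (S := S), h, code_mem_ext]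

theorem pair_mem_level {n : ℕ} {x y : ZFSet.{u}} (hx : x ∈ level S n) (hy : y ∈ level S n) :
    ZFSet.pair x y ∈ level S (n + 2) := by
  have h : ∀ {m : ℕ} {a b : ZFSet.{u}}, a ∈ level S m → b ∈ level S m →
      ({a, b} : ZFSet.{u}) ∈ level S (m + 1) := by
    intro m a b ha hb
    rw [level, ZFSet.mem_union, ZFSet.mem_powerset]
    refine Or.inr fun z hz => ?_
    rcases ZFSet.mem_pair.1 hz with rfl | rfl <;> assumption
  have h1 : ({x} : ZFSet.{u}) = {x, x} := by ext; simp
  rw [ZFSet.pair, h1]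
  exact h (h hx hx) (h hx hy)

instance : Coded S (α × β) where
  code p := ZFSet.pair (code S p.1) (code S p.2)
  code_injective p q h := by
    obtain ⟨h1, h2⟩ := ZFSet.pair_inj.1 h
    exact Prod.ext (code_injective h1) (code_injective h2)
  rank := max (rank S α) (rank S β) + 2
  code_mem p := pair_mem_level (level_mono (le_max_left _ _) (code_mem p.1))
    (level_mono (le_max_right _ _) (code_mem p.2))

instance : Coded S (Set α) where
  code := ext S
  code_injective := ext_injective
  rank := rank S α + 1
  code_mem R := by
    rw [level, ZFSet.mem_union, ZFSet.mem_powerset]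
    exact Or.inr fun z hz => (ZFSet.mem_sep.1 hz).1

theorem code_pair (a : α) (b : β) : code S (a, b) = ZFSet.pair (code S a) (code S b) := rfl

theorem code_set (R : Set α) : code S R = ext S R := rfl

/-- Every subset of the set of codes is again a code, so `E.Star (Set α)` is the extension of a full
power set. This is why every internal subset of `E.Star α` is a point of `E.Star (Set α)`. -/
theorem ext_univ_set : ext S (Set.univ : Set (Set α)) = (ext S (Set.univ : Set α)).powerset := by
  ext x
  rw [mem_ext, ZFSet.mem_powerset]
  constructor
  · rintro ⟨R, -, rfl⟩ y hy
    obtain ⟨a, -, rfl⟩ := mem_ext.1 hy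
    simp
  · intro h
    refine ⟨{a | code S a ∈ x}, trivial, ?_⟩
    ext y
    rw [code_set, mem_ext]
    constructor
    · rintro ⟨a, ha, rfl⟩
      exact ha
    · intro hy
      obtain ⟨a, -, rfl⟩ := mem_ext.1 (h hy)
      exact ⟨a, hy, rfl⟩

end Coded

open Coded

namespace NonstandardEmbedding

variable {S T : ZFSet.{u}} {E : NonstandardEmbedding S T}

theorem inSuper_map_star {l : List ZFSet.{u}} (hl : ∀ x ∈ l, InSuper S x) :
    ∀ x ∈ l.map E.star, InSuper T x := by
  intro x hx
  obtain ⟨y, hy, rfl⟩ := List.mem_map.1 hx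
  exact E.inSuper_star y (hl y hy)

/-- The list of values begins with the element, then its range, then the parameters; this order
fixes the de Bruijn indices in all the formulas that follow. -/
theorem transfer_ball (φ : BFormula) {A : ZFSet.{u}} (hA : IsSetIn S A) (l : List ZFSet.{u})
    (hl : ∀ x ∈ l, InSuper S x) (h : ∀ x ∈ A, InSuper S x → Holds S φ (x :: A :: l))
    {x : ZFSet.{u}} (hx : x ∈ E.star A) : Holds T φ (x :: E.star A :: l.map E.star) :=
  (E.transfer (.ball 0 φ) (A :: l) (by simpa using ⟨hA.1, hl⟩)).1
    (fun x h1 h2 => h x h2 h1) x ((isSetIn_star hA).inSuper_of_mem hx) hx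

theorem transfer_ball₂ (φ : BFormula) {A C : ZFSet.{u}} (hA : IsSetIn S A) (hC : IsSetIn S C)
    (l : List ZFSet.{u}) (hl : ∀ x ∈ l, InSuper S x)
    (h : ∀ x ∈ A, ∀ y ∈ C, InSuper S x → InSuper S y → Holds S φ (y :: x :: A :: C :: l))
    {x y : ZFSet.{u}} (hx : x ∈ E.star A) (hy : y ∈ E.star C) :
    Holds T φ (y :: x :: E.star A :: E.star C :: l.map E.star) :=
  transfer_ball (.ball 2 φ) hA (C :: l) (by simpa using ⟨hC.1, hl⟩)
    (fun x hx hx' y hy' hy => h x hx y hy hx' hy') hx y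
    ((isSetIn_star hC).inSuper_of_mem hy) hy

variable (E) in
/-- The nonstandard extension of a coded type. -/
def Star (α : Type v₁) [Coded S α] : Type (u + 1) := {x // x ∈ E.star (ext S (Set.univ : Set α))}

/-! ### Evaluation of predicates at nonstandard points -/

namespace Star

variable {α : Type v₁} {β : Type v₂} {γ : Type v₃} [Coded S α] [Coded S β] [Coded S γ]

@[ext] theorem ext {x y : E.Star α} (h : x.1 = y.1) : x = y := Subtype.ext h

theorem inSuper (x : E.Star α) : InSuper T x.1 :=
  (isSetIn_star (isSetIn_ext E.isBaseSet_source _)).inSuper_of_mem x.2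

/-- The nonstandard extension of the predicate `P` holds at `x`. -/
def Ev (x : E.Star α) (P : α → Prop) : Prop := x.1 ∈ E.star (Coded.ext S {a | P a})

/-- The element given by an element of the extension of a set of codes. -/
def ofMem {R : Set α} {x : ZFSet.{u}} (hx : x ∈ E.star (Coded.ext S R)) : E.Star α :=
  ⟨x, star_subset_star (isSetIn_ext E.isBaseSet_source _) (isSetIn_ext E.isBaseSet_source _)
    (fun y hy => by obtain ⟨a, -, rfl⟩ := mem_ext.1 hy; simp) hx⟩

/-- This is how transfer is invoked later: prove a statement for all standard arguments, evaluate it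
at a nonstandard one, and unfold it with the `ev_` lemmas. -/
theorem Ev.of_forall {P : α → Prop} (h : ∀ a, P a) (x : E.Star α) : x.Ev P := by
  have : {a | P a} = Set.univ := Set.eq_univ_of_forall h
  rw [Ev, this]
  exact x.2

-- With `ev_and` and `ev_exists` this gives a recursion in the manner of Łoś's theorem: explicit
-- bounded formulas are needed only for the basic clauses.
@[simp] theorem ev_not {x : E.Star α} {P : α → Prop} : x.Ev (fun a => ¬ P a) ↔ ¬ x.Ev P := by
  have hS := E.isBaseSet_source
  have := transfer_ball (E := E) (.and (.imp (.mem 0 2) (.neg (.mem 0 3)))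
    (.imp (.neg (.mem 0 3)) (.mem 0 2))) (isSetIn_ext hS Set.univ)
    [Coded.ext S {a | ¬ P a}, Coded.ext S {a | P a}]
    (by simp [inSuper_ext hS]) (by
      intro y hy hy'
      obtain ⟨a, -, rfl⟩ := mem_ext.1 hy
      simp) x.2
  simp only [holds_and, holds_imp, holds_neg, holds_mem, List.map, val_cons_zero, val_cons_ofNat,
    val_cons_one, Nat.reduceSub] at this
  exact ⟨this.1, this.2⟩

@[simp] theorem ev_and {x : E.Star α} {P Q : α → Prop} :
    x.Ev (fun a => P a ∧ Q a) ↔ x.Ev P ∧ x.Ev Q := by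
  have hS := E.isBaseSet_source
  have := transfer_ball (E := E) (.and (.imp (.mem 0 2) (.and (.mem 0 3) (.mem 0 4)))
    (.imp (.and (.mem 0 3) (.mem 0 4)) (.mem 0 2))) (isSetIn_ext hS Set.univ)
    [Coded.ext S {a | P a ∧ Q a}, Coded.ext S {a | P a}, Coded.ext S {a | Q a}]
    (by simp [inSuper_ext hS]) (by
      intro y hy hy'
      obtain ⟨a, -, rfl⟩ := mem_ext.1 hy
      simp) x.2
  simp only [holds_and, holds_imp, holds_mem, List.map, val_cons_zero, val_cons_ofNat,
    val_cons_one, Nat.reduceSub] at this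
  exact ⟨this.1, this.2⟩

@[simp] theorem ev_or {x : E.Star α} {P Q : α → Prop} :
    x.Ev (fun a => P a ∨ Q a) ↔ x.Ev P ∨ x.Ev Q := by
  have h : (fun a => P a ∨ Q a) = fun a => ¬ (¬ P a ∧ ¬ Q a) := by ext; tauto
  rw [h, ev_not, ev_and, ev_not, ev_not]
  tauto

@[simp] theorem ev_imp {x : E.Star α} {P Q : α → Prop} :
    x.Ev (fun a => P a → Q a) ↔ (x.Ev P → x.Ev Q) := by
  have h : (fun a => P a → Q a) = fun a => ¬ (P a ∧ ¬ Q a) := by ext; tauto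
  rw [h, ev_not, ev_and, ev_not]
  tauto

@[simp] theorem ev_iff {x : E.Star α} {P Q : α → Prop} :
    x.Ev (fun a => P a ↔ Q a) ↔ (x.Ev P ↔ x.Ev Q) := by
  have h : (fun a => P a ↔ Q a) = fun a => (P a → Q a) ∧ (Q a → P a) := by
    ext; exact iff_iff_implies_and_implies
  rw [h, ev_and, ev_imp, ev_imp]
  tauto

theorem Ev.mono {x : E.Star α} {P Q : α → Prop} (h : ∀ a, P a → Q a) (hx : x.Ev P) : x.Ev Q :=
  ev_imp.1 (.of_forall h x) hx

/-! ### Pairs -/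

/-- The pair of two elements. -/
def pair (x : E.Star α) (y : E.Star β) : E.Star (α × β) := ⟨ZFSet.pair x.1 y.1, by
  have hS := E.isBaseSet_source
  have hT := E.isBaseSet_target
  have h := fun R : Set (α × β) => inSuper_ext hS R
  have := transfer_ball₂ (E := E) (.mem2 1 0 4) (isSetIn_ext hS (Set.univ : Set α))
    (isSetIn_ext hS (Set.univ : Set β)) [Coded.ext S (Set.univ : Set (α × β))]
    (by simp [inSuper_ext hS]) (by
      intro x hx y hy hx' hy'
      obtain ⟨a, -, rfl⟩ := mem_ext.1 hx
      obtain ⟨b, -, rfl⟩ := mem_ext.1 hy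
      rw [holds_mem2 hS (by simp [inSuper_ext hS, inSuper_code])]
      exact code_mem_ext.2 (Set.mem_univ (a, b))) x.2 y.2
  rw [holds_mem2 hT (by
    simp [x.inSuper, y.inSuper, E.inSuper_star _ (inSuper_ext hS _)])] at this
  exact this⟩

@[simp] theorem pair_val (x : E.Star α) (y : E.Star β) :
    (x.pair y).1 = ZFSet.pair x.1 y.1 := rfl

theorem exists_eq_pair (z : E.Star (α × β)) : ∃ x y, z = pair x y := by
  have hS := E.isBaseSet_source
  have hT := E.isBaseSet_target
  have := transfer_ball (E := E) (.bex 2 (.bex 4 (.pair 2 1 0)))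
    (isSetIn_ext hS (Set.univ : Set (α × β)))
    [Coded.ext S (Set.univ : Set α), Coded.ext S (Set.univ : Set β)]
    (by simp [inSuper_ext hS]) (by
      intro z hz hz'
      obtain ⟨⟨a, b⟩, -, rfl⟩ := mem_ext.1 hz
      rw [holds_bex]
      refine ⟨code S a, inSuper_code a, by simp, ?_⟩
      rw [holds_bex]
      refine ⟨code S b, inSuper_code b, by simp, ?_⟩
      rw [holds_pair hS (by simp [inSuper_ext hS, inSuper_code])]
      rfl) z.2
  rw [holds_bex] at this
  obtain ⟨x, hx, hx', this⟩ := this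
  rw [holds_bex] at this
  obtain ⟨y, hy, hy', this⟩ := this
  rw [holds_pair hT (by
    simp [hx, hy, z.inSuper, E.inSuper_star _ (inSuper_ext hS _)])] at this
  exact ⟨⟨x, hx'⟩, ⟨y, hy'⟩, Star.ext this⟩

theorem pair_inj {x x' : E.Star α} {y y' : E.Star β} :
    pair x y = pair x' y' ↔ x = x' ∧ y = y' := by
  rw [Star.ext_iff, pair_val, pair_val, ZFSet.pair_inj, ← Star.ext_iff, ← Star.ext_iff]

/-- first component -/
def fst (z : E.Star (α × β)) : E.Star α := z.exists_eq_pair.choose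

/-- second component -/
def snd (z : E.Star (α × β)) : E.Star β := z.exists_eq_pair.choose_spec.choose

@[simp] theorem pair_fst_snd (z : E.Star (α × β)) : pair z.fst z.snd = z :=
  z.exists_eq_pair.choose_spec.choose_spec.symm

@[simp] theorem fst_pair (x : E.Star α) (y : E.Star β) : (pair x y).fst = x :=
  (pair_inj.1 (pair_fst_snd (pair x y))).1

@[simp] theorem snd_pair (x : E.Star α) (y : E.Star β) : (pair x y).snd = y :=
  (pair_inj.1 (pair_fst_snd (pair x y))).2

/-- Transfer of a quantifier. -/
theorem ev_exists {x : E.Star α} {P : α → β → Prop} :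
    x.Ev (fun a => ∃ b, P a b) ↔ ∃ y : E.Star β, (x.pair y).Ev fun p => P p.1 p.2 := by
  have hS := E.isBaseSet_source
  have hT := E.isBaseSet_target
  have := transfer_ball (E := E) (.and (.imp (.mem 0 2) (.bex 3 (.mem2 1 0 5)))
    (.imp (.bex 3 (.mem2 1 0 5)) (.mem 0 2))) (isSetIn_ext hS Set.univ)
    [Coded.ext S {a | ∃ b, P a b}, Coded.ext S (Set.univ : Set β),
      Coded.ext S {p : α × β | P p.1 p.2}]
    (by simp [inSuper_ext hS]) (by
      intro y hy hy'
      obtain ⟨a, -, rfl⟩ := mem_ext.1 hy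
      rw [holds_and, holds_imp, holds_imp, holds_bex]
      constructor
      · intro h
        obtain ⟨b, hb⟩ := code_mem_ext.1 (show code S a ∈ Coded.ext S _ from h)
        refine ⟨code S b, inSuper_code b, by simp, ?_⟩
        rw [holds_mem2 hS (by simp [inSuper_ext hS, inSuper_code])]
        exact code_mem_ext (a := (a, b)).2 hb
      · rintro ⟨y, hy, hyB, h⟩
        obtain ⟨b, -, rfl⟩ := mem_ext.1 (show y ∈ Coded.ext S _ from hyB)
        rw [holds_mem2 hS (by simp [inSuper_ext hS, inSuper_code])] at h
        exact code_mem_ext.2 ⟨b, code_mem_ext (a := (a, b)).1 h⟩) x.2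
  rw [holds_and, holds_imp, holds_imp, holds_bex] at this
  constructor
  · intro h
    obtain ⟨y, hy, hyB, h⟩ := this.1 h
    rw [holds_mem2 hT (by simp [hy, x.inSuper, E.inSuper_star _ (inSuper_ext hS _)])] at h
    exact ⟨⟨y, hyB⟩, h⟩
  · rintro ⟨y, h⟩
    refine this.2 ⟨y.1, y.inSuper, y.2, ?_⟩
    rw [holds_mem2 hT (by simp [y.inSuper, x.inSuper, E.inSuper_star _ (inSuper_ext hS _)])]
    exact h

/-- If `β` is itself a type of sets, the transferred quantifier ranges over the internal sets only.
-/
theorem ev_forall {x : E.Star α} {P : α → β → Prop} :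
    x.Ev (fun a => ∀ b, P a b) ↔ ∀ y : E.Star β, (x.pair y).Ev fun p => P p.1 p.2 := by
  have h : (fun a => ∀ b, P a b) = fun a => ¬ ∃ b, ¬ P a b := by ext; simp
  rw [h, ev_not, ev_exists]
  simp

theorem ev_eq_pair {x y : E.Star α} : (x.pair y).Ev (fun p => p.1 = p.2) ↔ x = y := by
  have hS := E.isBaseSet_source
  have hT := E.isBaseSet_target
  have := transfer_ball₂ (E := E) (.and (.imp (.mem2 1 0 4) (.eq 1 0))
    (.imp (.eq 1 0) (.mem2 1 0 4))) (isSetIn_ext hS (Set.univ : Set α))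
    (isSetIn_ext hS (Set.univ : Set α)) [Coded.ext S {p : α × α | p.1 = p.2}]
    (by simp [inSuper_ext hS]) (by
      intro x hx y hy hx' hy'
      obtain ⟨a, -, rfl⟩ := mem_ext.1 hx
      obtain ⟨b, -, rfl⟩ := mem_ext.1 hy
      rw [holds_and, holds_imp, holds_imp, holds_mem2 hS (by simp [inSuper_ext hS, inSuper_code])]
      have h : ZFSet.pair (code S a) (code S b) ∈ Coded.ext S {p : α × α | p.1 = p.2} ↔ a = b :=
        code_mem_ext (a := (a, b))
      refine ⟨fun h' => congrArg (code S) (h.1 h'), fun h' => h.2 (code_injective h')⟩) x.2 y.2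
  rw [holds_and, holds_imp, holds_imp, holds_mem2 hT (by
    simp [x.inSuper, y.inSuper, E.inSuper_star _ (inSuper_ext hS _)])] at this
  exact ⟨fun h => Star.ext (this.1 h), fun h => this.2 (congrArg Subtype.val h)⟩

theorem ev_mem_pair {x : E.Star α} {s : E.Star (Set α)} :
    (x.pair s).Ev (fun p => p.1 ∈ p.2) ↔ x.1 ∈ s.1 := by
  have hS := E.isBaseSet_source
  have hT := E.isBaseSet_target
  have := transfer_ball₂ (E := E) (.and (.imp (.mem2 1 0 4) (.mem 1 0))
    (.imp (.mem 1 0) (.mem2 1 0 4))) (isSetIn_ext hS (Set.univ : Set α))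
    (isSetIn_ext hS (Set.univ : Set (Set α))) [Coded.ext S {p : α × Set α | p.1 ∈ p.2}]
    (by simp [inSuper_ext hS]) (by
      intro x hx y hy hx' hy'
      obtain ⟨a, -, rfl⟩ := mem_ext.1 hx
      obtain ⟨b, -, rfl⟩ := mem_ext.1 hy
      rw [holds_and, holds_imp, holds_imp, holds_mem2 hS (by simp [inSuper_ext hS, inSuper_code])]
      have h : ZFSet.pair (code S a) (code S b) ∈ Coded.ext S {p : α × Set α | p.1 ∈ p.2} ↔ a ∈ b :=
        code_mem_ext (a := (a, b))
      have h' : code S a ∈ code S b ↔ a ∈ b := code_mem_ext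
      exact ⟨fun h1 => h'.2 (h.1 h1), fun h1 => h.2 (h'.1 h1)⟩) x.2 s.2
  rw [holds_and, holds_imp, holds_imp, holds_mem2 hT (by
    simp [x.inSuper, s.inSuper, E.inSuper_star _ (inSuper_ext hS _)])] at this
  exact ⟨this.1, this.2⟩

/-! ### Functions -/

theorem exists_map (f : α → β) (x : E.Star α) :
    ∃ y : E.Star β, (x.pair y).Ev fun p => f p.1 = p.2 :=
  ev_exists.1 (.of_forall (fun a => ⟨f a, rfl⟩) x)

/-- The nonstandard extension of a function. -/
def map (f : α → β) (x : E.Star α) : E.Star β := (exists_map f x).choose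

theorem map_spec (f : α → β) (x : E.Star α) : (x.pair (map f x)).Ev fun p => f p.1 = p.2 :=
  (exists_map f x).choose_spec

/-- The graph of `f` is single-valued, and this transfers; hence the value picked by choice in `map`
is the only one. -/
theorem map_eq_iff {f : α → β} {x : E.Star α} {y : E.Star β} :
    map f x = y ↔ (x.pair y).Ev fun p => f p.1 = p.2 := by
  refine ⟨fun h => h ▸ map_spec f x, fun h => ?_⟩
  have hS := E.isBaseSet_source
  have hT := E.isBaseSet_target
  have := transfer_ball₂ (E := E) (.ball 3 (.imp (.and (.mem2 2 1 5) (.mem2 2 0 5)) (.eq 1 0)))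
    (isSetIn_ext hS (Set.univ : Set α)) (isSetIn_ext hS (Set.univ : Set β))
    [Coded.ext S {p : α × β | f p.1 = p.2}]
    (by simp [inSuper_ext hS]) (by
      intro x hx y hy hx' hy'
      obtain ⟨a, -, rfl⟩ := mem_ext.1 hx
      obtain ⟨b, -, rfl⟩ := mem_ext.1 hy
      rw [holds_ball]
      intro z hz' hz
      obtain ⟨c, -, rfl⟩ := mem_ext.1 (show z ∈ Coded.ext S _ from hz)
      rw [holds_imp, holds_and, holds_mem2 hS (by simp [inSuper_ext hS, inSuper_code]),
        holds_mem2 hS (by simp [inSuper_ext hS, inSuper_code])]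
      rintro ⟨h1, h2⟩
      have h1' : f a = b := code_mem_ext (a := (a, b)).1 h1
      have h2' : f a = c := code_mem_ext (a := (a, c)).1 h2
      exact congrArg (code S) (h1'.symm.trans h2')) x.2 (map f x).2
  rw [holds_ball] at this
  have := this y.1 y.inSuper y.2
  rw [holds_imp, holds_and, holds_mem2 hT (by
    simp [x.inSuper, y.inSuper, (map f x).inSuper, E.inSuper_star _ (inSuper_ext hS _)]),
    holds_mem2 hT (by
    simp [x.inSuper, y.inSuper, (map f x).inSuper, E.inSuper_star _ (inSuper_ext hS _)])] at this
  exact Star.ext (this ⟨map_spec f x, h⟩)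

@[simp] theorem ev_map {f : α → β} {x : E.Star α} {P : β → Prop} :
    (map f x).Ev P ↔ x.Ev fun a => P (f a) := by
  have hS := E.isBaseSet_source
  have hT := E.isBaseSet_target
  have := transfer_ball₂ (E := E) (.imp (.mem2 1 0 4) (.and (.imp (.mem 0 5) (.mem 1 6))
    (.imp (.mem 1 6) (.mem 0 5))))
    (isSetIn_ext hS (Set.univ : Set α)) (isSetIn_ext hS (Set.univ : Set β))
    [Coded.ext S {p : α × β | f p.1 = p.2}, Coded.ext S {b | P b}, Coded.ext S {a | P (f a)}]
    (by simp [inSuper_ext hS]) (by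
      intro x hx y hy hx' hy'
      obtain ⟨a, -, rfl⟩ := mem_ext.1 hx
      obtain ⟨b, -, rfl⟩ := mem_ext.1 hy
      rw [holds_imp, holds_and, holds_mem2 hS (by simp [inSuper_ext hS, inSuper_code])]
      intro h
      have h' : f a = b := code_mem_ext (a := (a, b)).1 h
      subst h'
      simp) x.2 (map f x).2
  rw [holds_imp, holds_and, holds_mem2 hT (by
    simp [x.inSuper, (map f x).inSuper, E.inSuper_star _ (inSuper_ext hS _)])] at this
  have := this (map_spec f x)
  rw [holds_imp, holds_imp] at this
  exact ⟨this.1, this.2⟩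

@[simp] theorem map_map (g : β → γ) (f : α → β) (x : E.Star α) :
    map g (map f x) = map (fun a => g (f a)) x := by
  symm
  rw [map_eq_iff]
  have hS := E.isBaseSet_source
  have hT := E.isBaseSet_target
  have := transfer_ball₂ (E := E) (.ball 4 (.imp (.and (.mem2 2 1 6) (.mem2 1 0 7)) (.mem2 2 0 8)))
    (isSetIn_ext hS (Set.univ : Set α)) (isSetIn_ext hS (Set.univ : Set β))
    [Coded.ext S (Set.univ : Set γ), Coded.ext S {p : α × β | f p.1 = p.2},
      Coded.ext S {p : β × γ | g p.1 = p.2}, Coded.ext S {p : α × γ | g (f p.1) = p.2}]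
    (by simp [inSuper_ext hS]) (by
      intro x hx y hy hx' hy'
      obtain ⟨a, -, rfl⟩ := mem_ext.1 hx
      obtain ⟨b, -, rfl⟩ := mem_ext.1 hy
      rw [holds_ball]
      intro z hz' hz
      obtain ⟨c, -, rfl⟩ := mem_ext.1 (show z ∈ Coded.ext S _ from hz)
      rw [holds_imp, holds_and, holds_mem2 hS (by simp [inSuper_ext hS, inSuper_code]),
        holds_mem2 hS (by simp [inSuper_ext hS, inSuper_code]),
        holds_mem2 hS (by simp [inSuper_ext hS, inSuper_code])]
      rintro ⟨h1, h2⟩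
      have h1' : f a = b := code_mem_ext (a := (a, b)).1 h1
      have h2' : g b = c := code_mem_ext (a := (b, c)).1 h2
      exact code_mem_ext (a := (a, c)).2 ((congrArg g h1').trans h2')) x.2 (map f x).2
  rw [holds_ball] at this
  have := this (map g (map f x)).1 (map g (map f x)).inSuper (map g (map f x)).2
  have hl : ∀ l : List ZFSet.{u}, (∀ x ∈ l, InSuper S x) → ∀ y ∈ (map g (map f x)).1 ::
      (map f x).1 :: x.1 :: E.star (Coded.ext S (Set.univ : Set α)) ::
      E.star (Coded.ext S (Set.univ : Set β)) :: l.map E.star, InSuper T y := by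
    intro l hl
    simp only [List.forall_mem_cons]
    exact ⟨(map g (map f x)).inSuper, (map f x).inSuper, x.inSuper,
      E.inSuper_star _ (inSuper_ext hS _), E.inSuper_star _ (inSuper_ext hS _),
      inSuper_map_star hl⟩
  rw [holds_imp, holds_and, holds_mem2 hT (hl _ (by simp [inSuper_ext hS])),
    holds_mem2 hT (hl _ (by simp [inSuper_ext hS])),
    holds_mem2 hT (hl _ (by simp [inSuper_ext hS]))] at this
  exact this ⟨map_spec f x, map_spec g _⟩

@[simp] theorem map_id (x : E.Star α) : map (fun a => a) x = x :=
  map_eq_iff.2 (ev_eq_pair.2 rfl)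

@[simp] theorem ev_eq {f g : α → β} {x : E.Star α} :
    x.Ev (fun a => f a = g a) ↔ map f x = map g x := by
  constructor
  · intro h
    have h1 : ∀ y : E.Star β, (x.pair y).Ev (fun p => f p.1 = p.2) →
        (x.pair y).Ev (fun p => g p.1 = p.2) := by
      intro y hy
      have := ev_forall.1 (h.mono (Q := fun a => ∀ b, f a = b → g a = b)
        fun a (ha : f a = g a) b hb => ha ▸ hb) y
      exact ev_imp.1 this hy
    exact (map_eq_iff.2 (h1 _ (map_spec f x))).symm
  · intro h
    have h2 := map_spec g x
    rw [← h] at h2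
    have h1 := map_spec f x
    exact (ev_exists (P := fun a b => f a = b ∧ g a = b)).2 ⟨_, ev_and.2 ⟨h1, h2⟩⟩ |>.mono
      fun a ⟨b, h1, h2⟩ => h1.trans h2.symm

theorem ev_fst (z : E.Star (α × β)) : (z.pair z.fst).Ev fun p => p.1.1 = p.2 := by
  have hS := E.isBaseSet_source
  have hT := E.isBaseSet_target
  have := transfer_ball₂ (E := E) (.ball 4 (.imp (.pair 0 2 1) (.mem2 0 2 6)))
    (isSetIn_ext hS (Set.univ : Set α)) (isSetIn_ext hS (Set.univ : Set β))
    [Coded.ext S (Set.univ : Set (α × β)), Coded.ext S {p : (α × β) × α | p.1.1 = p.2}]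
    (by simp [inSuper_ext hS]) (by
      intro x hx y hy hx' hy'
      obtain ⟨a, -, rfl⟩ := mem_ext.1 hx
      obtain ⟨b, -, rfl⟩ := mem_ext.1 hy
      rw [holds_ball]
      intro z hz' hz
      rw [holds_imp, holds_pair hS (by simp [inSuper_ext hS, inSuper_code, hz']),
        holds_mem2 hS (by simp [inSuper_ext hS, inSuper_code, hz'])]
      intro h
      have h' : z = code S (a, b) := h
      subst h'
      exact code_mem_ext (a := ((a, b), a)).2 rfl) z.fst.2 z.snd.2
  rw [holds_ball] at this
  have := this z.1 z.inSuper z.2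
  rw [holds_imp, holds_pair hT (by
    simp [z.fst.inSuper, z.snd.inSuper, z.inSuper, E.inSuper_star _ (inSuper_ext hS _)]),
    holds_mem2 hT (by
    simp [z.fst.inSuper, z.snd.inSuper, z.inSuper, E.inSuper_star _ (inSuper_ext hS _)])] at this
  exact this (congrArg Subtype.val (pair_fst_snd z).symm)

theorem ev_snd (z : E.Star (α × β)) : (z.pair z.snd).Ev fun p => p.1.2 = p.2 := by
  have hS := E.isBaseSet_source
  have hT := E.isBaseSet_target
  have := transfer_ball₂ (E := E) (.ball 4 (.imp (.pair 0 2 1) (.mem2 0 1 6)))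
    (isSetIn_ext hS (Set.univ : Set α)) (isSetIn_ext hS (Set.univ : Set β))
    [Coded.ext S (Set.univ : Set (α × β)), Coded.ext S {p : (α × β) × β | p.1.2 = p.2}]
    (by simp [inSuper_ext hS]) (by
      intro x hx y hy hx' hy'
      obtain ⟨a, -, rfl⟩ := mem_ext.1 hx
      obtain ⟨b, -, rfl⟩ := mem_ext.1 hy
      rw [holds_ball]
      intro z hz' hz
      rw [holds_imp, holds_pair hS (by simp [inSuper_ext hS, inSuper_code, hz']),
        holds_mem2 hS (by simp [inSuper_ext hS, inSuper_code, hz'])]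
      intro h
      have h' : z = code S (a, b) := h
      subst h'
      exact code_mem_ext (a := ((a, b), b)).2 rfl) z.fst.2 z.snd.2
  rw [holds_ball] at this
  have := this z.1 z.inSuper z.2
  rw [holds_imp, holds_pair hT (by
    simp [z.fst.inSuper, z.snd.inSuper, z.inSuper, E.inSuper_star _ (inSuper_ext hS _)]),
    holds_mem2 hT (by
    simp [z.fst.inSuper, z.snd.inSuper, z.inSuper, E.inSuper_star _ (inSuper_ext hS _)])] at this
  exact this (congrArg Subtype.val (pair_fst_snd z).symm)

@[simp] theorem map_fst (f : γ → α × β) (x : E.Star γ) :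
    map (fun c => (f c).1) x = (map f x).fst := by
  rw [← map_map Prod.fst f]
  exact map_eq_iff.2 (ev_fst _)

@[simp] theorem map_snd (f : γ → α × β) (x : E.Star γ) :
    map (fun c => (f c).2) x = (map f x).snd := by
  rw [← map_map Prod.snd f]
  exact map_eq_iff.2 (ev_snd _)

@[simp] theorem map_prodMk (f : γ → α) (g : γ → β) (x : E.Star γ) :
    map (fun c => (f c, g c)) x = (map f x).pair (map g x) := by
  rw [← pair_fst_snd (map (fun c => (f c, g c)) x), ← map_fst, ← map_snd]

@[simp] theorem ev_mem {f : α → β} {g : α → Set β} {x : E.Star α} :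
    x.Ev (fun a => f a ∈ g a) ↔ (map f x).1 ∈ (map g x).1 := by
  rw [← ev_mem_pair, ← map_prodMk, ev_map]

@[simp] theorem map_const (b : β) (x : E.Star α) :
    (map (fun _ => b) x).1 = E.star (code S b) := by
  have hS := E.isBaseSet_source
  have hb : E.star (code S b) ∈ E.star (Coded.ext S {b' | b' = b}) :=
    (star_mem_star (inSuper_code b) (inSuper_ext hS _)).2 (code_mem_ext.2 rfl)
  have : map (fun _ => b) x = ofMem hb := by
    rw [map_eq_iff]
    have h : (ofMem hb).Ev (fun b' => b' = b) := hb
    have h2 : (x.pair (ofMem hb)).snd.Ev (fun b' => b' = b) := by rwa [snd_pair]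
    have h3 := map_snd (fun p : α × β => p) (x.pair (ofMem hb))
    rw [map_id] at h3
    rw [← h3, ev_map] at h2
    exact h2.mono fun p hp => hp.symm
  rw [this]
  rfl

/-! ### Internal sets -/

/-- `Holds` quantifies over entities of the superstructure only, which is the reason for `InSuper T
x`. It becomes automatic in `set_subset`, once `set_notMem` has excluded that `s` is an individual.
-/
theorem mem_univ_of_mem {s : E.Star (Set α)} {x : ZFSet.{u}} (hx : x ∈ s.1) (hx' : InSuper T x) :
    x ∈ E.star (Coded.ext S (Set.univ : Set α)) := by
  have hS := E.isBaseSet_source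
  have := transfer_ball (E := E) (.ball 0 (.mem 0 3))
    (isSetIn_ext hS (Set.univ : Set (Set α))) [Coded.ext S (Set.univ : Set α)]
    (by simp [inSuper_ext hS]) (by
      intro y hy hy'
      obtain ⟨R, -, rfl⟩ := mem_ext.1 hy
      intro z hz' hz
      obtain ⟨a, -, rfl⟩ := mem_ext.1 (show z ∈ Coded.ext S R from hz)
      simp) s.2
  exact this x hx' hx

theorem set_notMem (s : E.Star (Set α)) : s.1 ∉ T := by
  have hS := E.isBaseSet_source
  have := transfer_ball (E := E) (.neg (.mem 0 2))
    (isSetIn_ext hS (Set.univ : Set (Set α))) [S]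
    (by simp [inSuper_base hS]) (by
      intro y hy hy'
      obtain ⟨R, -, rfl⟩ := mem_ext.1 hy
      exact (isSetIn_ext hS R).2) s.2
  simpa [E.star_base] using this

theorem isSetIn_set (s : E.Star (Set α)) : IsSetIn T s.1 := ⟨s.inSuper, s.set_notMem⟩

theorem set_subset (s : E.Star (Set α)) : s.1 ⊆ E.star (Coded.ext S (Set.univ : Set α)) :=
  fun _ hx => mem_univ_of_mem hx (s.isSetIn_set.inSuper_of_mem hx)

theorem internal (x : E.Star α) : E.Internal x.1 := ⟨_, isSetIn_ext E.isBaseSet_source _, x.2⟩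

theorem mem_of_internal {x : ZFSet.{u}} (h : E.Internal x) (hx : x ∉ T)
    (hsub : x ⊆ E.star (Coded.ext S (Set.univ : Set α))) :
    x ∈ E.star (Coded.ext S (Set.univ : Set (Set α))) := by
  rw [ext_univ_set]
  exact h.mem_star_powerset hx (isSetIn_ext E.isBaseSet_source _) hsub

/-- Elements with the same codes correspond to each other. -/
theorem map_val_of_code {f : α → β} (h : ∀ a, code S (f a) = code S a) (x : E.Star α) :
    (map f x).1 = x.1 := by
  have hS := E.isBaseSet_source
  have hT := E.isBaseSet_target
  have := transfer_ball₂ (E := E) (.imp (.mem2 1 0 4) (.eq 0 1))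
    (isSetIn_ext hS (Set.univ : Set α)) (isSetIn_ext hS (Set.univ : Set β))
    [Coded.ext S {p : α × β | f p.1 = p.2}]
    (by simp [inSuper_ext hS]) (by
      intro x hx y hy hx' hy'
      obtain ⟨a, -, rfl⟩ := mem_ext.1 hx
      obtain ⟨b, -, rfl⟩ := mem_ext.1 hy
      rw [holds_imp, holds_mem2 hS (by simp [inSuper_ext hS, inSuper_code])]
      intro h'
      have h1 : f a = b := code_mem_ext (a := (a, b)).1 h'
      exact h1 ▸ h a) x.2 (map f x).2
  rw [holds_imp, holds_mem2 hT (by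
    simp [x.inSuper, (map f x).inSuper, E.inSuper_star _ (inSuper_ext hS _)])] at this
  exact this (map_spec f x)

end Star

end NonstandardEmbedding

/-! ## Orders in Dedekind domains -/

section Dedekind

variable {R : Type*} [CommRing R]

/-- The exponent of `𝔪` in the factorization of `x`. -/
def ordAt (𝔪 : Ideal R) (x : R) : ℕ := multiplicity 𝔪 (Ideal.span {x})

variable [IsDedekindDomain R] {𝔪 : Ideal R}

/-- A proper ideal divides a nonzero ideal to a finite order only. At `x = 0` the multiplicity is a
default value, whence the conditions `x ≠ 0` in most statements on orders. -/
theorem mem_pow_iff_le_ordAt (h𝔪 : 𝔪.IsMaximal) {x : R} (hx : x ≠ 0) {n : ℕ} :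
    x ∈ 𝔪 ^ n ↔ n ≤ ordAt 𝔪 x := by
  have h : FiniteMultiplicity 𝔪 (Ideal.span {x}) := by
    apply FiniteMultiplicity.of_not_isUnit
    · rw [Ideal.isUnit_iff]
      exact h𝔪.ne_top
    · simpa using hx
  rw [← Ideal.dvd_span_singleton, h.pow_dvd_iff_le_multiplicity]
  rfl

theorem ordAt_eq_iff (h𝔪 : 𝔪.IsMaximal) {x : R} (hx : x ≠ 0) {n : ℕ} :
    ordAt 𝔪 x = n ↔ x ∈ 𝔪 ^ n ∧ x ∉ 𝔪 ^ (n + 1) := by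
  rw [mem_pow_iff_le_ordAt h𝔪 hx, mem_pow_iff_le_ordAt h𝔪 hx]
  omega

theorem ordAt_ne_zero_iff (h𝔪 : 𝔪.IsMaximal) {x : R} (hx : x ≠ 0) :
    ordAt 𝔪 x ≠ 0 ↔ x ∈ 𝔪 := by
  have := mem_pow_iff_le_ordAt h𝔪 hx (n := 1)
  rw [pow_one] at this
  rw [this]
  omega

theorem ordAt_mul (h𝔪 : 𝔪.IsMaximal) (h0 : 𝔪 ≠ ⊥) {x y : R} (hx : x ≠ 0) (hy : y ≠ 0) :
    ordAt 𝔪 (x * y) = ordAt 𝔪 x + ordAt 𝔪 y := by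
  have hp : Prime 𝔪 := Ideal.prime_of_isPrime h0 h𝔪.isPrime
  rw [ordAt, ordAt, ordAt, ← Ideal.span_singleton_mul_span_singleton]
  apply multiplicity_mul hp
  apply FiniteMultiplicity.of_not_isUnit hp.not_isUnit
  simpa using ⟨hx, hy⟩

/-- Unique factorization of ideals: `(x)` divides `(y)` as soon as every prime power dividing `(x)`
divides `(y)`, and for principal ideals this is divisibility of the generators. -/
theorem dvd_of_ordAt_le {x y : R} (hx : x ≠ 0) (hy : y ≠ 0)
    (h : ∀ 𝔪 : Ideal R, 𝔪.IsMaximal → 𝔪 ≠ ⊥ → ordAt 𝔪 x ≤ ordAt 𝔪 y) : x ∣ y := by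
  rw [← Ideal.mem_span_singleton, ← Ideal.dvd_span_singleton]
  have hx' : Ideal.span {x} ≠ 0 := by simpa using hx
  rw [UniqueFactorizationMonoid.dvd_iff_emultiplicity_le hx']
  intro p hp
  have hp' := Ideal.isPrime_of_prime hp
  have hm := hp'.isMaximal hp.ne_zero
  apply emultiplicity_le_emultiplicity_iff.2
  intro n hn
  rw [Ideal.dvd_span_singleton, mem_pow_iff_le_ordAt hm] at hn ⊢
  · exact hn.trans (h p hm hp.ne_zero)
  · exact hy
  · exact hx

theorem finite_setOf_mem {x : R} (hx : x ≠ 0) :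
    {𝔪 : Ideal R | 𝔪.IsMaximal ∧ 𝔪 ≠ ⊥ ∧ x ∈ 𝔪}.Finite := by
  have := Ideal.finite_factors (R := R) (I := Ideal.span {x}) (by simpa using hx)
  refine (this.image IsDedekindDomain.HeightOneSpectrum.asIdeal).subset ?_
  rintro 𝔪 ⟨h1, h2, h3⟩
  exact ⟨⟨𝔪, h1.isPrime, h2⟩, by simpa [Ideal.dvd_span_singleton] using h3, rfl⟩

theorem exists_sub_mem_pow (s : Set (Ideal R)) (hs : s.Finite)
    (h : ∀ 𝔪 ∈ s, 𝔪.IsMaximal ∧ 𝔪 ≠ ⊥) (n : Ideal R → ℕ) (x : Ideal R → R) :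
    ∃ y, ∀ 𝔪 ∈ s, y - x 𝔪 ∈ 𝔪 ^ n 𝔪 := by
  obtain ⟨y, hy⟩ := IsDedekindDomain.exists_forall_sub_mem_ideal (s := hs.toFinset) id n
    (fun i hi => by
      obtain ⟨h1, h2⟩ := h i (hs.mem_toFinset.1 hi)
      exact Ideal.prime_of_isPrime h2 h1.isPrime)
    (fun i _ j _ hij => hij) (fun i => x i)
  exact ⟨y, fun 𝔪 h𝔪 => hy 𝔪 (hs.mem_toFinset.2 h𝔪)⟩

/-- By the Chinese remainder theorem at the finitely many primes containing `c`, take `e ≡ 0` at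
those in `H` and `e ≡ 1` at the others. Elsewhere `c` has order zero and nothing is required, so `H`
may be any set. The element `e` is idempotent modulo `c`. -/
theorem exists_idempotent_mod {c : R} (hc : c ≠ 0) (H : Set (Ideal R)) :
    ∃ e, ∀ 𝔪 : Ideal R, 𝔪.IsMaximal → 𝔪 ≠ ⊥ →
      (𝔪 ∈ H → e ≠ 0 → ordAt 𝔪 c ≤ ordAt 𝔪 e) ∧
      (𝔪 ∉ H → 1 - e ≠ 0 → ordAt 𝔪 c ≤ ordAt 𝔪 (1 - e)) := by
  classical
  obtain ⟨e, he⟩ := exists_sub_mem_pow _ (finite_setOf_mem hc) (fun 𝔪 h => ⟨h.1, h.2.1⟩)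
    (fun 𝔪 => ordAt 𝔪 c) (fun 𝔪 => if 𝔪 ∈ H then 0 else 1)
  refine ⟨e, fun 𝔪 h1 h2 => ?_⟩
  by_cases hm : c ∈ 𝔪
  · have := he 𝔪 ⟨h1, h2, hm⟩
    split_ifs at this with h
    · rw [sub_zero] at this
      exact ⟨fun _ h0 => (mem_pow_iff_le_ordAt h1 h0).1 this, fun h' => absurd h h'⟩
    · rw [← neg_mem_iff, neg_sub] at this
      exact ⟨fun h' => absurd h' h, fun _ h0 => (mem_pow_iff_le_ordAt h1 h0).1 this⟩
  · have : ordAt 𝔪 c = 0 := by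
      by_contra h
      exact hm ((ordAt_ne_zero_iff h1 hc).1 h)
    simp [this]

/-- Choose at each `𝔪` an element of exact order `n 𝔪` and glue by the Chinese remainder theorem. -/
theorem exists_ordAt_eq (H : Set (Ideal R)) (hH : H.Finite)
    (h : ∀ 𝔪 ∈ H, 𝔪.IsMaximal ∧ 𝔪 ≠ ⊥) (n : Ideal R → ℕ) :
    ∃ a ≠ 0, ∀ 𝔪 ∈ H, ordAt 𝔪 a = n 𝔪 := by
  -- For empty `H` the congruences would not exclude `a = 0`.
  rcases H.eq_empty_or_nonempty with rfl | ⟨𝔪₀, h₀⟩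
  · exact ⟨1, one_ne_zero, by simp⟩
  have : ∀ 𝔪 : Ideal R, ∃ x, 𝔪 ∈ H → x ∈ 𝔪 ^ n 𝔪 ∧ x ∉ 𝔪 ^ (n 𝔪 + 1) := by
    intro 𝔪
    by_cases h𝔪 : 𝔪 ∈ H
    · obtain ⟨h1, h2⟩ := h 𝔪 h𝔪
      obtain ⟨x, hx⟩ := Ideal.exists_mem_pow_notMem_pow_succ 𝔪 h2 h1.ne_top (n 𝔪)
      exact ⟨x, fun _ => hx⟩
    · exact ⟨0, fun h => absurd h h𝔪⟩
  choose x hx using this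
  -- The exponent `n 𝔪 + 1` ensures that non-membership in `𝔪 ^ (n 𝔪 + 1)` is preserved, and not
  -- only membership in `𝔪 ^ n 𝔪`.
  obtain ⟨a, ha⟩ := exists_sub_mem_pow H hH h (fun 𝔪 => n 𝔪 + 1) x
  have key : ∀ 𝔪 ∈ H, a ∈ 𝔪 ^ n 𝔪 ∧ a ∉ 𝔪 ^ (n 𝔪 + 1) := by
    intro 𝔪 h𝔪
    refine ⟨?_, fun h => (hx 𝔪 h𝔪).2 ?_⟩
    · have := (𝔪 ^ n 𝔪).add_mem (Ideal.pow_le_pow_right (Nat.le_succ _) (ha 𝔪 h𝔪)) (hx 𝔪 h𝔪).1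
      rwa [sub_add_cancel] at this
    · have := (𝔪 ^ (n 𝔪 + 1)).sub_mem h (ha 𝔪 h𝔪)
      rwa [sub_sub_cancel] at this
  have ha0 : a ≠ 0 := fun h0 => (key 𝔪₀ h₀).2 (h0 ▸ Ideal.zero_mem _)
  exact ⟨a, ha0, fun 𝔪 h𝔪 => (ordAt_eq_iff (h 𝔪 h𝔪).1 ha0).2 (key 𝔪 h𝔪)⟩

/-- A nonzero ideal of a Dedekind domain has two generators, so sums with two terms suffice for
every `n`, with the same `g` and `h`. This uniform bound survives transfer, whereas sums of
arbitrary finite length would turn into hyperfinite sums. -/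
theorem exists_pow_succ_generators (h0 : 𝔪 ≠ ⊥) : ∃ g ∈ 𝔪, ∃ h ∈ 𝔪, ∀ (n : ℕ), ∀ x ∈ 𝔪 ^ (n + 1),
    ∃ y ∈ 𝔪 ^ n, ∃ z ∈ 𝔪 ^ n, x = y * g + z * h := by
  obtain ⟨g, hg, hg0⟩ := Submodule.exists_mem_ne_zero_of_ne_bot h0
  obtain ⟨h, hh⟩ := IsDedekindDomain.exists_eq_span_pair hg hg0
  have hh𝔪 : h ∈ 𝔪 := hh ▸ Ideal.subset_span (by simp)
  refine ⟨g, hg, h, hh𝔪, fun n x hx => ?_⟩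
  rw [pow_succ] at hx
  induction hx using Submodule.mul_induction_on' with
  | mem_mul_mem m hm k hk =>
    rw [hh, Ideal.mem_span_pair] at hk
    obtain ⟨a, b, rfl⟩ := hk
    exact ⟨m * a, Ideal.mul_mem_right _ _ hm, m * b, Ideal.mul_mem_right _ _ hm, by ring⟩
  | add x _ y _ hx hy =>
    obtain ⟨a, ha, b, hb, rfl⟩ := hx
    obtain ⟨c, hc, d, hd, rfl⟩ := hy
    exact ⟨a + c, Ideal.add_mem _ ha hc, b + d, Ideal.add_mem _ hb hd, by ring⟩

/-- For `a ≠ 0` the fractional ideal `I = (a, b)` is invertible, so `1 = a x + b y` with `x, y ∈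
I⁻¹`, and the products of `a`, `b` with `x`, `y` lie in `R`. This form of the Prüfer property
quantifies over elements only. -/
theorem exists_add_eq_one_mul_eq_mul (a b : R) :
    ∃ s t y z : R, s + t = 1 ∧ s * a = y * b ∧ t * b = z * a := by
  by_cases ha : a = 0
  · exact ⟨1, 0, 0, 0, by simp [ha]⟩
  let K := FractionRing R
  let I : FractionalIdeal (nonZeroDivisors R) K := (Ideal.span {a, b} : Ideal R)
  have hI : I ≠ 0 := by
    rw [FractionalIdeal.coeIdeal_ne_zero]
    intro h
    have : a ∈ (⊥ : Ideal R) := h ▸ Ideal.subset_span (by simp)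
    exact ha (by simpa using this)
  have h1 : I * I⁻¹ = 1 := mul_inv_cancel₀ hI
  have hint : ∀ x ∈ I⁻¹, ∀ c ∈ Ideal.span {a, b}, ∃ y : R, algebraMap R K y = algebraMap R K c * x := by
    intro x hx c hc
    have := FractionalIdeal.mul_mem_mul (I := I) (FractionalIdeal.mem_coeIdeal_of_mem _ hc) hx
    rw [h1] at this
    exact (FractionalIdeal.mem_one_iff _).1 this
  have hone : (1 : K) ∈ I * I⁻¹ := h1 ▸ FractionalIdeal.one_mem_one _
  -- Since `I` is generated by `a` and `b`, a sum of products from `I * I⁻¹` can be collected into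
  -- two terms.
  have key : ∀ z ∈ I * I⁻¹, ∃ x ∈ I⁻¹, ∃ y ∈ I⁻¹,
      z = algebraMap R K a * x + algebraMap R K b * y := by
    intro z hz
    refine FractionalIdeal.mul_induction_on hz ?_ ?_
    · intro i hi j hj
      obtain ⟨c, hc, rfl⟩ := (FractionalIdeal.mem_coeIdeal _).1 hi
      obtain ⟨p, q, rfl⟩ := Ideal.mem_span_pair.1 hc
      refine ⟨p • j, Submodule.smul_mem _ _ hj, q • j, Submodule.smul_mem _ _ hj, ?_⟩
      simp only [Algebra.smul_def, map_add, map_mul]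
      ring
    · rintro x y ⟨p, hp, q, hq, rfl⟩ ⟨p', hp', q', hq', rfl⟩
      exact ⟨p + p', Submodule.add_mem _ hp hp', q + q', Submodule.add_mem _ hq hq', by ring⟩
  obtain ⟨x, hx, y, hy, h⟩ := key 1 hone
  have haI : a ∈ Ideal.span {a, b} := Ideal.subset_span (by simp)
  have hbI : b ∈ Ideal.span {a, b} := Ideal.subset_span (by simp)
  obtain ⟨ax, hax⟩ := hint x hx a haI
  obtain ⟨bx, hbx⟩ := hint x hx b hbI
  obtain ⟨ay, hay⟩ := hint y hy a haI
  obtain ⟨by', hby⟩ := hint y hy b hbI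
  have inj := IsFractionRing.injective R K
  -- With `s = b y` and `t = a x` one has `s a = (a y) b` and `t b = (b x) a`.
  refine ⟨by', ax, ay, bx, inj ?_, inj ?_, inj ?_⟩
  · rw [map_add, map_one, hax, hby, h, add_comm]
  · rw [map_mul, map_mul, hby, hay]; ring
  · rw [map_mul, map_mul, hax, hbx]; ring

end Dedekind

/-! ## Valuations of Prüfer domains -/

section Valuations

variable {B : Type*} {L : Type w} [CommRing B] [Field L] [Algebra B L]

/-- The center of a valuation. -/
def CenteredValuation.center (v : CenteredValuation B L) : Ideal B where
  carrier := {a | v.v (algebraMap B L a) < 1}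
  add_mem' {a b} ha hb := by
    simp only [Set.mem_ofPred_eq, map_add] at *
    exact v.v.map_add_lt ha hb
  zero_mem' := by simp
  smul_mem' c a ha := by
    simp only [Set.mem_ofPred_eq, smul_eq_mul, map_mul] at *
    exact mul_lt_one_of_nonneg_of_lt_one_right (v.le_one c) zero_le ha

theorem CenteredValuation.mem_center {v : CenteredValuation B L} {a : B} :
    a ∈ v.center ↔ v.v (algebraMap B L a) < 1 := Iff.rfl

theorem CenteredValuation.val_eq_one {v : CenteredValuation B L} {a : B} (h : a ∉ v.center) :
    v.v (algebraMap B L a) = 1 :=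
  le_antisymm (v.le_one a) (not_lt.1 h)

theorem CenteredValuation.center_isPrime (v : CenteredValuation B L) : v.center.IsPrime := by
  refine Ideal.isPrime_iff.2 ⟨fun h => ?_, fun {x y} hxy => ?_⟩
  · have : (1 : B) ∈ v.center := h ▸ Submodule.mem_top
    simp [mem_center] at this
  · by_contra! h
    rw [mem_center, map_mul, map_mul, val_eq_one h.1, val_eq_one h.2] at hxy
    simp at hxy

variable [IsFractionRing B L]

/-- With zero center, `v` would be `1` on all nonzero elements of `B`, hence on all nonzero
fractions. -/
theorem CenteredValuation.center_ne_bot (v : CenteredValuation B L) : v.center ≠ ⊥ := by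
  intro h
  obtain ⟨x, hx0, hx1⟩ := v.nontrivial.exists_val_nontrivial
  obtain ⟨a, b, hb, rfl⟩ := IsFractionRing.div_surjective (A := B) x
  have := (algebraMap B L).domain_nontrivial
  have hv : ∀ c : B, c ≠ 0 → v.v (algebraMap B L c) = 1 := fun c hc =>
    val_eq_one (by rw [h]; simpa using hc)
  have ha : a ≠ 0 := by
    rintro rfl
    simp at hx0
  rw [map_div₀, hv a ha, hv b (nonZeroDivisors.ne_zero hb)] at hx1
  simp at hx1

variable (hB : ∀ a b : B, ∃ s t y z : B, s + t = 1 ∧ s * a = y * b ∧ t * b = z * a)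

include hB

/-- Let `x = a / b` and apply `hB`. If `s` is outside the center, then `x = y / s`. Otherwise `t` is
outside and `x = t / z`; here `v b = v z * v a`, and `v x ≤ 1` prevents `z` from lying in the
center. -/
theorem CenteredValuation.le_one_iff (v : CenteredValuation B L) (x : L) : v.v x ≤ 1 ↔
    ∃ a s : B, s ∉ v.center ∧ x = algebraMap B L a / algebraMap B L s := by
  constructor
  · intro hx
    obtain ⟨a, b, hb, rfl⟩ := IsFractionRing.div_surjective (A := B) x
    have := (algebraMap B L).domain_nontrivial
    have hb0 : algebraMap B L b ≠ 0 :=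
      (map_ne_zero_iff _ (IsFractionRing.injective B L)).2 (nonZeroDivisors.ne_zero hb)
    have hne : ∀ {s}, s ∉ v.center → algebraMap B L s ≠ 0 := by
      intro s hs h0
      have := val_eq_one hs
      rw [h0] at this
      simp at this
    obtain ⟨s, t, y, z, hst, h1, h2⟩ := hB a b
    have h1' := congrArg (algebraMap B L) h1
    have h2' := congrArg (algebraMap B L) h2
    rw [map_mul, map_mul] at h1' h2'
    by_cases hs : s ∈ v.center
    · have ht : t ∉ v.center := fun ht => v.center_isPrime.ne_top
        ((Ideal.eq_top_iff_one _).2 (hst ▸ v.center.add_mem hs ht))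
      refine ⟨t, z, fun hz => ?_, ?_⟩
      · have h3 := congrArg v.v h2'
        rw [map_mul, map_mul, val_eq_one ht, one_mul] at h3
        rw [map_div₀, div_le_one₀ (zero_lt_iff.2 ((v.v.ne_zero_iff).2 hb0)), h3] at hx
        have h4 : v.v (algebraMap B L a) ≠ 0 := by
          intro h0
          rw [h0, mul_zero, v.v.zero_iff] at h3
          exact hb0 h3
        have h5 := mul_lt_mul_of_pos_right (mem_center.1 hz) (zero_lt_iff.2 h4)
        rw [one_mul] at h5
        exact absurd hx (not_le.2 h5)
      · have hz0 : algebraMap B L z ≠ 0 := by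
          intro h0
          rw [h0, zero_mul] at h2'
          exact mul_ne_zero (hne ht) hb0 h2'
        rw [div_eq_div_iff hb0 hz0, h2', mul_comm]
    · refine ⟨y, s, hs, ?_⟩
      rw [div_eq_div_iff hb0 (hne hs), ← h1', mul_comm]
  · rintro ⟨a, s, hs, rfl⟩
    rw [map_div₀, val_eq_one hs, div_one]
    exact v.le_one a

/-- The valuation ring `B_𝔭` in the quotient field. -/
def localValuationSubring (𝔭 : Ideal B) (h𝔭 : 𝔭.IsPrime) : ValuationSubring L where
  carrier := {x | ∃ a s : B, s ∉ 𝔭 ∧ x = algebraMap B L a / algebraMap B L s}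
  mul_mem' := by
    rintro _ _ ⟨a, s, hs, rfl⟩ ⟨b, t, ht, rfl⟩
    refine ⟨a * b, s * t, fun h => (h𝔭.mem_or_mem h).elim hs ht, ?_⟩
    rw [map_mul, map_mul, div_mul_div_comm]
  one_mem' := ⟨1, 1, fun h => h𝔭.ne_top ((Ideal.eq_top_iff_one _).2 h), by simp⟩
  add_mem' := by
    rintro _ _ ⟨a, s, hs, rfl⟩ ⟨b, t, ht, rfl⟩
    have hne : ∀ {s}, s ∉ 𝔭 → algebraMap B L s ≠ 0 := by
      intro s hs h0
      rw [← map_zero (algebraMap B L)] at h0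
      exact hs (IsFractionRing.injective B L h0 ▸ 𝔭.zero_mem)
    refine ⟨a * t + s * b, s * t, fun h => (h𝔭.mem_or_mem h).elim hs ht, ?_⟩
    rw [map_add, map_mul, map_mul, map_mul, div_add_div _ _ (hne hs) (hne ht)]
  zero_mem' := ⟨0, 1, fun h => h𝔭.ne_top ((Ideal.eq_top_iff_one _).2 h), by simp⟩
  neg_mem' := by
    rintro _ ⟨a, s, hs, rfl⟩
    exact ⟨-a, s, hs, by rw [map_neg, neg_div]⟩
  mem_or_inv_mem' x := by
    obtain ⟨a, b, hb, rfl⟩ := IsFractionRing.div_surjective (A := B) x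
    have := (algebraMap B L).domain_nontrivial
    have hb0 : algebraMap B L b ≠ 0 :=
      (map_ne_zero_iff _ (IsFractionRing.injective B L)).2 (nonZeroDivisors.ne_zero hb)
    have hne : ∀ {s}, s ∉ 𝔭 → algebraMap B L s ≠ 0 := by
      intro s hs h0
      rw [← map_zero (algebraMap B L)] at h0
      exact hs (IsFractionRing.injective B L h0 ▸ 𝔭.zero_mem)
    obtain ⟨s, t, y, z, hst, h1, h2⟩ := hB a b
    have h1' := congrArg (algebraMap B L) h1
    have h2' := congrArg (algebraMap B L) h2
    rw [map_mul, map_mul] at h1' h2'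
    -- As `s + t = 1`, one of `s`, `t` is a denominator outside `𝔭`: `s` puts `a / b` into the ring,
    -- `t` its inverse.
    by_cases hs : s ∈ 𝔭
    · have ht : t ∉ 𝔭 := fun ht => h𝔭.ne_top
        ((Ideal.eq_top_iff_one _).2 (hst ▸ 𝔭.add_mem hs ht))
      refine Or.inr ⟨z, t, ht, ?_⟩
      have ha0 : algebraMap B L a ≠ 0 := by
        intro h0
        rw [h0, mul_zero] at h2'
        exact mul_ne_zero (hne ht) hb0 h2'
      rw [inv_div, div_eq_div_iff ha0 (hne ht), ← h2', mul_comm]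
    · refine Or.inl ⟨y, s, hs, ?_⟩
      rw [div_eq_div_iff hb0 (hne hs), ← h1', mul_comm]

/-- For `a ∉ 𝔭` the inverse of `a` lies in the ring. For nonzero `a ∈ 𝔭` a representation `1 / a = c
/ s` would give `s = c a ∈ 𝔭`. -/
theorem localValuation_lt_one_iff {𝔭 : Ideal B} (h𝔭 : 𝔭.IsPrime) (a : B) :
    (localValuationSubring (L := L) hB 𝔭 h𝔭).valuation (algebraMap B L a) < 1 ↔ a ∈ 𝔭 := by
  set A := localValuationSubring (L := L) hB 𝔭 h𝔭
  constructor
  · intro h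
    by_contra ha
    have h1 : (algebraMap B L a)⁻¹ ∈ A := ⟨1, a, ha, by simp⟩
    have h2 := (A.valuation_le_one_iff _).2 h1
    rw [map_inv₀] at h2
    have h3 : A.valuation (algebraMap B L a) ≠ 0 := by
      rw [Valuation.ne_zero_iff]
      intro h0
      rw [← map_zero (algebraMap B L)] at h0
      exact ha (IsFractionRing.injective B L h0 ▸ 𝔭.zero_mem)
    rw [inv_le_one₀ (zero_lt_iff.2 h3)] at h2
    exact absurd h (not_lt.2 h2)
  · intro ha
    by_contra h
    rw [not_lt] at h
    have h3 : A.valuation (algebraMap B L a) ≠ 0 := fun h0 => by rw [h0] at h; simp at h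
    have h4 : algebraMap B L a ≠ 0 := (Valuation.ne_zero_iff _).1 h3
    rw [← inv_le_one₀ (zero_lt_iff.2 h3), ← map_inv₀, A.valuation_le_one_iff] at h
    obtain ⟨c, s, hs, h⟩ := h
    have hs0 : algebraMap B L s ≠ 0 := by
      intro h0
      rw [← map_zero (algebraMap B L)] at h0
      exact hs (IsFractionRing.injective B L h0 ▸ 𝔭.zero_mem)
    rw [inv_eq_one_div, div_eq_div_iff h4 hs0, one_mul, ← map_mul] at h
    exact hs (IsFractionRing.injective B L h ▸ 𝔭.mul_mem_left c ha)

/-- The map goes from valuations to centers. It is injective because the center determines the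
valuation ring by `CenteredValuation.le_one_iff`, and surjective by `localValuationSubring`; the
equivalence is its inverse. -/
theorem exists_equiv_centeredValuationClass :
    ∃ e : {𝔭 : Ideal B // 𝔭 ≠ ⊥ ∧ 𝔭.IsPrime} ≃ CenteredValuationClass B L,
      ∀ (𝔭 : {𝔭 : Ideal B // 𝔭 ≠ ⊥ ∧ 𝔭.IsPrime}) (v : CenteredValuation B L),
        Quotient.mk _ v = e 𝔭 →
          (∀ x : L, v.v x ≤ 1 ↔
            ∃ a s : B, s ∉ 𝔭.1 ∧ x = algebraMap B L a / algebraMap B L s) ∧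
          ∀ a : B, v.v (algebraMap B L a) < 1 ↔ a ∈ 𝔭.1 := by
  let c : CenteredValuationClass B L → {𝔭 : Ideal B // 𝔭 ≠ ⊥ ∧ 𝔭.IsPrime} :=
    Quotient.lift (fun v => ⟨v.center, v.center_ne_bot, v.center_isPrime⟩) (by
      intro v w h
      refine Subtype.ext (Ideal.ext fun a => ?_)
      exact Valuation.IsEquiv.lt_one_iff_lt_one h)
  have hc : Function.Bijective c := by
    constructor
    · intro x y
      induction x using Quotient.inductionOn with | _ v
      induction y using Quotient.inductionOn with | _ w
      intro h
      have h' : v.center = w.center := congrArg Subtype.val h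
      refine Quotient.sound (Valuation.isEquiv_of_val_le_one fun {x} => ?_)
      rw [v.le_one_iff hB, w.le_one_iff hB, h']
    · rintro ⟨𝔭, h0, h𝔭⟩
      let A := localValuationSubring (L := L) hB 𝔭 h𝔭
      have hA : ∀ a, A.valuation (algebraMap B L a) < 1 ↔ a ∈ 𝔭 :=
        localValuation_lt_one_iff hB h𝔭
      refine ⟨Quotient.mk _ ⟨A.ValueGroup, A.valuation, ⟨?_⟩, fun b => ?_⟩, ?_⟩
      · obtain ⟨a, ha, ha0⟩ := Submodule.exists_mem_ne_zero_of_ne_bot h0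
        refine ⟨algebraMap B L a, (Valuation.ne_zero_iff _).2 ?_, ((hA a).2 ha).ne⟩
        rw [← map_zero (algebraMap B L)]
        exact fun h => ha0 (IsFractionRing.injective B L h)
      · rw [A.valuation_le_one_iff]
        exact ⟨b, 1, fun h => h𝔭.ne_top ((Ideal.eq_top_iff_one _).2 h), by simp⟩
      · exact Subtype.ext (Ideal.ext hA)
  refine ⟨(Equiv.ofBijective c hc).symm, fun 𝔭 v h => ?_⟩
  obtain rfl : c (Quotient.mk _ v) = 𝔭 := by
    rw [h]
    exact (Equiv.ofBijective c hc).apply_symm_apply 𝔭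
  exact ⟨v.le_one_iff hB, fun a => Iff.rfl⟩

end Valuations

namespace NonstandardEmbedding

/-! ## Hyperintegers -/

variable {S T : ZFSet.{u}} {E : NonstandardEmbedding S T}

variable (E) in
/-- The integers, coded by the individuals `E.int n`. -/
def StdInt (_ : NonstandardEmbedding S T) : Type := ℤ

/-- the underlying integer -/
def StdInt.toInt (n : E.StdInt) : ℤ := n

variable (E) in
/-- an integer as an element of the coded type -/
def ofInt (n : ℤ) : E.StdInt := n

instance : Coded S E.StdInt where
  code := E.int
  code_injective := E.int_injective
  rank := 0
  code_mem := E.int_mem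

theorem ext_univ_stdInt : Coded.ext S (Set.univ : Set E.StdInt) = E.intSet := by
  ext x
  rw [mem_ext, intSet, ZFSet.mem_range]
  exact ⟨fun ⟨a, _, h⟩ => ⟨a, h⟩, fun ⟨a, h⟩ => ⟨a, trivial, h⟩⟩

namespace HyperInt

/-- The hyperinteger given by an element of the extension of the integers. -/
def ofStar (x : E.Star E.StdInt) : E.HyperInt := ⟨x.1, ext_univ_stdInt (E := E) ▸ x.2⟩

/-- A hyperinteger as an element of the extension of the integers. -/
def toStar (x : E.HyperInt) : E.Star E.StdInt := ⟨x.1, ext_univ_stdInt (E := E) ▸ x.2⟩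

@[simp] theorem ofStar_toStar (x : E.HyperInt) : ofStar x.toStar = x := rfl

@[simp] theorem toStar_ofStar (x : E.Star E.StdInt) : (ofStar x).toStar = x := rfl

@[simp] theorem toStar_val (x : E.HyperInt) : x.toStar.1 = x.val := rfl

theorem ofStar_inj {x y : E.Star E.StdInt} : ofStar x = ofStar y ↔ x = y :=
  ⟨fun h => congrArg toStar h, fun h => congrArg ofStar h⟩

/-- The graph that defines addition of hyperintegers is the set of codes of this predicate, so both
sides are one and the same membership. -/
theorem ofStar_add_iff {x y z : E.Star E.StdInt} : ofStar x + ofStar y = ofStar z ↔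
    ((x.pair y).pair z).Ev fun p => p.1.1.toInt + p.1.2.toInt = p.2.toInt := by
  have h : Coded.ext S {p : (E.StdInt × E.StdInt) × E.StdInt |
      p.1.1.toInt + p.1.2.toInt = p.2.toInt} = E.intAdd := by
    ext x
    rw [mem_ext, intAdd, ZFSet.mem_range]
    constructor
    · rintro ⟨⟨⟨a, b⟩, c⟩, h, rfl⟩
      obtain rfl : a.toInt + b.toInt = c := h
      exact ⟨(a, b), rfl⟩
    · rintro ⟨⟨a, b⟩, rfl⟩
      exact ⟨((E.ofInt a, E.ofInt b), E.ofInt (a + b)), rfl, rfl⟩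
  rw [← isSum_iff, Star.Ev, h]
  rfl

theorem ofStar_le_iff {x y : E.Star E.StdInt} : ofStar x ≤ ofStar y ↔
    (x.pair y).Ev fun p => p.1.toInt ≤ p.2.toInt := by
  have h : Coded.ext S {p : E.StdInt × E.StdInt | p.1.toInt ≤ p.2.toInt} = E.intLE := by
    ext x
    rw [mem_ext, intLE, ZFSet.mem_range]
    constructor
    · rintro ⟨⟨a, b⟩, h, rfl⟩
      exact ⟨⟨(a, b), h⟩, rfl⟩
    · rintro ⟨⟨⟨a, b⟩, h⟩, rfl⟩
      exact ⟨(E.ofInt a, E.ofInt b), h, rfl⟩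
  rw [Star.Ev, h]
  rfl

end HyperInt

/-! ### Transfer of integer-valued functions -/

namespace Star

variable {α : Type v₁} [Coded S α]

/-- The hyperinteger value of the extension of an integer valued function. -/
def int (f : α → ℤ) (x : E.Star α) : E.HyperInt := .ofStar (map (fun a => E.ofInt (f a)) x)

theorem int_toInt (f : α → E.StdInt) (x : E.Star α) :
    int (fun a => (f a).toInt) x = .ofStar (map f x) := rfl

@[simp] theorem int_map {β : Type*} [Coded S β] (g : β → ℤ) (f : α → β) (x : E.Star α) :
    int g (map f x) = int (fun a => g (f a)) x := by
  rw [int, int, map_map]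

@[simp] theorem int_add (f g : α → ℤ) (x : E.Star α) :
    int (fun a => f a + g a) x = int f x + int g x := by
  rw [eq_comm, int, int, int, HyperInt.ofStar_add_iff, ← map_prodMk, ← map_prodMk, ev_map]
  exact .of_forall (fun a => rfl) x

@[simp] theorem int_zero (x : E.Star α) : int (fun _ => 0) x = 0 :=
  HyperInt.ext (map_const (E.ofInt 0) x)

@[simp] theorem int_one (x : E.Star α) : int (fun _ => 1) x = 1 :=
  HyperInt.ext (map_const (E.ofInt 1) x)

@[simp] theorem ev_le (f g : α → ℤ) (x : E.Star α) :
    x.Ev (fun a => f a ≤ g a) ↔ int f x ≤ int g x := by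
  rw [int, int, HyperInt.ofStar_le_iff, ← map_prodMk, ev_map]
  rfl

@[simp] theorem ev_int_eq (f g : α → ℤ) (x : E.Star α) :
    x.Ev (fun a => f a = g a) ↔ int f x = int g x := by
  rw [int, int, HyperInt.ofStar_inj, ← ev_eq]
  rfl

end Star

/-! ### The discrete order of the hyperintegers -/

namespace HyperInt

theorem le_total' (x y : E.HyperInt) : x ≤ y ∨ y ≤ x := by
  have := Star.Ev.of_forall (P := fun p : E.StdInt × E.StdInt =>
    p.1.toInt ≤ p.2.toInt ∨ p.2.toInt ≤ p.1.toInt) (fun p => le_total _ _)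
    (x.toStar.pair y.toStar)
  simpa [Star.int_toInt] using this

theorem le_trans' (x y z : E.HyperInt) (h : x ≤ y) (h' : y ≤ z) : x ≤ z := by
  have := Star.Ev.of_forall (P := fun p : E.StdInt × E.StdInt × E.StdInt =>
    p.1.toInt ≤ p.2.1.toInt → p.2.1.toInt ≤ p.2.2.toInt → p.1.toInt ≤ p.2.2.toInt)
    (fun p => le_trans) (x.toStar.pair (y.toStar.pair z.toStar))
  simp [Star.int_toInt] at this
  exact this h h'

theorem le_antisymm' (x y : E.HyperInt) (h : x ≤ y) (h' : y ≤ x) : x = y := by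
  have := Star.Ev.of_forall (P := fun p : E.StdInt × E.StdInt =>
    p.1.toInt ≤ p.2.toInt → p.2.toInt ≤ p.1.toInt → p.1.toInt = p.2.toInt)
    (fun p => le_antisymm) (x.toStar.pair y.toStar)
  simp [Star.int_toInt] at this
  exact this h h'

theorem add_le_add_left' (x y z : E.HyperInt) (h : x ≤ y) : x + z ≤ y + z := by
  have := Star.Ev.of_forall (P := fun p : E.StdInt × E.StdInt × E.StdInt =>
    p.1.toInt ≤ p.2.1.toInt → p.1.toInt + p.2.2.toInt ≤ p.2.1.toInt + p.2.2.toInt)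
    (fun p h => by omega) (x.toStar.pair (y.toStar.pair z.toStar))
  simp only [Star.ev_imp, Star.ev_le, Star.int_add, Star.int_toInt, Star.map_fst, Star.map_snd,
    Star.map_id, Star.fst_pair, Star.snd_pair, ofStar_toStar] at this
  exact this h

instance : LinearOrder E.HyperInt where
  le_refl x := (le_total' x x).elim id id
  le_trans := le_trans'
  le_antisymm := le_antisymm'
  le_total := le_total'
  toDecidableLE := Classical.decRel _

instance : IsOrderedAddMonoid E.HyperInt where
  add_le_add_left x y h z := add_le_add_left' x y z h

theorem add_one_le_iff {x y : E.HyperInt} : x + 1 ≤ y ↔ x < y := by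
  have := Star.Ev.of_forall (P := fun p : E.StdInt × E.StdInt =>
    p.1.toInt + 1 ≤ p.2.toInt ↔ ¬ p.2.toInt ≤ p.1.toInt)
    (fun p => by omega) (x.toStar.pair y.toStar)
  simp only [Star.ev_iff, Star.ev_not, Star.ev_le, Star.int_add, Star.int_one, Star.int_toInt,
    Star.map_fst, Star.map_snd, Star.map_id, Star.fst_pair, Star.snd_pair, ofStar_toStar]
    at this
  exact this.trans not_le

/-- The least element principle for internal sets. -/
theorem exists_least (s : E.Star (Set E.StdInt)) {n : E.HyperInt} (hn : n.val ∈ s.1)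
    (h0 : ∀ m : E.HyperInt, m.val ∈ s.1 → 0 ≤ m) :
    ∃ m : E.HyperInt, m.val ∈ s.1 ∧ ∀ k : E.HyperInt, k.val ∈ s.1 → m ≤ k := by
  have := Star.Ev.of_forall (P := fun s : Set E.StdInt => (∀ m, m ∈ s → 0 ≤ m.toInt) →
    (∃ n, n ∈ s) → ∃ m, m ∈ s ∧ ∀ k, k ∈ s → m.toInt ≤ k.toInt) (by
      intro s h0 hs
      obtain ⟨m, hm, hm'⟩ := Int.exists_least_of_bdd (P := fun n => E.ofInt n ∈ s)
        ⟨0, fun z hz => h0 _ hz⟩ hs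
      exact ⟨m, hm, hm'⟩) s
  simp [Star.int_toInt, Star.ev_forall, Star.ev_exists] at this
  obtain ⟨m, hm, h⟩ := this (fun m hm => h0 (.ofStar m) hm) n.toStar hn
  exact ⟨.ofStar m, hm, fun k hk => h k.toStar hk⟩

end HyperInt

end NonstandardEmbedding

open Coded NonstandardEmbedding

/-! ## Families of Dedekind domains -/

/-- A subset of a commutative ring underlies a nonzero maximal ideal. -/
theorem exists_maximal_ideal_iff {R : Type*} [CommRing R] (J : Set R) :
    (∃ 𝔪 : Ideal R, 𝔪.IsMaximal ∧ 𝔪 ≠ ⊥ ∧ J = 𝔪) ↔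
      0 ∈ J ∧ (∀ x y, x ∈ J → y ∈ J → x + y ∈ J) ∧ (∀ x y, y ∈ J → x * y ∈ J) ∧ 1 ∉ J ∧
      (∀ x, x ∉ J → ∃ y i, i ∈ J ∧ x * y + i = 1) ∧ ∃ x, x ∈ J ∧ x ≠ 0 := by
  constructor
  · rintro ⟨𝔪, h1, h2, rfl⟩
    refine ⟨𝔪.zero_mem, fun x y => 𝔪.add_mem, fun x y => 𝔪.mul_mem_left x,
      fun h => h1.ne_top ((Ideal.eq_top_iff_one _).2 h), fun x hx => ?_,
      Submodule.exists_mem_ne_zero_of_ne_bot h2⟩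
    obtain ⟨y, i, hi, h⟩ := h1.exists_inv hx
    exact ⟨y, i, hi, by rw [mul_comm, h]⟩
  · rintro ⟨h0, ha, hm, h1, hx, x, hxJ, hx0⟩
    refine ⟨{ carrier := J, add_mem' := fun {x y} => ha x y, zero_mem' := h0,
              smul_mem' := fun x y => hm x y }, ?_, ?_, rfl⟩
    · rw [Ideal.isMaximal_iff]
      refine ⟨h1, fun K x hJK hx' hxK => ?_⟩
      obtain ⟨y, i, hi, h⟩ := hx x hx'
      rw [← h]
      exact K.add_mem (K.mul_mem_right y hxK) (hJK hi)
    · intro h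
      have : x ∈ (⊥ : Ideal R) := h ▸ hxJ
      exact hx0 this

namespace InternalDedekindRing

variable {S T : ZFSet.{u}} {E : NonstandardEmbedding S T} (B : InternalDedekindRing E)

/-- A standard family of Dedekind domains whose extension contains `B`. -/
def family : ZFSet.{u} := B.exists_family.choose

theorem isSetIn_family : IsSetIn S B.family := B.exists_family.choose_spec.1

theorem isDedekindCode {t : ZFSet.{u}} (ht : t ∈ B.family) : IsDedekindCode S t :=
  B.exists_family.choose_spec.2.1 t ht

theorem code_mem_family : ringCode B.carrier ∈ E.star B.family :=
  B.exists_family.choose_spec.2.2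

/-- The index set of the family. -/
def Idx : Type (u + 1) := {t // t ∈ B.family}

/-- A level containing the elements of the rings of the family. -/
def ambRank : ℕ := (exists_subset_level B.isSetIn_family).choose

theorem family_subset : B.family ⊆ level S B.ambRank :=
  (exists_subset_level B.isSetIn_family).choose_spec

/-- An ambient set containing all elements of the rings of the family. -/
def Amb : Type (u + 1) := {x // x ∈ level S B.ambRank}

instance : Coded S B.Idx where
  code t := t.1
  code_injective := Subtype.val_injective
  rank := B.ambRank
  code_mem t := B.family_subset t.2

instance : Coded S B.Amb where
  code x := x.1
  code_injective := Subtype.val_injective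
  rank := B.ambRank
  code_mem x := x.2

theorem ext_univ_idx : Coded.ext S (Set.univ : Set B.Idx) = B.family := by
  ext x
  rw [mem_ext]
  exact ⟨fun ⟨t, _, h⟩ => h ▸ t.2, fun h => ⟨⟨x, h⟩, trivial, rfl⟩⟩

variable {B}

/-- The underlying set of a ring of the family. -/
def dom (t : B.Idx) : ZFSet.{u} := (B.isDedekindCode t.2).choose

/-- A ring of the family. -/
def Fib (t : B.Idx) : Type (u + 1) := {x // x ∈ dom t}

instance (t : B.Idx) : CommRing (Fib t) := (B.isDedekindCode t.2).choose_spec.choose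

instance (t : B.Idx) : IsDedekindDomain (Fib t) :=
  (B.isDedekindCode t.2).choose_spec.choose_spec.2.1

theorem isSetIn_dom (t : B.Idx) : IsSetIn S (dom t) :=
  (B.isDedekindCode t.2).choose_spec.choose_spec.1

theorem idx_eq_ringCode (t : B.Idx) :
    t.1 = @ringCode (dom t) (inferInstanceAs (CommRing (Fib t))) :=
  (B.isDedekindCode t.2).choose_spec.choose_spec.2.2

/-- The underlying set lies two membership steps below the code of the ring, and levels are closed
under passing to elements that are entities. Thus one level contains the elements of all rings of
the family, which allows a common ambient type. -/
theorem dom_subset (t : B.Idx) : dom t ⊆ level S B.ambRank := by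
  have hS := E.isBaseSet_source
  intro x hx
  have h1 := B.family_subset t.2
  rw [idx_eq_ringCode] at h1
  have hD := isSetIn_dom t
  have ha := (isSetIn_opGraph hS hD fun x y : Fib t => x + y).1
  have hm := (isSetIn_opGraph hS hD fun x y : Fib t => x * y).1
  have h2 := mem_level_of_mem hS h1 (y := {dom t, _}) (ZFSet.mem_pair.2 (Or.inr rfl))
    (IsSetIn.insert_singleton hS hD.1 (InSuper.pair hS ha hm)).1
  have h3 := mem_level_of_mem hS h2 (y := dom t) (by simp) hD.1
  exact mem_level_of_mem hS h3 hx (hD.inSuper_of_mem hx)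

/-- The inclusion of a ring of the family into the ambient set. -/
def incl (t : B.Idx) (x : Fib t) : B.Amb := ⟨x.1, dom_subset t x.2⟩

theorem incl_injective (t : B.Idx) : Function.Injective (incl t) := fun _ _ h =>
  Subtype.ext (congrArg (fun z : B.Amb => z.1) h)

@[simp] theorem incl_inj {t : B.Idx} {x y : Fib t} : incl t x = incl t y ↔ x = y :=
  (incl_injective t).eq_iff

open Classical in
/-- A retraction of the ambient set onto a ring of the family. -/
def retr (t : B.Idx) (x : B.Amb) : Fib t := if h : x.1 ∈ dom t then ⟨x.1, h⟩ else 0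

@[simp] theorem retr_incl (t : B.Idx) (x : Fib t) : retr t (incl t x) = x :=
  dif_pos x.2

/-- The underlying set of a ring of the family, as a subset of the ambient set. -/
def car (t : B.Idx) : Set B.Amb := Set.range (incl t)

/-- The addition of the ring with index `t`. -/
def sadd (t : B.Idx) (x y : B.Amb) : B.Amb := incl t (retr t x + retr t y)

/-- The multiplication of the ring with index `t`. -/
def smul (t : B.Idx) (x y : B.Amb) : B.Amb := incl t (retr t x * retr t y)

/-- The zero element of the ring with index `t`. -/
def szero (t : B.Idx) : B.Amb := incl t 0

/-- The unit element of the ring with index `t`. -/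
def sone (t : B.Idx) : B.Amb := incl t 1

@[simp] theorem sadd_incl (t : B.Idx) (x y : Fib t) :
    sadd t (incl t x) (incl t y) = incl t (x + y) := by simp [sadd]

@[simp] theorem smul_incl (t : B.Idx) (x y : Fib t) :
    smul t (incl t x) (incl t y) = incl t (x * y) := by simp [smul]

theorem forall_mem_car {t : B.Idx} {P : B.Amb → Prop} :
    (∀ x, x ∈ car t → P x) ↔ ∀ x : Fib t, P (incl t x) := Set.forall_mem_range

theorem exists_mem_car {t : B.Idx} {P : B.Amb → Prop} :
    (∃ x, x ∈ car t ∧ P x) ↔ ∃ x : Fib t, P (incl t x) := Set.exists_range_iff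

/-- The graph of a binary operation of the ring with index `t`. -/
def sgraph (F : ∀ t : B.Idx, Fib t → Fib t → Fib t) (t : B.Idx) :
    Set ((B.Amb × B.Amb) × B.Amb) :=
  {p | ∃ x y, p = ((incl t x, incl t y), incl t (F t x y))}

theorem code_car (t : B.Idx) : code S (car t) = dom t := by
  ext x
  rw [code_set, mem_ext]
  constructor
  · rintro ⟨_, ⟨y, rfl⟩, rfl⟩
    exact y.2
  · exact fun h => ⟨incl t ⟨x, h⟩, ⟨_, rfl⟩, rfl⟩

theorem code_sgraph (F : ∀ t : B.Idx, Fib t → Fib t → Fib t) (t : B.Idx) :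
    code S (sgraph F t) = opGraph (dom t) (F t) := by
  ext x
  rw [code_set, mem_ext]
  refine Iff.trans ?_ ZFSet.mem_sep.symm
  constructor
  · rintro ⟨_, ⟨x, y, rfl⟩, rfl⟩
    exact ⟨ZFSet.pair_mem_prod.2 ⟨ZFSet.pair_mem_prod.2 ⟨x.2, y.2⟩, (F t x y).2⟩, x, y, rfl⟩
  · rintro ⟨-, x, y, rfl⟩
    exact ⟨_, ⟨x, y, rfl⟩, rfl⟩

/-! ### `B` as the nonstandard member of the family -/

variable (B)

/-- The index of `B`, as an element of the extension of the index set. -/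
def base : E.Star B.Idx := ⟨ringCode B.carrier, B.ext_univ_idx ▸ B.code_mem_family⟩

/-- Sending `t` to the triple of its underlying set and two graphs leaves the code unchanged. By
`map_val_of_code` the same is true of the extension, and at `base` the components can be compared
with those of `ringCode B.carrier`. -/
theorem base_decode : (B.base.map car).1 = B.carrier ∧
    (B.base.map (sgraph fun _ x y => x + y)).1 = opGraph B.carrier (fun x y : B.Elem => x + y) ∧
    (B.base.map (sgraph fun _ x y => x * y)).1 = opGraph B.carrier (fun x y : B.Elem => x * y) := by
  have h := Star.map_val_of_code (E := E)
    (f := fun t : B.Idx => (car t, (sgraph (fun _ x y => x + y) t, sgraph (fun _ x y => x * y) t)))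
    (fun t => by
      rw [code_pair, code_pair, code_car, code_sgraph, code_sgraph]
      exact (idx_eq_ringCode t).symm) B.base
  rw [Star.map_prodMk, Star.map_prodMk] at h
  obtain ⟨h1, h2⟩ := ZFSet.pair_inj.1 h
  obtain ⟨h2, h3⟩ := ZFSet.pair_inj.1 h2
  exact ⟨h1, h2, h3⟩

variable {B}

/-- An element of `B`, as an element of the extension of the ambient set. -/
def st (x : B.Elem) : E.Star B.Amb :=
  ⟨x.1, (B.base.map car).set_subset (B.base_decode.1.symm ▸ x.2)⟩

@[simp] theorem st_val (x : B.Elem) : (st x).1 = x.1 := rfl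

@[simp] theorem st_inj {x y : B.Elem} : st x = st y ↔ x = y :=
  ⟨fun h => Subtype.ext (congrArg (fun z : E.Star B.Amb => z.1) h), fun h => h ▸ rfl⟩

theorem st_mem_car (x : B.Elem) : x.1 ∈ (B.base.map car).1 := B.base_decode.1.symm ▸ x.2

theorem exists_eq_st {y : E.Star B.Amb} (hy : y.1 ∈ (B.base.map car).1) : ∃ x, y = st x :=
  ⟨⟨y.1, B.base_decode.1 ▸ hy⟩, rfl⟩

theorem forall_st {P : E.Star B.Amb → Prop} :
    (∀ y : E.Star B.Amb, y.1 ∈ (B.base.map car).1 → P y) ↔ ∀ x : B.Elem, P (st x) := by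
  refine ⟨fun h x => h _ (st_mem_car x), fun h y hy => ?_⟩
  obtain ⟨x, rfl⟩ := exists_eq_st hy
  exact h x

theorem exists_st {P : E.Star B.Amb → Prop} :
    (∃ y : E.Star B.Amb, y.1 ∈ (B.base.map car).1 ∧ P y) ↔ ∃ x : B.Elem, P (st x) := by
  constructor
  · rintro ⟨y, hy, h⟩
    obtain ⟨x, rfl⟩ := exists_eq_st hy
    exact ⟨x, h⟩
  · exact fun ⟨x, h⟩ => ⟨_, st_mem_car x, h⟩

/-- The operation of the ring with index `t` induced by an operation of the family. -/
def sop (F : ∀ t : B.Idx, Fib t → Fib t → Fib t) (p : B.Idx × B.Amb × B.Amb) : B.Amb :=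
  incl p.1 (F p.1 (retr p.1 p.2.1) (retr p.1 p.2.2))

/-- The total operations built with `retr` have to be reconciled with the graphs occurring in the
code of `B`; `base_decode` then turns the second conjunct into an equation in `B`. -/
theorem map_sop {F : ∀ t : B.Idx, Fib t → Fib t → Fib t} (x y : B.Elem) :
    ∃ z : B.Elem, (B.base.pair ((st x).pair (st y))).map (sop F) = st z ∧
      ZFSet.pair (ZFSet.pair x.1 y.1) z.1 ∈ (B.base.map (sgraph F)).1 := by
  have := Star.Ev.of_forall (P := fun p : B.Idx × B.Amb × B.Amb => p.2.1 ∈ car p.1 →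
    p.2.2 ∈ car p.1 → sop F p ∈ car p.1 ∧ ((p.2.1, p.2.2), sop F p) ∈ sgraph F p.1) (by
      rintro ⟨t, a, b⟩ ha hb
      obtain ⟨x, rfl⟩ : ∃ x, incl t x = a := ha
      obtain ⟨y, rfl⟩ : ∃ y, incl t y = b := hb
      exact ⟨⟨_, rfl⟩, x, y, by simp [sop]⟩) (B.base.pair ((st x).pair (st y)))
  have hcar := Star.map_map (E := E) (car (B := B)) (fun p : B.Idx × B.Amb × B.Amb => p.1)
    (B.base.pair ((st x).pair (st y)))
  have hgr := Star.map_map (E := E) (sgraph F) (fun p : B.Idx × B.Amb × B.Amb => p.1)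
    (B.base.pair ((st x).pair (st y)))
  simp only [Star.map_fst, Star.map_id, Star.fst_pair] at hcar hgr
  simp only [Star.ev_imp, Star.ev_and, Star.ev_mem, Star.map_prodMk, Star.map_fst,
    Star.map_snd, Star.map_id, Star.fst_pair, Star.snd_pair, ← hcar, ← hgr, Star.pair_val] at this
  obtain ⟨h1, h2⟩ := this (st_mem_car x) (st_mem_car y)
  obtain ⟨z, hz⟩ := exists_eq_st h1
  refine ⟨z, hz, ?_⟩
  rw [hz] at h2
  exact h2

/-- The extension of the additions of the rings of the family. -/
def starAdd (t : E.Star B.Idx) (x y : E.Star B.Amb) : E.Star B.Amb :=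
  (t.pair (x.pair y)).map fun p => sadd p.1 p.2.1 p.2.2

/-- The extension of the multiplications of the rings of the family. -/
def starMul (t : E.Star B.Idx) (x y : E.Star B.Amb) : E.Star B.Amb :=
  (t.pair (x.pair y)).map fun p => smul p.1 p.2.1 p.2.2

@[simp] theorem starAdd_st (x y : B.Elem) : starAdd B.base (st x) (st y) = st (x + y) := by
  obtain ⟨z, h1, h2⟩ := map_sop (F := fun _ x y => x + y) x y
  rw [B.base_decode.2.1] at h2
  rw [pair_mem_opGraph.1 h2]
  exact h1

@[simp] theorem starMul_st (x y : B.Elem) : starMul B.base (st x) (st y) = st (x * y) := by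
  obtain ⟨z, h1, h2⟩ := map_sop (F := fun _ x y => x * y) x y
  rw [B.base_decode.2.2] at h2
  rw [pair_mem_opGraph.1 h2]
  exact h1

section Push

variable {γ : Type*} [Coded S γ]

@[simp] theorem map_car (t : γ → B.Idx) (w : E.Star γ) :
    w.map (fun a => car (t a)) = (w.map t).map car := (Star.map_map _ _ _).symm

@[simp] theorem map_szero (t : γ → B.Idx) (w : E.Star γ) :
    w.map (fun a => szero (t a)) = (w.map t).map szero := (Star.map_map _ _ _).symm

@[simp] theorem map_sone (t : γ → B.Idx) (w : E.Star γ) :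
    w.map (fun a => sone (t a)) = (w.map t).map sone := (Star.map_map _ _ _).symm

@[simp] theorem map_sadd (t : γ → B.Idx) (f g : γ → B.Amb) (w : E.Star γ) :
    w.map (fun a => sadd (t a) (f a) (g a)) = starAdd (w.map t) (w.map f) (w.map g) := by
  rw [starAdd, ← Star.map_prodMk, ← Star.map_prodMk, Star.map_map]

@[simp] theorem map_smul (t : γ → B.Idx) (f g : γ → B.Amb) (w : E.Star γ) :
    w.map (fun a => smul (t a) (f a) (g a)) = starMul (w.map t) (w.map f) (w.map g) := by
  rw [starMul, ← Star.map_prodMk, ← Star.map_prodMk, Star.map_map]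

end Push

-- The additions are already known to agree, and zero is the only solution of `z + z = z`.
@[simp] theorem map_szero_base : B.base.map szero = st 0 := by
  have := Star.Ev.of_forall (P := fun t : B.Idx => szero t ∈ car t ∧
    sadd t (szero t) (szero t) = szero t) (fun t => ⟨⟨_, rfl⟩, by simp [szero]⟩) B.base
  simp only [Star.ev_and, Star.ev_mem, Star.ev_eq, map_sadd, Star.map_id] at this
  obtain ⟨z, hz⟩ := exists_eq_st this.1
  have h2 := this.2
  have h3 : B.base.map szero = B.base.map (fun t => szero t) := rfl
  rw [h3, hz, starAdd_st, st_inj] at h2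
  rw [h3, hz, st_inj]
  simpa using h2

-- The transferred unit is a left unit of `B`; evaluating it at `1` identifies it.
@[simp] theorem map_sone_base : B.base.map sone = st 1 := by
  have := Star.Ev.of_forall (P := fun t : B.Idx => sone t ∈ car t ∧
    ∀ x, x ∈ car t → smul t (sone t) x = x) (fun t => ⟨⟨_, rfl⟩, by
      rintro _ ⟨x, rfl⟩
      simp [sone]⟩) B.base
  simp only [Star.ev_and, Star.ev_mem, Star.ev_eq, Star.ev_imp, Star.ev_forall, map_smul, map_sone,
    map_car, Star.map_fst, Star.map_snd, Star.map_id, Star.fst_pair, Star.snd_pair, forall_st] at this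
  obtain ⟨z, hz⟩ := exists_eq_st this.1
  have h2 := this.2 1
  have h3 : B.base.map sone = B.base.map (fun t => sone t) := rfl
  rw [h3, hz, starMul_st, st_inj, mul_one] at h2
  rw [h3, hz, h2]

/-- Internal Dedekind rings are Prüfer rings. -/
theorem exists_add_eq_one_mul_eq_mul (a b : B.Elem) :
    ∃ s t y z : B.Elem, s + t = 1 ∧ s * a = y * b ∧ t * b = z * a := by
  have := Star.Ev.of_forall (P := fun t : B.Idx => ∀ a, a ∈ car t → ∀ b, b ∈ car t →
    ∃ s, s ∈ car t ∧ ∃ r, r ∈ car t ∧ ∃ y, y ∈ car t ∧ ∃ z, z ∈ car t ∧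
      sadd t s r = sone t ∧ smul t s a = smul t y b ∧ smul t r b = smul t z a) (by
      rintro t _ ⟨a, rfl⟩ _ ⟨b, rfl⟩
      obtain ⟨s, r, y, z, h⟩ := Nonstandard.exists_add_eq_one_mul_eq_mul a b
      exact ⟨incl t s, ⟨_, rfl⟩, incl t r, ⟨_, rfl⟩, incl t y, ⟨_, rfl⟩, incl t z, ⟨_, rfl⟩,
        by simpa [sone] using h⟩) B.base
  simp only [Star.ev_and, Star.ev_mem, Star.ev_eq, Star.ev_imp, Star.ev_forall, Star.ev_exists,
    map_smul, map_sadd, map_sone, map_car, Star.map_fst, Star.map_snd, Star.map_id, Star.fst_pair,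
    Star.snd_pair, forall_st, exists_st, map_sone_base, starAdd_st, starMul_st, st_inj] at this
  exact this a b

/-! ### Maximal ideals -/

/-- An ideal, as a subset of the ambient set. -/
def toSet (t : B.Idx) (I : Ideal (Fib t)) : Set B.Amb := incl t '' I

/-- The ideal generated by a subset of the ambient set. -/
def idl (t : B.Idx) (I : Set B.Amb) : Ideal (Fib t) := Ideal.span (incl t ⁻¹' I)

@[simp] theorem incl_mem_toSet {t : B.Idx} {I : Ideal (Fib t)} {x : Fib t} :
    incl t x ∈ toSet t I ↔ x ∈ I := by
  simp [toSet]

theorem toSet_subset (t : B.Idx) (I : Ideal (Fib t)) : toSet t I ⊆ car t := by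
  rintro _ ⟨x, -, rfl⟩
  exact ⟨x, rfl⟩

@[simp] theorem idl_toSet (t : B.Idx) (I : Ideal (Fib t)) : idl t (toSet t I) = I := by
  rw [idl, toSet, Set.preimage_image_eq _ (incl_injective t), Ideal.span_eq]

theorem toSet_injective (t : B.Idx) : Function.Injective (toSet t) :=
  Function.LeftInverse.injective (idl_toSet t)

/-- The set of nonzero maximal ideals of the ring with index `t`. -/
def smax (t : B.Idx) : Set (Set B.Amb) :=
  {I | ∃ 𝔪 : Ideal (Fib t), 𝔪.IsMaximal ∧ 𝔪 ≠ ⊥ ∧ I = toSet t 𝔪}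

/-- Maximality is expressed by solvability of `x y + i = 1` for `x ∉ I`, so only elements of the
ring are quantified. After transfer the condition therefore describes maximal ideals in the ordinary
sense, without reference to other internal ideals. -/
theorem mem_smax_iff {t : B.Idx} {I : Set B.Amb} : I ∈ smax t ↔ (∀ x, x ∈ I → x ∈ car t) ∧
    szero t ∈ I ∧ (∀ x, x ∈ car t → ∀ y, y ∈ car t → x ∈ I → y ∈ I → sadd t x y ∈ I) ∧
    (∀ x, x ∈ car t → ∀ y, y ∈ car t → y ∈ I → smul t x y ∈ I) ∧ ¬ sone t ∈ I ∧
    (∀ x, x ∈ car t → ¬ x ∈ I → ∃ y, y ∈ car t ∧ ∃ i, i ∈ car t ∧ i ∈ I ∧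
      sadd t (smul t x y) i = sone t) ∧ ∃ x, x ∈ car t ∧ x ∈ I ∧ ¬ x = szero t := by
  have key := exists_maximal_ideal_iff (incl t ⁻¹' I)
  simp only [forall_mem_car, exists_mem_car, sadd_incl, smul_incl, szero, sone, incl_inj]
  refine Iff.trans ⟨?_, ?_⟩ (and_congr_right fun _ => key)
  · rintro ⟨𝔪, h1, h2, rfl⟩
    exact ⟨fun x hx => toSet_subset t 𝔪 hx, 𝔪, h1, h2, by ext; simp⟩
  · rintro ⟨h, 𝔪, h1, h2, h3⟩
    refine ⟨𝔪, h1, h2, Set.ext fun x => ⟨fun hx => ?_, ?_⟩⟩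
    · obtain ⟨y, rfl⟩ := h x hx
      rw [incl_mem_toSet]
      exact h3.subset hx
    · rintro ⟨y, hy, rfl⟩
      exact h3.superset hy

/-- An internal ideal, as an element of the extension of the power set of the ambient set. -/
def stSet (I : Ideal B.Elem) (h : E.Internal (B.idealCode I)) : E.Star (Set B.Amb) :=
  ⟨B.idealCode I, Star.mem_of_internal h (idealCode_notMem I)
    fun _ hx => (st ⟨_, idealCode_subset I hx⟩).2⟩

/-- A maximal ideal, as an element of the extension of the power set of the ambient set. -/
def stMax (𝔭 : B.InternalMax) : E.Star (Set B.Amb) := stSet 𝔭.1 𝔭.2.2.2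

@[simp] theorem mem_stMax {𝔭 : B.InternalMax} {x : B.Elem} : x.1 ∈ (stMax 𝔭).1 ↔ x ∈ 𝔭.1 :=
  mem_idealCode

theorem stMax_injective : Function.Injective (stMax (B := B)) := fun _ _ h =>
  Subtype.ext (idealCode_injective (congrArg (fun z : E.Star (Set B.Amb) => z.1) h))

/-- The criterion `mem_smax_iff`, evaluated at `base`, is literally the criterion
`exists_maximal_ideal_iff` for `B`. Hence `ℳ` is itself a transferred object, and quantifiers over
`smax` become quantifiers over `ℳ`. -/
theorem mem_map_smax_iff {I : E.Star (Set B.Amb)} :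
    I.1 ∈ (B.base.map smax).1 ↔ ∃ 𝔭 : B.InternalMax, I = stMax 𝔭 := by
  have key := Star.ev_forall.1 (Star.Ev.of_forall (P := fun t : B.Idx => ∀ I : Set B.Amb, I ∈ smax t ↔ _)
    (fun t I => mem_smax_iff) B.base) I
  simp only [Star.ev_iff, Star.ev_and, Star.ev_not, Star.ev_imp, Star.ev_mem, Star.ev_eq,
    Star.ev_forall, Star.ev_exists, map_smul, map_sadd, map_sone, map_szero, map_car, Star.map_fst,
    Star.map_snd, Star.map_id, Star.fst_pair, Star.snd_pair, forall_st, exists_st, map_sone_base,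
    map_szero_base, starAdd_st, starMul_st, st_inj, st_val] at key
  have hsm : Star.map (fun p : B.Idx × Set B.Amb => smax p.1) (B.base.pair I) = B.base.map smax := by
    rw [← Star.map_map smax, Star.map_fst, Star.map_id, Star.fst_pair]
  rw [hsm] at key
  rw [key]
  constructor
  · rintro ⟨h1, h2⟩
    obtain ⟨𝔪, hm1, hm2, hm3⟩ := (exists_maximal_ideal_iff {x : B.Elem | x.1 ∈ I.1}).2 h2
    have hI : I.1 = B.idealCode 𝔪 := by
      ext x
      constructor
      · intro hx
        obtain ⟨y, hy⟩ := exists_eq_st (h1 ⟨x, I.set_subset hx⟩ hx)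
        obtain rfl : x = y.1 := congrArg Subtype.val hy
        exact mem_idealCode.2 (hm3.subset hx)
      · intro hx
        have := (mem_idealCode (x := ⟨x, idealCode_subset _ hx⟩)).1 hx
        exact hm3.superset this
    exact ⟨⟨𝔪, hm1, hm2, hI ▸ I.internal⟩, Star.ext hI⟩
  · rintro ⟨𝔭, rfl⟩
    refine ⟨fun x hx => B.base_decode.1.symm ▸ idealCode_subset _ hx, ?_⟩
    simp only [mem_stMax]
    exact (exists_maximal_ideal_iff (𝔭.1 : Set B.Elem)).1 ⟨𝔭.1, 𝔭.2.1, 𝔭.2.2.1, rfl⟩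

theorem stMax_mem (𝔭 : B.InternalMax) : (stMax 𝔭).1 ∈ (B.base.map smax).1 :=
  mem_map_smax_iff.2 ⟨𝔭, rfl⟩

theorem forall_stMax {P : E.Star (Set B.Amb) → Prop} :
    (∀ I : E.Star (Set B.Amb), I.1 ∈ (B.base.map smax).1 → P I) ↔ ∀ 𝔭, P (stMax 𝔭) := by
  refine ⟨fun h 𝔭 => h _ (stMax_mem 𝔭), fun h I hI => ?_⟩
  obtain ⟨𝔭, rfl⟩ := mem_map_smax_iff.1 hI
  exact h 𝔭

/-! ### Orders -/

/-- The order of `x` at a maximal ideal. -/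
def sord (t : B.Idx) (I : Set B.Amb) (x : B.Amb) : ℤ := ordAt (idl t I) (retr t x)

@[simp] theorem sord_incl (t : B.Idx) (𝔪 : Ideal (Fib t)) (x : Fib t) :
    sord t (toSet t 𝔪) (incl t x) = ordAt 𝔪 x := by
  simp [sord]

/-- The extension of the order functions. -/
def starOrd (t : E.Star B.Idx) (I : E.Star (Set B.Amb)) (x : E.Star B.Amb) : E.HyperInt :=
  (t.pair (I.pair x)).int fun p => sord p.1 p.2.1 p.2.2

section Push

variable {γ : Type*} [Coded S γ]

@[simp] theorem map_smax (t : γ → B.Idx) (w : E.Star γ) :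
    w.map (fun a => smax (t a)) = (w.map t).map smax := (Star.map_map _ _ _).symm

@[simp] theorem int_sord (t : γ → B.Idx) (I : γ → Set B.Amb) (x : γ → B.Amb) (w : E.Star γ) :
    w.int (fun a => sord (t a) (I a) (x a)) = starOrd (w.map t) (w.map I) (w.map x) := by
  rw [starOrd, ← Star.map_prodMk, ← Star.map_prodMk, Star.int_map]

end Push

/-- The (hyperinteger) order of `a` at `𝔭`. -/
def ord (𝔭 : B.InternalMax) (a : B.Elem) : E.HyperInt := starOrd B.base (stMax 𝔭) (st a)

theorem ord_nonneg (𝔭 : B.InternalMax) (a : B.Elem) : 0 ≤ ord 𝔭 a := by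
  have := Star.Ev.of_forall (P := fun p : B.Idx × Set B.Amb × B.Amb => 0 ≤ sord p.1 p.2.1 p.2.2)
    (fun p => Int.natCast_nonneg _) (B.base.pair ((stMax 𝔭).pair (st a)))
  rw [Star.ev_le, Star.int_zero] at this
  exact this

/-- The pattern for most facts on `ord`: the standard fact is written with quantifiers bounded by
`car` and `smax`, proved at each index for elements `incl t x` and ideals `toSet t 𝔪`, and evaluated
at `B.base`, where the bounds turn into `B.Elem` and `B.InternalMax`. -/
theorem ord_ne_zero_iff {𝔭 : B.InternalMax} {a : B.Elem} (ha : a ≠ 0) :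
    ord 𝔭 a ≠ 0 ↔ a ∈ 𝔭.1 := by
  have := Star.Ev.of_forall (P := fun t : B.Idx => ∀ I, I ∈ smax t → ∀ a, a ∈ car t →
    ¬ a = szero t → (¬ sord t I a = 0 ↔ a ∈ I)) (by
      rintro t _ ⟨𝔪, h1, h2, rfl⟩ _ ⟨a, rfl⟩ ha
      have := ordAt_ne_zero_iff h1 (x := a) (by simpa [szero] using ha)
      simpa using this) B.base
  simp only [Star.ev_iff, Star.ev_not, Star.ev_imp, Star.ev_mem, Star.ev_eq, Star.ev_int_eq,
    Star.ev_forall, map_szero, map_car, map_smax, int_sord, Star.int_zero, Star.map_fst,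
    Star.map_snd, Star.map_id, Star.fst_pair, Star.snd_pair, forall_st, forall_stMax,
    map_szero_base, st_inj, st_val, mem_stMax] at this
  exact this 𝔭 a ha

theorem ord_one (𝔭 : B.InternalMax) : ord 𝔭 1 = 0 := by
  by_contra h
  have := 𝔭.2.1
  by_cases h1 : (1 : B.Elem) = 0
  · exact this.ne_top ((Ideal.eq_top_iff_one _).2 (h1 ▸ 𝔭.1.zero_mem))
  · exact this.ne_top ((Ideal.eq_top_iff_one _).2 ((ord_ne_zero_iff h1).1 h))

theorem ord_mul (𝔭 : B.InternalMax) {a b : B.Elem} (ha : a ≠ 0) (hb : b ≠ 0) :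
    ord 𝔭 (a * b) = ord 𝔭 a + ord 𝔭 b := by
  have := Star.Ev.of_forall (P := fun t : B.Idx => ∀ I, I ∈ smax t → ∀ a, a ∈ car t →
    ∀ b, b ∈ car t → ¬ a = szero t → ¬ b = szero t →
      sord t I (smul t a b) = sord t I a + sord t I b) (by
      rintro t _ ⟨𝔪, h1, h2, rfl⟩ _ ⟨a, rfl⟩ _ ⟨b, rfl⟩ ha hb
      have := ordAt_mul h1 h2 (x := a) (y := b) (by simpa [szero] using ha)
        (by simpa [szero] using hb)
      simp [this]) B.base
  simp only [Star.ev_not, Star.ev_imp, Star.ev_mem, Star.ev_eq, Star.ev_int_eq,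
    Star.ev_forall, map_szero, map_smul, map_car, map_smax, int_sord, Star.int_add, Star.map_fst,
    Star.map_snd, Star.map_id, Star.fst_pair, Star.snd_pair, forall_st, forall_stMax,
    map_szero_base, starMul_st, st_inj] at this
  exact this 𝔭 a b ha hb

theorem isDomain : IsDomain B.Elem := by
  have := Star.Ev.of_forall (P := fun t : B.Idx => ¬ szero t = sone t ∧ ∀ a, a ∈ car t →
    ∀ b, b ∈ car t → smul t a b = szero t → a = szero t ∨ b = szero t) (by
      refine fun t => ⟨by simp [szero, sone], ?_⟩
      rintro _ ⟨a, rfl⟩ _ ⟨b, rfl⟩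
      simp [szero]) B.base
  simp only [Star.ev_not, Star.ev_imp, Star.ev_and, Star.ev_or, Star.ev_mem, Star.ev_eq,
    Star.ev_forall, map_szero, map_smul, map_car, Star.map_fst,
    Star.map_snd, Star.map_id, Star.fst_pair, Star.snd_pair, forall_st,
    map_szero_base, map_sone_base, starMul_st, st_inj] at this
  have h1 : Nontrivial B.Elem := ⟨0, 1, this.1⟩
  have h2 : NoZeroDivisors B.Elem := ⟨fun {a b} h => this.2 a b h⟩
  exact NoZeroDivisors.to_isDomain _

theorem le_ord_add (𝔭 : B.InternalMax) {a b : B.Elem} (ha : a ≠ 0) (hb : b ≠ 0)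
    (hab : a + b ≠ 0) : min (ord 𝔭 a) (ord 𝔭 b) ≤ ord 𝔭 (a + b) := by
  have := Star.Ev.of_forall (P := fun t : B.Idx => ∀ I, I ∈ smax t → ∀ a, a ∈ car t →
    ∀ b, b ∈ car t → ¬ a = szero t → ¬ b = szero t → ¬ sadd t a b = szero t →
      sord t I a ≤ sord t I (sadd t a b) ∨ sord t I b ≤ sord t I (sadd t a b)) (by
      rintro t _ ⟨𝔪, h1, h2, rfl⟩ _ ⟨a, rfl⟩ _ ⟨b, rfl⟩ ha hb hab
      simp only [szero, incl_inj, sadd_incl] at ha hb hab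
      simp only [sadd_incl, sord_incl, Nat.cast_le]
      rw [← min_le_iff, ← mem_pow_iff_le_ordAt h1 hab]
      exact Ideal.add_mem _ ((mem_pow_iff_le_ordAt h1 ha).2 (min_le_left _ _))
        ((mem_pow_iff_le_ordAt h1 hb).2 (min_le_right _ _))) B.base
  simp only [Star.ev_not, Star.ev_imp, Star.ev_or, Star.ev_mem, Star.ev_eq, Star.ev_le,
    Star.ev_forall, map_szero, map_sadd, map_car, map_smax, int_sord, Star.map_fst,
    Star.map_snd, Star.map_id, Star.fst_pair, Star.snd_pair, forall_st, forall_stMax,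
    map_szero_base, starAdd_st, st_inj] at this
  exact min_le_iff.2 (this 𝔭 a b ha hb hab)

/-- The quotient is an element of the same ring, so its existence transfers. This is the step back
from orders to membership in arbitrary, possibly external, ideals of `B`. -/
theorem dvd_of_ord_le {a b : B.Elem} (ha : a ≠ 0) (hb : b ≠ 0)
    (h : ∀ 𝔭 : B.InternalMax, ord 𝔭 a ≤ ord 𝔭 b) : a ∣ b := by
  have := Star.Ev.of_forall (P := fun t : B.Idx => ∀ a, a ∈ car t →
    ∀ b, b ∈ car t → ¬ a = szero t → ¬ b = szero t →
      (∀ I, I ∈ smax t → sord t I a ≤ sord t I b) → ∃ c, c ∈ car t ∧ b = smul t a c) (by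
      rintro t _ ⟨a, rfl⟩ _ ⟨b, rfl⟩ ha hb h
      simp only [szero, incl_inj] at ha hb
      obtain ⟨c, rfl⟩ := dvd_of_ordAt_le ha hb fun 𝔪 h1 h2 => by
        simpa using h _ ⟨𝔪, h1, h2, rfl⟩
      exact ⟨incl t c, ⟨c, rfl⟩, by simp⟩) B.base
  simp only [Star.ev_not, Star.ev_imp, Star.ev_and, Star.ev_mem, Star.ev_eq, Star.ev_le,
    Star.ev_forall, Star.ev_exists, map_szero, map_smul, map_car, map_smax, int_sord, Star.map_fst,
    Star.map_snd, Star.map_id, Star.fst_pair, Star.snd_pair, forall_st, exists_st, forall_stMax,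
    map_szero_base, starMul_st, st_inj] at this
  exact this a b ha hb h

/-- An arbitrary set of ideals in the standard statement becomes an arbitrary internal one. The
element `f` stands for `1 - e` and avoids a transferred subtraction. -/
theorem exists_idempotent_mod_of_star {c : B.Elem} (hc : c ≠ 0)
    (H : E.Star (Set (Set B.Amb))) : ∃ e f : B.Elem, e + f = 1 ∧ ∀ 𝔭 : B.InternalMax,
      ((stMax 𝔭).1 ∈ H.1 → e ≠ 0 → ord 𝔭 c ≤ ord 𝔭 e) ∧
      ((stMax 𝔭).1 ∉ H.1 → f ≠ 0 → ord 𝔭 c ≤ ord 𝔭 f) := by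
  have := Star.Ev.of_forall (P := fun t : B.Idx => ∀ c, c ∈ car t → ¬ c = szero t →
    ∀ H : Set (Set B.Amb), ∃ e, e ∈ car t ∧ ∃ f, f ∈ car t ∧ sadd t e f = sone t ∧
      ∀ I, I ∈ smax t → (I ∈ H → ¬ e = szero t → sord t I c ≤ sord t I e) ∧
        (¬ I ∈ H → ¬ f = szero t → sord t I c ≤ sord t I f)) (by
      rintro t _ ⟨c, rfl⟩ hc H
      simp only [szero, incl_inj] at hc
      obtain ⟨e, he⟩ := exists_idempotent_mod hc (toSet t ⁻¹' H)
      refine ⟨incl t e, ⟨e, rfl⟩, incl t (1 - e), ⟨_, rfl⟩, by simp [sone], ?_⟩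
      rintro _ ⟨𝔪, h1, h2, rfl⟩
      have := he 𝔪 h1 h2
      simp only [szero, incl_inj, sord_incl, Nat.cast_le]
      exact this) B.base
  simp only [Star.ev_not, Star.ev_imp, Star.ev_and, Star.ev_mem, Star.ev_eq, Star.ev_le,
    Star.ev_forall, Star.ev_exists, map_szero, map_sone, map_sadd, map_car, map_smax, int_sord,
    Star.map_fst, Star.map_snd, Star.map_id, Star.fst_pair, Star.snd_pair, forall_st, exists_st,
    forall_stMax, map_szero_base, map_sone_base, starAdd_st, st_inj] at this
  exact this c hc H

end InternalDedekindRing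

/-! ### Hyperfinite sets as extensions of finite sets -/

theorem IsBaseSet.notMem_of_forall {T x : ZFSet.{u}} (hT : IsBaseSet T)
    (h : ∀ y ∈ x, InSuper T y) : x ∉ T := by
  intro hx
  rcases ZFSet.eq_empty_or_nonempty x with rfl | ⟨y, hy⟩
  · exact hT.1 hx
  · exact hT.2 x hx y hy (h y hy)

namespace NonstandardEmbedding

variable {S T : ZFSet.{u}} {E : NonstandardEmbedding S T}

theorem Internal.snd_of_pair {x y : ZFSet.{u}} (h : E.Internal (ZFSet.pair x y))
    (hx : InSuper T x) (hy : InSuper T y) : E.Internal y := by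
  have hT := E.isBaseSet_target
  have h1 := (IsSetIn.singleton hT hx).1
  have h2 := (IsSetIn.insert_singleton hT hx hy).1
  have h3 : E.Internal {x, y} := by
    refine h.mem (hT.notMem_of_forall fun z hz => ?_) (ZFSet.mem_pair.2 (Or.inr rfl))
    rcases ZFSet.mem_pair.1 hz with rfl | rfl
    exacts [h1, h2]
  refine h3.mem (hT.notMem_of_forall fun z hz => ?_) (ZFSet.mem_pair.2 (Or.inr rfl))
  rcases ZFSet.mem_pair.1 hz with rfl | rfl
  exacts [hx, hy]

namespace Star

variable {α : Type v₁} {β : Type v₂} [Coded S α] [Coded S β]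

theorem mem_map_iff {F : α → Set β} {x : E.Star α} {y : E.Star β} :
    y.1 ∈ (x.map F).1 ↔ (x.pair y).Ev fun p => p.2 ∈ F p.1 := by
  have h : map (fun p : α × β => F p.1) (x.pair y) = map F x := by
    rw [← map_map F (fun p : α × β => p.1), map_fst, map_id, fst_pair]
  rw [ev_mem, map_snd, map_id, snd_pair, h]

/-- Extensions of finite sets. -/
def Finite (s : E.Star (Set α)) : Prop := s.Ev Set.Finite

@[simp] theorem ev_finite (f : β → Set α) (x : E.Star β) :
    x.Ev (fun a => (f a).Finite) ↔ (x.map f).Finite := ev_map.symm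

theorem Finite.subset {s t : E.Star (Set α)} (ht : t.Finite)
    (h : ∀ x : E.Star α, x.1 ∈ s.1 → x.1 ∈ t.1) : s.Finite := by
  have := Ev.of_forall (P := fun p : Set α × Set α => p.2.Finite → (∀ x, x ∈ p.1 → x ∈ p.2) →
    p.1.Finite) (fun p h h' => h.subset h') (s.pair t)
  simp only [ev_imp, ev_finite, ev_forall, ev_mem, map_fst, map_snd, map_id, fst_pair,
    snd_pair] at this
  exact this ht h

/-- The bounding set in `Hyperfinite` is arbitrary, while `Star.Finite` refers to codes of subsets
of `α`. Coding is injective, so a set of codes is finite only if the coded set is, and this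
transfers. -/
theorem finite_of_hyperfinite {s : E.Star (Set α)} (h : E.Hyperfinite s.1) : s.Finite := by
  obtain ⟨A, hA, h⟩ := h
  have hS := E.isBaseSet_source
  have := transfer_ball (E := E) (.imp (.mem 0 2) (.mem 0 3)) (isSetIn_fin hS hA)
    [Coded.ext S (Set.univ : Set (Set α)), Coded.ext S {s : Set α | s.Finite}]
    (by simp [inSuper_ext hS]) (by
      intro x hx hx'
      rw [holds_imp]
      intro h
      obtain ⟨R, -, rfl⟩ := mem_ext.1 (show x ∈ Coded.ext S _ from h)
      refine code_mem_ext.2 ?_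
      have h1 := (ZFSet.mem_sep.1 hx).2
      refine (h1.preimage (f := code S) code_injective.injOn).subset fun a ha => ?_
      exact code_mem_ext.2 ha) h
  rw [holds_imp] at this
  exact this s.2

theorem Finite.hyperfinite {s : E.Star (Set α)} (h : s.Finite) : E.Hyperfinite s.1 := by
  have hS := E.isBaseSet_source
  refine ⟨_, isSetIn_ext hS (Set.univ : Set α),
    star_subset_star (isSetIn_ext hS _) (isSetIn_fin hS (isSetIn_ext hS _)) ?_ h⟩
  intro x hx
  obtain ⟨R, hR, rfl⟩ := mem_ext.1 hx
  refine ZFSet.mem_sep.2 ⟨?_, ?_⟩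
  · rw [← ext_univ_set]
    exact code_mem_ext.2 trivial
  · refine (Set.Finite.image (code S) hR).subset fun y hy => ?_
    obtain ⟨a, ha, rfl⟩ := mem_ext.1 hy
    exact ⟨a, ha, rfl⟩

end Star

theorem Hyperfinite.internal {x : ZFSet.{u}} (h : E.Hyperfinite x) : E.Internal x := by
  obtain ⟨A, hA, h⟩ := h
  exact ⟨_, isSetIn_fin E.isBaseSet_source hA, h⟩

end NonstandardEmbedding

namespace InternalDedekindRing

variable {S T : ZFSet.{u}} {E : NonstandardEmbedding S T} {B : InternalDedekindRing E}

/-! ### Hyperfinite sets of maximal ideals -/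

/-- An internal set of maximal ideals, as an element of the extension of a power set. -/
def stIdeals (H : Set B.InternalMax) (h : E.Internal (B.setCode H)) :
    E.Star (Set (Set B.Amb)) :=
  ⟨B.setCode H, Star.mem_of_internal h
    (E.isBaseSet_target.notMem_of_forall fun y hy => by
      obtain ⟨𝔭, -, rfl⟩ := mem_setCode.1 hy
      exact 𝔭.2.2.2.inSuper)
    fun y hy => by
      obtain ⟨𝔭, -, rfl⟩ := mem_setCode.1 hy
      exact (stMax 𝔭).2⟩

@[simp] theorem stMax_mem_stIdeals {H : Set B.InternalMax} {h : E.Internal (B.setCode H)}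
    {𝔭 : B.InternalMax} : (stMax 𝔭).1 ∈ (stIdeals H h).1 ↔ 𝔭 ∈ H := by
  refine Iff.trans (mem_setCode (B := B)) ⟨?_, fun h => ⟨𝔭, h, rfl⟩⟩
  rintro ⟨𝔮, h𝔮, h⟩
  rwa [stMax_injective (Star.ext h : stMax 𝔭 = stMax 𝔮)]

theorem exists_stMax_of_mem_stIdeals {H : Set B.InternalMax} {h : E.Internal (B.setCode H)}
    {I : E.Star (Set B.Amb)} (hI : I.1 ∈ (stIdeals H h).1) : ∃ 𝔭 ∈ H, I = stMax 𝔭 := by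
  obtain ⟨𝔭, h𝔭, h⟩ := mem_setCode.1 hI
  exact ⟨𝔭, h𝔭, Star.ext h⟩

theorem stIdeals_finite {H : Set B.InternalMax} (hH : H ∈ B.hyperfiniteSubsets) :
    (stIdeals H hH.internal).Finite := Star.finite_of_hyperfinite hH

theorem mem_hyperfiniteSubsets_of_finite {H : Set B.InternalMax} {s : E.Star (Set (Set B.Amb))}
    (hs : s.Finite) (hsm : ∀ I : E.Star (Set B.Amb), I.1 ∈ s.1 → I.1 ∈ (B.base.map smax).1)
    (h : ∀ 𝔭, (stMax 𝔭).1 ∈ s.1 ↔ 𝔭 ∈ H) : H ∈ B.hyperfiniteSubsets := by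
  have : B.setCode H = s.1 := by
    ext x
    rw [mem_setCode]
    constructor
    · rintro ⟨𝔭, h𝔭, rfl⟩
      exact (h 𝔭).2 h𝔭
    · intro hx
      have hx' : (⟨x, s.set_subset hx⟩ : E.Star (Set B.Amb)).1 ∈ s.1 := hx
      obtain ⟨𝔭, h𝔭⟩ := mem_map_smax_iff.1 (hsm _ hx')
      rw [h𝔭, h] at hx'
      exact ⟨𝔭, hx', congrArg Subtype.val h𝔭⟩
  have h := hs.hyperfinite
  rwa [← this] at h

/-- A subset of a hyperfinite set cut out by a transferred predicate with an internal parameter is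
internal, hence hyperfinite. In particular `ℒ` has intersections and relative complements. -/
theorem sep_mem_hyperfiniteSubsets {α : Type*} [Coded S α] (x : E.Star α)
    (P : α → Set B.Amb → Prop) {H : Set B.InternalMax} (hH : H ∈ B.hyperfiniteSubsets) :
    {𝔭 ∈ H | (x.pair (stMax 𝔭)).Ev fun p => P p.1 p.2} ∈ B.hyperfiniteSubsets := by
  -- The extension of the standard operation of separation, applied to the internal data.
  let s := (x.pair (stIdeals H hH.internal)).map
    (fun p : α × Set (Set B.Amb) => {I | I ∈ p.2 ∧ P p.1 I})
  have hs : ∀ I : E.Star (Set B.Amb), I.1 ∈ s.1 ↔ I.1 ∈ (stIdeals H hH.internal).1 ∧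
      (x.pair I).Ev fun p => P p.1 p.2 := by
    intro I
    have h1 : ((x.pair (stIdeals H hH.internal)).pair I).map
        (fun p : (α × Set (Set B.Amb)) × Set B.Amb => (p.1.1, p.2)) = x.pair I := by
      simp only [Star.map_prodMk, Star.map_fst, Star.map_snd, Star.map_id, Star.fst_pair,
        Star.snd_pair]
    rw [Star.mem_map_iff, ← h1, Star.ev_map]
    simp only [Set.mem_ofPred_eq, Star.ev_and, Star.ev_mem, Star.map_fst, Star.map_snd, Star.map_id,
      Star.fst_pair, Star.snd_pair]
  refine mem_hyperfiniteSubsets_of_finite (s := s)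
    ((stIdeals_finite hH).subset fun I hI => ((hs I).1 hI).1) (fun I hI => ?_) fun 𝔭 => ?_
  · obtain ⟨𝔭, -, rfl⟩ := exists_stMax_of_mem_stIdeals ((hs I).1 hI).1
    exact stMax_mem 𝔭
  · rw [hs, stMax_mem_stIdeals]
    rfl

theorem inter_mem_hyperfiniteSubsets {H K : Set B.InternalMax} (hH : H ∈ B.hyperfiniteSubsets)
    (hK : K ∈ B.hyperfiniteSubsets) : H ∩ K ∈ B.hyperfiniteSubsets := by
  have := sep_mem_hyperfiniteSubsets (stIdeals K hK.internal) (fun s I => I ∈ s) hH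
  simp only [Star.ev_mem, Star.map_fst, Star.map_snd, Star.map_id, Star.fst_pair, Star.snd_pair,
    stMax_mem_stIdeals] at this
  exact this

theorem diff_mem_hyperfiniteSubsets {H K : Set B.InternalMax} (hH : H ∈ B.hyperfiniteSubsets)
    (hK : K ∈ B.hyperfiniteSubsets) : H \ K ∈ B.hyperfiniteSubsets := by
  have := sep_mem_hyperfiniteSubsets (stIdeals K hK.internal) (fun s I => ¬ I ∈ s) hH
  simp only [Star.ev_not, Star.ev_mem, Star.map_fst, Star.map_snd, Star.map_id, Star.fst_pair,
    Star.snd_pair, stMax_mem_stIdeals] at this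
  exact this

theorem exists_idempotent_mod {c : B.Elem} (hc : c ≠ 0) {H : Set B.InternalMax}
    (hH : H ∈ B.hyperfiniteSubsets) : ∃ e f : B.Elem, e + f = 1 ∧ ∀ 𝔭 : B.InternalMax,
      (𝔭 ∈ H → e ≠ 0 → ord 𝔭 c ≤ ord 𝔭 e) ∧ (𝔭 ∉ H → f ≠ 0 → ord 𝔭 c ≤ ord 𝔭 f) := by
  have := exists_idempotent_mod_of_star hc (stIdeals H hH.internal)
  simpa only [stMax_mem_stIdeals] using this

/-! ### Internal divisors -/

/-- An internal divisor, as an element of the extension of a power set. -/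
def stDiv (d : B.WeilDiv) : E.Star (Set (Set B.Amb × E.StdInt)) :=
  have h : B.divGraph d.1 ⊆ E.star (Coded.ext S (Set.univ : Set (Set B.Amb × E.StdInt))) := by
    intro x hx
    obtain ⟨-, 𝔭, rfl⟩ := ZFSet.mem_sep.1 hx
    exact ((stMax 𝔭).pair (d.1 𝔭).toStar).2
  ⟨B.divGraph d.1, Star.mem_of_internal d.2.1
    (E.isBaseSet_target.notMem_of_forall fun _ hx =>
      (isSetIn_star (isSetIn_ext E.isBaseSet_source _)).inSuper_of_mem (h hx)) h⟩

@[simp] theorem pair_mem_stDiv {d : B.WeilDiv} {𝔭 : B.InternalMax} {n : E.Star E.StdInt} :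
    ZFSet.pair (stMax 𝔭).1 n.1 ∈ (stDiv d).1 ↔ d.1 𝔭 = .ofStar n :=
  pair_mem_divGraph (z := HyperInt.ofStar n)

/-- An internal divisor is accessible to transfer only through its graph, so the comparison is
rewritten as the existence of values `m ≤ n` in the two graphs. -/
theorem setOf_le_mem_hyperfiniteSubsets {H : Set B.InternalMax} (hH : H ∈ B.hyperfiniteSubsets)
    (d e : B.WeilDiv) : {𝔭 ∈ H | d.1 𝔭 ≤ e.1 𝔭} ∈ B.hyperfiniteSubsets := by
  have := sep_mem_hyperfiniteSubsets ((stDiv d).pair (stDiv e)) (fun G I =>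
    ∃ m, ∃ n, (I, m) ∈ G.1 ∧ (I, n) ∈ G.2 ∧ m.toInt ≤ n.toInt) hH
  simp only [Star.ev_and, Star.ev_mem, Star.ev_le, Star.ev_exists, Star.map_prodMk, Star.map_fst,
    Star.map_snd, Star.map_id, Star.fst_pair, Star.snd_pair, Star.pair_val, pair_mem_stDiv,
    Star.int_toInt] at this
  convert this using 3 with 𝔭
  refine and_congr_right fun _ => ?_
  constructor
  · exact fun h => ⟨(d.1 𝔭).toStar, (e.1 𝔭).toStar, rfl, rfl, h⟩
  · rintro ⟨m, n, h1, h2, h3⟩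
    rwa [h1, h2]

/-- The approximation theorem. -/
theorem exists_ord_eq (d : B.WeilDiv) {H : Set B.InternalMax} (hH : H ∈ B.hyperfiniteSubsets)
    (h0 : ∀ 𝔭 ∈ H, 0 ≤ d.1 𝔭) : ∃ a : B.Elem, a ≠ 0 ∧ ∀ 𝔭 ∈ H, ord 𝔭 a = d.1 𝔭 := by
  have := Star.Ev.of_forall (P := fun t : B.Idx => ∀ H : Set (Set B.Amb), H.Finite →
    (∀ I, I ∈ H → I ∈ smax t) → ∀ G : Set (Set B.Amb × E.StdInt),
    (∀ I, I ∈ H → ∀ m, ∀ n, (I, m) ∈ G → (I, n) ∈ G → m.toInt = n.toInt) →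
    ∃ a, a ∈ car t ∧ ¬ a = szero t ∧ ∀ I, I ∈ H → ∀ n, (I, n) ∈ G → 0 ≤ n.toInt →
      sord t I a = n.toInt) (by
      classical
      intro t H hH hHm G hG
      obtain ⟨a, ha, h⟩ := exists_ordAt_eq (toSet t ⁻¹' H) (hH.preimage (toSet_injective t).injOn)
        (fun 𝔪 h𝔪 => by
          obtain ⟨𝔪', h1, h2, h3⟩ := hHm _ h𝔪
          rw [toSet_injective t h3]
          exact ⟨h1, h2⟩)
        -- The default `0` and the truncation `toNat` do no harm: the conclusion concerns only pairs
        -- in `G` with nonnegative second entry, and `hG` makes the chosen value the only one.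
        (fun 𝔪 => if h : ∃ n, (toSet t 𝔪, n) ∈ G then h.choose.toInt.toNat else 0)
      refine ⟨incl t a, ⟨a, rfl⟩, by simpa [szero] using ha, fun I hI n hn h0 => ?_⟩
      obtain ⟨𝔪, -, -, rfl⟩ := hHm I hI
      have hn' : ∃ n, (toSet t 𝔪, n) ∈ G := ⟨n, hn⟩
      have h1 := h 𝔪 hI
      rw [dif_pos hn', hG _ hI _ _ hn'.choose_spec hn] at h1
      rw [sord_incl, h1]
      exact Int.toNat_of_nonneg h0) B.base
  simp only [Star.ev_not, Star.ev_imp, Star.ev_and, Star.ev_mem, Star.ev_eq, Star.ev_le,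
    Star.ev_int_eq, Star.ev_forall, Star.ev_exists, Star.ev_finite, map_szero, map_car, map_smax,
    int_sord, Star.int_zero, Star.int_toInt, Star.map_prodMk, Star.map_fst, Star.map_snd,
    Star.map_id, Star.fst_pair, Star.snd_pair, Star.pair_val, exists_st,
    map_szero_base, st_inj] at this
  obtain ⟨a, ha, h⟩ := this (stIdeals H hH.internal) (stIdeals_finite hH) (by
      intro I hI
      obtain ⟨𝔭, -, rfl⟩ := exists_stMax_of_mem_stIdeals hI
      exact stMax_mem 𝔭) (stDiv d) (by
      intro I hI m n hm hn
      obtain ⟨𝔭, -, rfl⟩ := exists_stMax_of_mem_stIdeals hI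
      rw [pair_mem_stDiv] at hm hn
      exact hm.symm.trans hn)
  refine ⟨a, ha, fun 𝔭 h𝔭 => ?_⟩
  exact h (stMax 𝔭) (stMax_mem_stIdeals.2 h𝔭) (d.1 𝔭).toStar (pair_mem_stDiv.2 rfl) (h0 𝔭 h𝔭)

/-- In a Dedekind domain a nonzero element lies in finitely many maximal ideals; the extension of
this finite set is the support. -/
theorem support_mem_hyperfiniteSubsets {a : B.Elem} (ha : a ≠ 0) :
    {𝔭 : B.InternalMax | ord 𝔭 a ≠ 0} ∈ B.hyperfiniteSubsets := by
  let F : B.Idx × B.Amb → Set (Set B.Amb) := fun p => {I | I ∈ smax p.1 ∧ ¬ sord p.1 I p.2 = 0}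
  have hfin := Star.Ev.of_forall (P := fun t : B.Idx => ∀ a, a ∈ car t → ¬ a = szero t →
      (F (t, a)).Finite) (by
    rintro t _ ⟨a, rfl⟩ ha
    simp only [szero, incl_inj] at ha
    refine ((finite_setOf_mem ha).image (toSet t)).subset ?_
    rintro _ ⟨⟨𝔪, h1, h2, rfl⟩, h⟩
    refine ⟨𝔪, ⟨h1, h2, (ordAt_ne_zero_iff h1 ha).1 ?_⟩, rfl⟩
    simpa using h) B.base
  simp only [Star.ev_not, Star.ev_imp, Star.ev_mem, Star.ev_eq, Star.ev_forall, Star.ev_finite,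
    map_szero, map_car, Star.map_fst, Star.map_snd, Star.map_id, Star.fst_pair, Star.snd_pair,
    forall_st, map_szero_base, st_inj] at hfin
  have hs : ∀ I : E.Star (Set B.Amb), I.1 ∈ ((B.base.pair (st a)).map F).1 ↔
      I.1 ∈ (B.base.map smax).1 ∧ starOrd B.base I (st a) ≠ 0 := by
    intro I
    rw [Star.mem_map_iff]
    simp only [F, Set.mem_ofPred_eq, Star.ev_and, Star.ev_not, Star.ev_mem, Star.ev_int_eq,
      int_sord, Star.int_zero, map_smax, Star.map_fst, Star.map_snd, Star.map_id, Star.fst_pair,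
      Star.snd_pair, ne_eq]
  refine mem_hyperfiniteSubsets_of_finite (hfin a ha) (fun I hI => ((hs I).1 hI).1) fun 𝔭 => ?_
  rw [hs]
  exact and_iff_right (stMax_mem 𝔭)

/-- The graph of the orders of `a` is the value of a standard function at the point `(base, a)`,
hence internal. -/
theorem ord_mem_WeilDiv {a : B.Elem} (ha : a ≠ 0) : (fun 𝔭 => ord 𝔭 a) ∈ B.WeilDiv := by
  refine ⟨?_, _, support_mem_hyperfiniteSubsets ha, fun 𝔭 h𝔭 => not_not.1 h𝔭⟩
  let F : B.Idx × B.Amb → Set (Set B.Amb × E.StdInt) :=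
    fun p => {q | q.1 ∈ smax p.1 ∧ sord p.1 q.1 p.2 = q.2.toInt}
  have hF : B.divGraph (fun 𝔭 => ord 𝔭 a) = ((B.base.pair (st a)).map F).1 := by
    have hs : ∀ (I : E.Star (Set B.Amb)) (n : E.Star E.StdInt),
        (I.pair n).1 ∈ ((B.base.pair (st a)).map F).1 ↔
        I.1 ∈ (B.base.map smax).1 ∧ starOrd B.base I (st a) = .ofStar n := by
      intro I n
      rw [Star.mem_map_iff]
      simp only [F, Set.mem_ofPred_eq, Star.ev_and, Star.ev_mem, Star.ev_int_eq, Star.int_toInt,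
        int_sord, map_smax, Star.map_fst, Star.map_snd, Star.map_id, Star.fst_pair, Star.snd_pair]
    ext x
    constructor
    · intro hx
      obtain ⟨-, 𝔭, rfl⟩ := ZFSet.mem_sep.1 hx
      exact (hs (stMax 𝔭) (ord 𝔭 a).toStar).2 ⟨stMax_mem 𝔭, rfl⟩
    · intro hx
      obtain ⟨I, n, h⟩ := Star.exists_eq_pair
        (⟨x, Star.set_subset _ hx⟩ : E.Star (Set B.Amb × E.StdInt))
      obtain rfl : x = (I.pair n).1 := congrArg Subtype.val h
      obtain ⟨h1, h2⟩ := (hs I n).1 hx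
      obtain ⟨𝔭, rfl⟩ := mem_map_smax_iff.1 h1
      exact (pair_mem_divGraph (d := fun 𝔭 => ord 𝔭 a) (z := HyperInt.ofStar n)).2 h2
  rw [hF]
  exact Star.internal _

/-- The divisor of a nonzero element. -/
def divisor (a : B.Elem) (ha : a ≠ 0) : B.WeilDiv := ⟨_, ord_mem_WeilDiv ha⟩

/-! ### Internal powers -/

/-- The power of an ideal, with `I ^ n = ⊤` for `n ≤ 0`. -/
def spow (t : B.Idx) (I : Set B.Amb) (n : ℤ) : Set B.Amb := toSet t (idl t I ^ n.toNat)

/-- The extension of the power functions. -/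
def starPow (t : E.Star B.Idx) (I : E.Star (Set B.Amb)) (n : E.HyperInt) : E.Star (Set B.Amb) :=
  (t.pair (I.pair n.toStar)).map fun p => spow p.1 p.2.1 p.2.2.toInt

@[simp] theorem map_spow {γ : Type*} [Coded S γ] (t : γ → B.Idx) (I : γ → Set B.Amb) (n : γ → ℤ)
    (w : E.Star γ) :
    w.map (fun a => spow (t a) (I a) (n a)) = starPow (w.map t) (w.map I) (w.int n) := by
  rw [starPow, Star.int, HyperInt.toStar_ofStar, ← Star.map_prodMk, ← Star.map_prodMk,
    Star.map_map]
  rfl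

variable (𝔭 : B.InternalMax)

/-- These properties are bundled so as to be transferred at once. They contain only the inclusion `P
n * 𝔭 ≤ P (n + 1)` of the recursion; the other one comes from `exists_generators`. -/
theorem mem_starPow_aux (n : E.HyperInt) :
    (∀ x : E.Star B.Amb, x.1 ∈ (starPow B.base (stMax 𝔭) n).1 → x.1 ∈ (B.base.map car).1) ∧
    (st (0 : B.Elem)).1 ∈ (starPow B.base (stMax 𝔭) n).1 ∧
    (∀ x y : B.Elem, x.1 ∈ (starPow B.base (stMax 𝔭) n).1 →
      y.1 ∈ (starPow B.base (stMax 𝔭) n).1 → (x + y).1 ∈ (starPow B.base (stMax 𝔭) n).1) ∧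
    (∀ x y : B.Elem, y.1 ∈ (starPow B.base (stMax 𝔭) n).1 →
      (x * y).1 ∈ (starPow B.base (stMax 𝔭) n).1) ∧
    (n ≤ 0 → ∀ x : B.Elem, x.1 ∈ (starPow B.base (stMax 𝔭) n).1) ∧
    (0 ≤ n → ∀ x y : B.Elem, x.1 ∈ (starPow B.base (stMax 𝔭) n).1 → y.1 ∈ (stMax 𝔭).1 →
      (x * y).1 ∈ (starPow B.base (stMax 𝔭) (n + 1)).1) ∧
    (∀ x : B.Elem, x ≠ 0 → (x.1 ∈ (starPow B.base (stMax 𝔭) n).1 ↔ n ≤ ord 𝔭 x)) := by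
  have := Star.Ev.of_forall (P := fun t : B.Idx => ∀ I, I ∈ smax t → ∀ n : E.StdInt,
    (∀ x, x ∈ spow t I n.toInt → x ∈ car t) ∧ szero t ∈ spow t I n.toInt ∧
    (∀ x, x ∈ car t → ∀ y, y ∈ car t → x ∈ spow t I n.toInt → y ∈ spow t I n.toInt →
      sadd t x y ∈ spow t I n.toInt) ∧
    (∀ x, x ∈ car t → ∀ y, y ∈ car t → y ∈ spow t I n.toInt → smul t x y ∈ spow t I n.toInt) ∧
    (n.toInt ≤ 0 → ∀ x, x ∈ car t → x ∈ spow t I n.toInt) ∧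
    (0 ≤ n.toInt → ∀ x, x ∈ car t → ∀ y, y ∈ car t → x ∈ spow t I n.toInt → y ∈ I →
      smul t x y ∈ spow t I (n.toInt + 1)) ∧
    (∀ x, x ∈ car t → ¬ x = szero t → (x ∈ spow t I n.toInt ↔ n.toInt ≤ sord t I x))) (by
      rintro t _ ⟨𝔪, h1, h2, rfl⟩ n
      simp only [forall_mem_car, spow, idl_toSet, szero, sadd_incl, smul_incl, incl_mem_toSet,
        incl_inj, sord_incl]
      refine ⟨fun x hx => toSet_subset t _ hx, Ideal.zero_mem _, fun x y => Ideal.add_mem _,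
        fun x y => Ideal.mul_mem_left _ x, fun hn x => ?_, fun hn x y hx hy => ?_, fun x hx => ?_⟩
      · rw [Int.toNat_of_nonpos hn, pow_zero, Ideal.one_eq_top]
        trivial
      · rw [Int.toNat_add hn zero_le_one, Int.toNat_one, pow_succ]
        exact Ideal.mul_mem_mul hx hy
      · rw [mem_pow_iff_le_ordAt h1 hx, Int.toNat_le]) B.base
  simp only [Star.ev_not, Star.ev_imp, Star.ev_and, Star.ev_iff, Star.ev_mem, Star.ev_eq,
    Star.ev_le, Star.ev_forall, map_szero, map_car, map_smax, map_sadd, map_smul, map_spow,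
    int_sord, Star.int_zero, Star.int_one, Star.int_add, Star.int_toInt, Star.map_fst,
    Star.map_snd, Star.map_id, Star.fst_pair, Star.snd_pair, forall_st, forall_stMax,
    map_szero_base, starAdd_st, starMul_st, st_inj, st_val] at this
  exact this 𝔭 n.toStar

theorem exists_generators : ∃ g ∈ 𝔭.1, ∃ h ∈ 𝔭.1, ∀ n : E.HyperInt, 0 ≤ n → ∀ x : B.Elem,
    x.1 ∈ (starPow B.base (stMax 𝔭) (n + 1)).1 → ∃ y z : B.Elem,
      y.1 ∈ (starPow B.base (stMax 𝔭) n).1 ∧ z.1 ∈ (starPow B.base (stMax 𝔭) n).1 ∧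
      x = y * g + z * h := by
  have := Star.Ev.of_forall (P := fun t : B.Idx => ∀ I, I ∈ smax t → ∃ g, g ∈ car t ∧ g ∈ I ∧
    ∃ h, h ∈ car t ∧ h ∈ I ∧ ∀ n : E.StdInt, 0 ≤ n.toInt → ∀ x, x ∈ car t →
    x ∈ spow t I (n.toInt + 1) → ∃ y, y ∈ car t ∧ ∃ z, z ∈ car t ∧ y ∈ spow t I n.toInt ∧
      z ∈ spow t I n.toInt ∧ x = sadd t (smul t y g) (smul t z h)) (by
      rintro t _ ⟨𝔪, h1, h2, rfl⟩
      obtain ⟨g, hg, h, hh, key⟩ := exists_pow_succ_generators h2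
      refine ⟨incl t g, ⟨g, rfl⟩, incl_mem_toSet.2 hg, incl t h, ⟨h, rfl⟩, incl_mem_toSet.2 hh, ?_⟩
      simp only [forall_mem_car, exists_mem_car, spow, idl_toSet, sadd_incl, smul_incl,
        incl_mem_toSet, incl_inj]
      intro n hn x hx
      rw [Int.toNat_add hn zero_le_one, Int.toNat_one] at hx
      obtain ⟨y, hy, z, hz, hxyz⟩ := key _ x hx
      exact ⟨y, z, hy, hz, hxyz⟩) B.base
  simp only [Star.ev_imp, Star.ev_and, Star.ev_mem, Star.ev_eq,
    Star.ev_le, Star.ev_forall, Star.ev_exists, map_car, map_smax, map_sadd, map_smul, map_spow,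
    Star.int_zero, Star.int_one, Star.int_add, Star.int_toInt, Star.map_fst,
    Star.map_snd, Star.map_id, Star.fst_pair, Star.snd_pair, forall_st, exists_st, forall_stMax,
    starAdd_st, starMul_st, st_inj, st_val] at this
  obtain ⟨g, hg, h, hh, key⟩ := this 𝔭
  exact ⟨g, mem_stMax.1 hg, h, mem_stMax.1 hh, fun n => key n.toStar⟩

/-- The internal power `𝔭 ^ n`. -/
def internalPow (n : E.HyperInt) : Ideal B.Elem where
  carrier := {x | x.1 ∈ (starPow B.base (stMax 𝔭) n).1}
  zero_mem' := (mem_starPow_aux 𝔭 n).2.1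
  add_mem' {x y} := (mem_starPow_aux 𝔭 n).2.2.1 x y
  smul_mem' x y := (mem_starPow_aux 𝔭 n).2.2.2.1 x y

theorem idealCode_internalPow (n : E.HyperInt) :
    B.idealCode (internalPow 𝔭 n) = (starPow B.base (stMax 𝔭) n).1 := by
  ext x
  constructor
  · exact fun hx => (mem_idealCode (x := ⟨x, idealCode_subset _ hx⟩)).1 hx
  · intro hx
    obtain ⟨y, hy⟩ := exists_eq_st ((mem_starPow_aux 𝔭 n).1 ⟨x, Star.set_subset _ hx⟩ hx)
    obtain rfl : x = y.1 := congrArg Subtype.val hy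
    exact mem_idealCode.2 hx

theorem mem_internalPow_iff_le_ord {n : E.HyperInt} {x : B.Elem} (hx : x ≠ 0) :
    x ∈ internalPow 𝔭 n ↔ n ≤ ord 𝔭 x :=
  (mem_starPow_aux 𝔭 n).2.2.2.2.2.2 x hx

theorem internalPow_of_nonpos {n : E.HyperInt} (hn : n ≤ 0) : internalPow 𝔭 n = ⊤ :=
  eq_top_iff.2 fun x _ => (mem_starPow_aux 𝔭 n).2.2.2.2.1 hn x

/-- The product on the right is the ordinary one, made of finite sums, whereas the transferred power
a priori involves hyperfinite sums. The two generators of `𝔭` reconcile them. -/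
theorem internalPow_add_one {n : E.HyperInt} (hn : 0 ≤ n) :
    internalPow 𝔭 (n + 1) = internalPow 𝔭 n * 𝔭.1 := by
  refine le_antisymm (fun x hx => ?_) (Ideal.mul_le.2 fun x hx y hy => ?_)
  · obtain ⟨g, hg, h, hh, key⟩ := exists_generators 𝔭
    obtain ⟨y, z, hy, hz, rfl⟩ := key n hn x hx
    exact Ideal.add_mem _ (Ideal.mul_mem_mul hy hg) (Ideal.mul_mem_mul hz hh)
  · exact (mem_starPow_aux 𝔭 n).2.2.2.2.2.1 hn x y hx (mem_stMax.2 hy)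

/-- The graph of an internal sequence of ideals. -/
def seqGraph (P : E.HyperInt → Ideal B.Elem) : ZFSet.{u} :=
  ((E.star E.intSet).prod B.carrier.powerset).sep fun t =>
    ∃ n : E.HyperInt, t = ZFSet.pair n.val (B.idealCode (P n))

theorem mem_seqGraph {P : E.HyperInt → Ideal B.Elem} {t : ZFSet.{u}} :
    t ∈ seqGraph P ↔ ∃ n : E.HyperInt, t = ZFSet.pair n.val (B.idealCode (P n)) := by
  rw [seqGraph, ZFSet.mem_sep]
  refine ⟨fun h => h.2, fun h => ⟨?_, h⟩⟩
  obtain ⟨n, rfl⟩ := h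
  exact ZFSet.pair_mem_prod.2 ⟨n.mem, ZFSet.mem_powerset.2 (idealCode_subset _)⟩

theorem pair_mem_seqGraph {P : E.HyperInt → Ideal B.Elem} {n : E.HyperInt} {x : ZFSet.{u}} :
    ZFSet.pair n.val x ∈ seqGraph P ↔ x = B.idealCode (P n) := by
  rw [mem_seqGraph]
  constructor
  · rintro ⟨m, h⟩
    obtain ⟨h1, h2⟩ := ZFSet.pair_inj.1 h
    rw [h2, HyperInt.ext h1]
  · rintro rfl
    exact ⟨n, rfl⟩

theorem isPowerSeq_internalPow : IsPowerSeq 𝔭.1 (internalPow 𝔭) := by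
  refine ⟨?_, fun n => internalPow_of_nonpos 𝔭, fun n => internalPow_add_one 𝔭⟩
  let F : B.Idx × Set B.Amb → Set (E.StdInt × Set B.Amb) :=
    fun p => {q | q.2 = spow p.1 p.2 q.1.toInt}
  have hF : seqGraph (internalPow 𝔭) = ((B.base.pair (stMax 𝔭)).map F).1 := by
    have hs : ∀ (n : E.Star E.StdInt) (I : E.Star (Set B.Amb)),
        (n.pair I).1 ∈ ((B.base.pair (stMax 𝔭)).map F).1 ↔
        I = starPow B.base (stMax 𝔭) (.ofStar n) := by
      intro n I
      rw [Star.mem_map_iff]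
      simp only [F, Set.mem_ofPred_eq, Star.ev_eq, Star.int_toInt, map_spow, Star.map_fst,
        Star.map_snd, Star.map_id, Star.fst_pair, Star.snd_pair]
    ext x
    rw [mem_seqGraph]
    constructor
    · rintro ⟨n, rfl⟩
      rw [idealCode_internalPow]
      exact (hs n.toStar _).2 rfl
    · intro hx
      obtain ⟨n, I, h⟩ := Star.exists_eq_pair
        (⟨x, Star.set_subset _ hx⟩ : E.Star (E.StdInt × Set B.Amb))
      obtain rfl : x = (n.pair I).1 := congrArg Subtype.val h
      refine ⟨.ofStar n, ?_⟩
      rw [idealCode_internalPow, (hs n I).1 hx]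
      rfl
  change E.Internal (seqGraph (internalPow 𝔭))
  rw [hF]
  exact Star.internal _

/-- The graph of an internal sequence of ideals, as an element of the extension of a power set. -/
theorem exists_star_seqGraph {P : E.HyperInt → Ideal B.Elem} (h : E.Internal (seqGraph P)) :
    ∃ G : E.Star (Set (E.StdInt × Set B.Amb)), G.1 = seqGraph P := by
  have hT := E.isBaseSet_target
  have hI : ∀ n, InSuper T (B.idealCode (P n)) := fun n =>
    (B.internal_aux.1.subset hT (idealCode_subset (P n))).1
  have hnT : seqGraph P ∉ T := hT.notMem_of_forall fun y hy => by
    obtain ⟨n, rfl⟩ := mem_seqGraph.1 hy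
    exact InSuper.pair hT n.inSuper (hI n)
  refine ⟨⟨seqGraph P, Star.mem_of_internal h hnT fun y hy => ?_⟩, rfl⟩
  have hy' := h.mem hnT hy
  obtain ⟨n, rfl⟩ := mem_seqGraph.1 hy
  exact (n.toStar.pair (stSet (P n) (hy'.snd_of_pair n.inSuper (hI n)))).2

/-- Internal induction: the indices where two internal power sequences differ form an internal set
of positive hyperintegers. At a least such `m` the sequences agree at `m - 1 ≥ 0`, and the recursion
forces agreement at `m`. Internality of the graph is what makes a least index available. -/
theorem IsPowerSeq.eq_internalPow {P : E.HyperInt → Ideal B.Elem} (hP : IsPowerSeq 𝔭.1 P)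
    (n : E.HyperInt) : P n = internalPow 𝔭 n := by
  by_contra hn
  obtain ⟨hint, h0, hsucc⟩ := hP
  obtain ⟨G, hG⟩ := exists_star_seqGraph (P := P) hint
  obtain ⟨G', hG'⟩ := exists_star_seqGraph (isPowerSeq_internalPow 𝔭).1
  -- The indices with a pair in the first graph but not in the second; as both are graphs of
  -- functions, this is where the sequences differ.
  let s := (G.pair G').map fun p : Set (E.StdInt × Set B.Amb) × Set (E.StdInt × Set B.Amb) =>
    {n | ∃ I, (n, I) ∈ p.1 ∧ ¬ (n, I) ∈ p.2}
  have hs : ∀ m : E.HyperInt, m.val ∈ s.1 ↔ P m ≠ internalPow 𝔭 m := by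
    intro m
    rw [← HyperInt.toStar_val, Star.mem_map_iff]
    simp only [Set.mem_ofPred_eq, Star.ev_exists, Star.ev_and, Star.ev_not, Star.ev_mem,
      Star.map_prodMk, Star.map_fst, Star.map_snd, Star.map_id, Star.fst_pair, Star.snd_pair,
      Star.pair_val, hG, hG', HyperInt.toStar_val, pair_mem_seqGraph]
    constructor
    · rintro ⟨I, h1, h2⟩ h3
      exact h2 (h3 ▸ h1)
    · intro h
      have hm : ZFSet.pair m.val (B.idealCode (P m)) ∈ G.1 := by
        rw [hG, pair_mem_seqGraph]
      obtain ⟨k, I, hkI⟩ := Star.exists_eq_pair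
        (⟨_, Star.set_subset _ hm⟩ : E.Star (E.StdInt × Set B.Amb))
      have hI := (ZFSet.pair_inj.1 (congrArg Subtype.val hkI)).2
      exact ⟨I, hI.symm, fun h' => h (idealCode_injective (hI.trans h'))⟩
  obtain ⟨m, hm, hmin⟩ := HyperInt.exists_least s (n := n) ((hs n).2 hn) fun k hk => by
    by_contra hk0
    exact (hs k).1 hk ((h0 k (le_of_not_ge hk0)).trans
      (internalPow_of_nonpos 𝔭 (le_of_not_ge hk0)).symm)
  have hm' := (hs m).1 hm
  have hm0 : 0 < m := by
    by_contra hk0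
    exact hm' ((h0 m (le_of_not_gt hk0)).trans (internalPow_of_nonpos 𝔭 (le_of_not_gt hk0)).symm)
  have hm1 : 0 ≤ m - 1 := by
    rw [sub_nonneg]
    simpa using HyperInt.add_one_le_iff.2 hm0
  have hlt : ¬ m ≤ m - 1 := by
    rw [not_le, ← HyperInt.add_one_le_iff, sub_add_cancel]
  have hprev : P (m - 1) = internalPow 𝔭 (m - 1) := by
    by_contra h
    exact hlt (hmin _ ((hs _).2 h))
  refine hm' ?_
  have h1 := hsucc _ hm1
  have h2 := internalPow_add_one 𝔭 hm1
  rw [sub_add_cancel] at h1 h2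
  rw [h1, h2, hprev]

variable {𝔭}

/-- Uniqueness of the power sequence removes the existential quantifier in `IsOrd`, and the internal
powers are described by inequalities for `ord`. -/
theorem isOrd_iff {a : B.Elem} (ha : a ≠ 0) {n : E.HyperInt} : IsOrd 𝔭.1 a n ↔ ord 𝔭 a = n := by
  have key : (a ∈ internalPow 𝔭 n ∧ a ∉ internalPow 𝔭 (n + 1)) ↔ ord 𝔭 a = n := by
    rw [mem_internalPow_iff_le_ord 𝔭 ha, mem_internalPow_iff_le_ord 𝔭 ha,
      HyperInt.add_one_le_iff, not_lt, le_antisymm_iff, and_comm]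
  rw [← key]
  constructor
  · rintro ⟨P, hP, h1, h2⟩
    rw [hP.eq_internalPow 𝔭] at h1 h2
    exact ⟨h1, h2⟩
  · exact fun h => ⟨_, isPowerSeq_internalPow 𝔭, h⟩

theorem isDivisorOf_iff {a : B.Elem} (ha : a ≠ 0) {d : B.WeilDiv} :
    IsDivisorOf a d ↔ d = divisor a ha := by
  constructor
  · exact fun h => Subtype.ext (funext fun 𝔭 => ((isOrd_iff ha).1 (h 𝔭)).symm)
  · rintro rfl
    exact fun 𝔭 => (isOrd_iff ha).2 rfl

/-! ### Maximal filters -/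

theorem IsProperFilter.empty_notMem {F : Set (Set B.InternalMax)} (hF : B.IsProperFilter F) :
    ∅ ∉ F := fun h =>
  hF.proper (hF.subset.antisymm fun K hK => hF.mem_of_superset ∅ h K hK (Set.empty_subset K))

/-- If every `H ∈ ℱ` met `K`, the sets containing some `H ∩ K` would form a proper filter that
contains `ℱ` and `K`. -/
theorem MaximalFilter.exists_disjoint (F : B.MaximalFilter) {K : Set B.InternalMax}
    (hK : K ∈ B.hyperfiniteSubsets) (hKF : K ∉ F.1) : ∃ H ∈ F.1, H ∩ K = ∅ := by
  by_contra! hne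
  have hF := F.2.prop
  let G : Set (Set B.InternalMax) := {L | L ∈ B.hyperfiniteSubsets ∧ ∃ H ∈ F.1, H ∩ K ⊆ L}
  have hG : B.IsProperFilter G := by
    refine ⟨fun L hL => hL.1, ?_, ?_, ?_, ?_⟩
    · obtain ⟨H, hH⟩ := hF.nonempty
      exact ⟨K, hK, H, hH, Set.inter_subset_right⟩
    · rintro L ⟨hL, H, hH, h⟩ L' ⟨hL', H', hH', h'⟩
      refine ⟨inter_mem_hyperfiniteSubsets hL hL', H ∩ H', hF.inter_mem H hH H' hH', fun x hx => ?_⟩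
      exact ⟨h ⟨hx.1.1, hx.2⟩, h' ⟨hx.1.2, hx.2⟩⟩
    · rintro L ⟨hL, H, hH, h⟩ L' hL' hLL'
      exact ⟨hL', H, hH, h.trans hLL'⟩
    · intro h
      obtain ⟨-, H, hH, h'⟩ : ∅ ∈ G := h ▸ empty_mem_hyperfiniteSubsets
      obtain ⟨x, hx⟩ := hne H hH
      exact h' hx
  have hFG : F.1 ≤ G := fun H hH => ⟨hF.subset hH, H, hH, Set.inter_subset_left⟩
  obtain ⟨H, hH⟩ := hF.nonempty
  exact hKF (F.2.le_of_ge hG hFG ⟨hK, H, hH, Set.inter_subset_right⟩)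

theorem MaximalFilter.diff_mem (F : B.MaximalFilter) {H K : Set B.InternalMax} (hH : H ∈ F.1)
    (hK : K ∈ B.hyperfiniteSubsets) (hKF : K ∉ F.1) : H \ K ∈ F.1 := by
  have hF := F.2.prop
  obtain ⟨L, hL, h⟩ := F.exists_disjoint hK hKF
  refine hF.mem_of_superset _ (hF.inter_mem L hL H hH) _
    (diff_mem_hyperfiniteSubsets (hF.subset hH) hK) fun x hx => ⟨hx.2, fun hxK => ?_⟩
  have : x ∈ L ∩ K := ⟨hx.1, hxK⟩
  rw [h] at this
  exact this

/-! ### The ordered groups of divisors modulo maximal filters -/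

namespace DivMod

variable {F : B.MaximalFilter}

theorem mk_surjective : Function.Surjective (DivMod.mk F) := QuotientAddGroup.mk'_surjective _

theorem mk_eq_mk {d e : B.WeilDiv} : DivMod.mk F d = DivMod.mk F e ↔
    ∃ H ∈ F.1, ∀ 𝔭 ∈ H, d.1 𝔭 = e.1 𝔭 := by
  refine QuotientAddGroup.eq.trans ?_
  refine exists_congr fun H => and_congr_right fun _ => forall₂_congr fun 𝔭 _ => ?_
  rw [AddSubgroup.coe_add, AddSubgroup.coe_neg, Pi.add_apply, Pi.neg_apply, neg_add_eq_zero]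

theorem mk_le_mk {d e : B.WeilDiv} : DivMod.mk F d ≤ DivMod.mk F e ↔
    ∃ H ∈ F.1, ∀ 𝔭 ∈ H, d.1 𝔭 ≤ e.1 𝔭 := by
  constructor
  · rintro ⟨d', e', hd, he, H, hH, h⟩
    obtain ⟨K, hK, hd⟩ := mk_eq_mk.1 hd
    obtain ⟨L, hL, he⟩ := mk_eq_mk.1 he
    refine ⟨H ∩ (K ∩ L), F.2.prop.inter_mem H hH _ (F.2.prop.inter_mem K hK L hL), fun 𝔭 h𝔭 => ?_⟩
    rw [← hd 𝔭 h𝔭.2.1, ← he 𝔭 h𝔭.2.2]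
    exact h 𝔭 h𝔭.1
  · exact fun h => ⟨d, e, rfl, rfl, h⟩

theorem le_antisymm' {x y : DivMod F} (hxy : x ≤ y) (hyx : y ≤ x) : x = y := by
  obtain ⟨d, rfl⟩ := mk_surjective x
  obtain ⟨e, rfl⟩ := mk_surjective y
  obtain ⟨H, hH, h⟩ := mk_le_mk.1 hxy
  obtain ⟨K, hK, h'⟩ := mk_le_mk.1 hyx
  exact mk_eq_mk.2 ⟨H ∩ K, F.2.prop.inter_mem H hH K hK, fun 𝔭 h𝔭 =>
    le_antisymm (h 𝔭 h𝔭.1) (h' 𝔭 h𝔭.2)⟩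

/-- Inside a member `H` of `ℱ`, either the hyperfinite set where `d ≤ e` or its relative complement
belongs to `ℱ`. -/
theorem le_total' (x y : DivMod F) : x ≤ y ∨ y ≤ x := by
  obtain ⟨d, rfl⟩ := mk_surjective x
  obtain ⟨e, rfl⟩ := mk_surjective y
  obtain ⟨H, hH⟩ := F.2.prop.nonempty
  have hK := setOf_le_mem_hyperfiniteSubsets (F.2.prop.subset hH) d e
  by_cases h : {𝔭 ∈ H | d.1 𝔭 ≤ e.1 𝔭} ∈ F.1
  · exact Or.inl (mk_le_mk.2 ⟨_, h, fun 𝔭 h𝔭 => h𝔭.2⟩)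
  · refine Or.inr (mk_le_mk.2 ⟨_, F.diff_mem hH hK h, fun 𝔭 h𝔭 => ?_⟩)
    exact (not_le.1 fun hle => h𝔭.2 ⟨h𝔭.1, hle⟩).le

instance : LinearOrder (DivMod F) where
  le_refl x := (le_total' x x).elim id id
  le_trans x y z hxy hyz := by
    obtain ⟨d, rfl⟩ := mk_surjective x
    obtain ⟨e, rfl⟩ := mk_surjective y
    obtain ⟨f, rfl⟩ := mk_surjective z
    obtain ⟨H, hH, h⟩ := mk_le_mk.1 hxy
    obtain ⟨K, hK, h'⟩ := mk_le_mk.1 hyz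
    exact mk_le_mk.2 ⟨H ∩ K, F.2.prop.inter_mem H hH K hK, fun 𝔭 h𝔭 =>
      (h 𝔭 h𝔭.1).trans (h' 𝔭 h𝔭.2)⟩
  lt_iff_le_not_ge x y :=
    ⟨fun h => ⟨h.1, fun h' => h.2 (le_antisymm' h.1 h')⟩,
      fun h => ⟨h.1, fun h' => h.2 (h' ▸ (le_total' x x).elim id id)⟩⟩
  le_antisymm _ _ := le_antisymm'
  le_total := le_total'
  toDecidableLE := Classical.decRel _

instance : IsOrderedAddMonoid (DivMod F) where
  add_le_add_left x y hxy z := by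
    obtain ⟨d, rfl⟩ := mk_surjective x
    obtain ⟨e, rfl⟩ := mk_surjective y
    obtain ⟨f, rfl⟩ := mk_surjective z
    obtain ⟨H, hH, h⟩ := mk_le_mk.1 hxy
    rw [← map_add, ← map_add]
    exact mk_le_mk.2 ⟨H, hH, fun 𝔭 h𝔭 => add_le_add_left (h 𝔭 h𝔭) (f.1 𝔭)⟩

variable (F) in
/-- The class of the divisor of a nonzero element. -/
def ofElem (a : B.Elem) (ha : a ≠ 0) : DivMod F := DivMod.mk F (divisor a ha)

theorem ofElem_le_ofElem {a b : B.Elem} {ha : a ≠ 0} {hb : b ≠ 0} :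
    ofElem F a ha ≤ ofElem F b hb ↔ ∃ H ∈ F.1, ∀ 𝔭 ∈ H, ord 𝔭 a ≤ ord 𝔭 b := mk_le_mk

theorem ofElem_mul {a b : B.Elem} (ha : a ≠ 0) (hb : b ≠ 0) (hab : a * b ≠ 0) :
    ofElem F (a * b) hab = ofElem F a ha + ofElem F b hb := by
  rw [ofElem, ofElem, ofElem, ← map_add]
  refine congrArg _ (Subtype.ext (funext fun 𝔭 => ?_))
  exact ord_mul 𝔭 ha hb

theorem ofElem_one (h : (1 : B.Elem) ≠ 0) : ofElem F 1 h = 0 := by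
  rw [ofElem, ← map_zero (DivMod.mk F)]
  exact congrArg _ (Subtype.ext (funext ord_one))

theorem ofElem_nonneg (a : B.Elem) (ha : a ≠ 0) : 0 ≤ ofElem F a ha := by
  rw [ofElem, ← map_zero (DivMod.mk F), mk_le_mk]
  obtain ⟨H, hH⟩ := F.2.prop.nonempty
  exact ⟨H, hH, fun 𝔭 _ => ord_nonneg 𝔭 a⟩

theorem min_ofElem_le {a b : B.Elem} (ha : a ≠ 0) (hb : b ≠ 0) (hab : a + b ≠ 0) :
    min (ofElem F a ha) (ofElem F b hb) ≤ ofElem F (a + b) hab := by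
  rcases le_total (ofElem F a ha) (ofElem F b hb) with h | h
  · rw [min_eq_left h, ofElem_le_ofElem]
    obtain ⟨H, hH, h⟩ := ofElem_le_ofElem.1 h
    exact ⟨H, hH, fun 𝔭 h𝔭 => min_eq_left (h 𝔭 h𝔭) ▸ le_ord_add 𝔭 ha hb hab⟩
  · rw [min_eq_right h, ofElem_le_ofElem]
    obtain ⟨H, hH, h⟩ := ofElem_le_ofElem.1 h
    exact ⟨H, hH, fun 𝔭 h𝔭 => min_eq_right (h 𝔭 h𝔭) ▸ le_ord_add 𝔭 ha hb hab⟩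

/-- A nonnegative class has a representative that is nonnegative on a member `K` of `ℱ`. Being
hyperfinite, `K` admits an element whose orders on `K` are these values. -/
theorem exists_eq_on {x : DivMod F} (hx : 0 ≤ x) {H : Set B.InternalMax} (hH : H ∈ F.1) :
    ∃ (a : B.Elem) (ha : a ≠ 0), ∃ K ∈ F.1, K ⊆ H ∧ ofElem F a ha = x := by
  obtain ⟨d, rfl⟩ := mk_surjective x
  rw [← map_zero (DivMod.mk F)] at hx
  obtain ⟨K, hK, h⟩ := mk_le_mk.1 hx
  obtain ⟨a, ha, h'⟩ := exists_ord_eq d (F.2.prop.subset hK) h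
  exact ⟨a, ha, K ∩ H, F.2.prop.inter_mem K hK H hH, Set.inter_subset_right,
    mk_eq_mk.2 ⟨K, hK, h'⟩⟩

theorem exists_ofElem_eq {x : DivMod F} (hx : 0 ≤ x) :
    ∃ (a : B.Elem) (ha : a ≠ 0), ofElem F a ha = x := by
  obtain ⟨H, hH⟩ := F.2.prop.nonempty
  obtain ⟨a, ha, -, -, -, h⟩ := exists_eq_on hx hH
  exact ⟨a, ha, h⟩

/-- A nonnegative `x` that does not exceed some `u ∈ U` satisfies `0 ≤ x ≤ u` and lies in `U` by
convexity. So "above `U`" may be replaced by "outside `U`". -/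
theorem forall_lt_iff {U : AddSubgroup (DivMod F)} (hU : IsConvexSubgroup U) {x : DivMod F}
    (hx : 0 ≤ x) : (∀ u ∈ U, u < x) ↔ x ∉ U :=
  ⟨fun h hxU => lt_irrefl x (h x hxU), fun h u hu => not_le.1 fun hxu => h (hU u hu x hx hxu)⟩

/-- A subgroup is determined by its nonnegative elements, and only these are classes of elements of
`B`. -/
theorem exists_nonneg_notMem {U W : AddSubgroup (DivMod F)} (h : ¬ U ≤ W) :
    ∃ x, 0 ≤ x ∧ x ∈ U ∧ x ∉ W := by
  obtain ⟨x, hx, hx'⟩ := SetLike.not_le_iff_exists.1 h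
  rcases le_total 0 x with h0 | h0
  · exact ⟨x, h0, hx, hx'⟩
  · exact ⟨-x, neg_nonneg.2 h0, neg_mem hx, fun h => hx' (neg_mem_iff.1 h)⟩

end DivMod

open DivMod

/-! ### The prime ideal of a convex subgroup -/

/-- The prime ideal of elements with divisors greater than all elements of a convex subgroup. -/
def idealOfPair (p : B.FilterConvexPair) : Ideal B.Elem where
  carrier := {a | ∀ ha : a ≠ 0, ofElem p.1 a ha ∉ p.2.1}
  zero_mem' h := absurd rfl h
  add_mem' {a b} ha hb hab := by
    rcases eq_or_ne a 0 with rfl | ha0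
    · simpa using hb (by simpa using hab)
    rcases eq_or_ne b 0 with rfl | hb0
    · simpa using ha ha0
    intro h
    -- One of the two classes is at most that of the sum, so convexity would put it into the
    -- subgroup together with the class of the sum.
    have hmin := min_ofElem_le (F := p.1) ha0 hb0 hab
    rcases min_le_iff.1 hmin with h' | h'
    · exact ha ha0 (p.2.2.1 _ h _ (ofElem_nonneg a ha0) h')
    · exact hb hb0 (p.2.2.1 _ h _ (ofElem_nonneg b hb0) h')
  smul_mem' c a ha hca h := by
    have ha0 : a ≠ 0 := fun h => hca (by rw [h, smul_zero])
    have hc0 : c ≠ 0 := fun h => hca (by rw [h, zero_smul])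
    refine ha ha0 (p.2.2.1 _ h _ (ofElem_nonneg a ha0) ?_)
    have := ofElem_mul (F := p.1) hc0 ha0 hca
    exact (le_add_of_nonneg_left (ofElem_nonneg c hc0)).trans_eq this.symm

theorem mem_idealOfPair {p : B.FilterConvexPair} {a : B.Elem} :
    a ∈ idealOfPair p ↔ ∀ ha : a ≠ 0, ofElem p.1 a ha ∉ p.2.1 := Iff.rfl

theorem idealOfPair_isPrime (p : B.FilterConvexPair) : (idealOfPair p).IsPrime := by
  have := isDomain (B := B)
  refine Ideal.isPrime_iff.2 ⟨fun h => ?_, fun {a b} hab => ?_⟩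
  · have h1 : (1 : B.Elem) ∈ idealOfPair p := h ▸ Submodule.mem_top
    refine h1 one_ne_zero ?_
    rw [ofElem_one]
    exact zero_mem _
  · by_contra! h
    obtain ⟨ha, hb⟩ := h
    rw [mem_idealOfPair] at ha hb
    push Not at ha hb
    obtain ⟨ha0, ha⟩ := ha
    obtain ⟨hb0, hb⟩ := hb
    refine hab (mul_ne_zero ha0 hb0) ?_
    rw [ofElem_mul ha0 hb0]
    exact add_mem ha hb

theorem idealOfPair_ne_bot (p : B.FilterConvexPair) : idealOfPair p ≠ ⊥ := by
  intro h
  obtain ⟨x, hx, -, hxU⟩ := exists_nonneg_notMem (U := ⊤) (W := p.2.1)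
    fun h => p.2.2.2 (top_le_iff.1 h)
  obtain ⟨a, ha, rfl⟩ := exists_ofElem_eq hx
  have : a ∈ idealOfPair p := fun _ => hxU
  rw [h] at this
  exact ha this

/-- Suppose `H` is a member of the first filter only, and let `K` be a member of the second disjoint
from `H`. For `c` in the common ideal whose class lies outside the first subgroup, split `e + f = 1`
along `H`. Then `e` is in the ideal since it dominates `c` on `H`, and `f` since it dominates `c` on
`K`; so `1` is in the ideal. -/
theorem subset_of_idealOfPair_eq {p q : B.FilterConvexPair} (h : idealOfPair p = idealOfPair q) :
    p.1.1 ⊆ q.1.1 := by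
  have hp := p.1.2.prop
  intro H hH
  by_contra hHq
  obtain ⟨K, hK, hKH⟩ := q.1.exists_disjoint (hp.subset hH) hHq
  obtain ⟨x, hx, -, hxU⟩ := exists_nonneg_notMem (U := ⊤) (W := p.2.1)
    fun h => p.2.2.2 (top_le_iff.1 h)
  obtain ⟨c, hc, rfl⟩ := exists_ofElem_eq hx
  have hcp : c ∈ idealOfPair p := fun _ => hxU
  obtain ⟨e, f, hef, key⟩ := exists_idempotent_mod hc (hp.subset hH)
  have he : e ∈ idealOfPair p := fun he0 h' =>
    hxU (p.2.2.1 _ h' _ hx (ofElem_le_ofElem.2 ⟨H, hH, fun 𝔭 h𝔭 => (key 𝔭).1 h𝔭 he0⟩))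
  have hf : f ∈ idealOfPair q := fun hf0 h' => by
    rw [h] at hcp
    refine hcp hc (q.2.2.1 _ h' _ (ofElem_nonneg c hc) (ofElem_le_ofElem.2 ⟨K, hK, fun 𝔭 h𝔭 => ?_⟩))
    refine (key 𝔭).2 (fun h𝔭H => ?_) hf0
    have : 𝔭 ∈ K ∩ H := ⟨h𝔭, h𝔭H⟩
    rw [hKH] at this
    exact this
  rw [← h] at hf
  exact (idealOfPair_isPrime p).ne_top ((Ideal.eq_top_iff_one _).2 (hef ▸ Ideal.add_mem _ he hf))

/-- For a fixed filter the nonnegative part of the subgroup consists of the classes of nonzero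
elements outside the ideal. -/
theorem le_of_idealOfPair_eq {F : B.MaximalFilter}
    {U W : {U : AddSubgroup (DivMod F) // IsConvexSubgroup U ∧ U ≠ ⊤}}
    (h : idealOfPair ⟨F, U⟩ = idealOfPair ⟨F, W⟩) : U.1 ≤ W.1 := by
  by_contra hle
  obtain ⟨x, hx, hxU, hxW⟩ := exists_nonneg_notMem hle
  obtain ⟨a, ha, rfl⟩ := exists_ofElem_eq hx
  have : a ∈ idealOfPair ⟨F, W⟩ := fun _ => hxW
  rw [← h] at this
  exact this ha hxU

theorem idealOfPair_injective : Function.Injective (idealOfPair (B := B)) := by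
  rintro ⟨F, U⟩ ⟨G, W⟩ h
  obtain rfl : F = G := Subtype.ext
    ((subset_of_idealOfPair_eq h).antisymm (subset_of_idealOfPair_eq h.symm))
  obtain rfl : U = W := Subtype.ext
    (le_antisymm (le_of_idealOfPair_eq h) (le_of_idealOfPair_eq h.symm))
  rfl

/-! ### The convex subgroup of a prime ideal -/

/-- The hyperfinite sets outside of which some element not in `𝔮` is divisible by `c`. -/
def filterOf (𝔮 : Ideal B.Elem) (c : B.Elem) : Set (Set B.InternalMax) :=
  {H | H ∈ B.hyperfiniteSubsets ∧ ∃ s ∉ 𝔮, ∀ 𝔭 ∉ H, ord 𝔭 c ≤ ord 𝔭 s}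

variable {𝔮 : Ideal B.Elem} {c : B.Elem}

/-- The support of `c` is a member with `s = 1`. Two members intersect in a member because the
product of their witnesses is outside the prime `𝔮`. If `∅` were a member, `c` would divide some `s
∉ 𝔮`. -/
theorem isProperFilter_filterOf (h𝔮 : 𝔮.IsPrime) (hc : c ∈ 𝔮) (hc0 : c ≠ 0) :
    B.IsProperFilter (filterOf 𝔮 c) := by
  have hne : ∀ {s}, s ∉ 𝔮 → s ≠ 0 := fun hs h => hs (h ▸ 𝔮.zero_mem)
  refine ⟨fun H hH => hH.1, ?_, ?_, ?_, ?_⟩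
  · refine ⟨_, support_mem_hyperfiniteSubsets hc0, 1,
      fun h => h𝔮.ne_top ((Ideal.eq_top_iff_one _).2 h), fun 𝔭 h𝔭 => ?_⟩
    rw [not_not.1 h𝔭]
    exact ord_nonneg 𝔭 1
  · rintro H ⟨hH, s, hs, h⟩ K ⟨hK, t, ht, h'⟩
    refine ⟨inter_mem_hyperfiniteSubsets hH hK, s * t,
      fun hst => (h𝔮.mem_or_mem hst).elim hs ht, fun 𝔭 h𝔭 => ?_⟩
    rw [ord_mul 𝔭 (hne hs) (hne ht)]
    by_cases h𝔭H : 𝔭 ∈ H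
    · exact (h' 𝔭 fun h𝔭K => h𝔭 ⟨h𝔭H, h𝔭K⟩).trans (le_add_of_nonneg_left (ord_nonneg 𝔭 s))
    · exact (h 𝔭 h𝔭H).trans (le_add_of_nonneg_right (ord_nonneg 𝔭 t))
  · rintro H ⟨hH, s, hs, h⟩ K hK hHK
    exact ⟨hK, s, hs, fun 𝔭 h𝔭 => h 𝔭 fun h' => h𝔭 (hHK h')⟩
  · intro h
    obtain ⟨-, s, hs, h'⟩ : ∅ ∈ filterOf 𝔮 c := h ▸ empty_mem_hyperfiniteSubsets
    exact hs (𝔮.mem_of_dvd (dvd_of_ord_le hc0 (hne hs) fun 𝔭 => h' 𝔭 (Set.notMem_empty 𝔭)) hc)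

/-- Let `H` belong to a larger proper filter and split `e + f = 1` along `H`. If `f ∉ 𝔮`, then `f`
witnesses that `H` is already a member. Otherwise `e ∉ 𝔮`, and `e` witnesses that the support of `c`
minus `H` is a member; its intersection with `H` is empty, which is impossible in a proper filter.
-/
theorem maximal_filterOf (h𝔮 : 𝔮.IsPrime) (hc : c ∈ 𝔮) (hc0 : c ≠ 0) :
    Maximal B.IsProperFilter (filterOf 𝔮 c) := by
  have hne : ∀ {s}, s ∉ 𝔮 → s ≠ 0 := fun hs h => hs (h ▸ 𝔮.zero_mem)
  refine ⟨isProperFilter_filterOf h𝔮 hc hc0, fun G hG hle H hH => ?_⟩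
  have hHL := hG.subset hH
  obtain ⟨e, f, hef, key⟩ := exists_idempotent_mod hc0 hHL
  by_cases hf : f ∈ 𝔮
  · have he : e ∉ 𝔮 := fun he => h𝔮.ne_top
      ((Ideal.eq_top_iff_one _).2 (hef ▸ 𝔮.add_mem he hf))
    have hsupp := support_mem_hyperfiniteSubsets hc0
    have hmem : {𝔭 : B.InternalMax | ord 𝔭 c ≠ 0} \ H ∈ filterOf 𝔮 c := by
      refine ⟨diff_mem_hyperfiniteSubsets hsupp hHL, e, he, fun 𝔭 h𝔭 => ?_⟩
      by_cases h𝔭H : 𝔭 ∈ H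
      · exact (key 𝔭).1 h𝔭H (hne he)
      · have h0 : ord 𝔭 c = 0 := by
          by_contra h0
          exact h𝔭 ⟨h0, h𝔭H⟩
        rw [h0]
        exact ord_nonneg 𝔭 e
    have := hG.inter_mem _ (hle hmem) _ hH
    rw [Set.sdiff_inter_self] at this
    exact absurd this hG.empty_notMem
  · exact ⟨hHL, f, hf, fun 𝔭 h𝔭 => (key 𝔭).2 h𝔭 (hne hf)⟩

/-- Dominating `c * a` is more than dominating `c`, so one filter contains the other, and maximality
makes them equal. Hence `c` may be enlarged by any nonzero factor. -/
theorem filterOf_mul (h𝔮 : 𝔮.IsPrime) (hc : c ∈ 𝔮) (hc0 : c ≠ 0) {a : B.Elem} (ha0 : a ≠ 0) :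
    filterOf 𝔮 (c * a) = filterOf 𝔮 c := by
  have := isDomain (B := B)
  refine (maximal_filterOf h𝔮 (𝔮.mul_mem_right a hc) (mul_ne_zero hc0 ha0)).eq_of_le
    (isProperFilter_filterOf h𝔮 hc hc0) ?_
  rintro H ⟨hH, s, hs, h⟩
  refine ⟨hH, s, hs, fun 𝔭 h𝔭 => le_trans ?_ (h 𝔭 h𝔭)⟩
  rw [ord_mul 𝔭 hc0 ha0]
  exact le_add_of_nonneg_right (ord_nonneg 𝔭 a)

/-- The elements bounded by divisors of elements not in `𝔮`. -/
def subgroupOf (F : B.MaximalFilter) (h𝔮 : 𝔮.IsPrime) : AddSubgroup (DivMod F) where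
  carrier := {x | ∃ s, s ∉ 𝔮 ∧ ∃ hs : s ≠ 0, x ≤ ofElem F s hs ∧ -x ≤ ofElem F s hs}
  zero_mem' := by
    have := isDomain (B := B)
    refine ⟨1, fun h => h𝔮.ne_top ((Ideal.eq_top_iff_one _).2 h), one_ne_zero, ?_⟩
    rw [neg_zero, and_self]
    exact ofElem_nonneg _ _
  add_mem' := by
    have := isDomain (B := B)
    rintro x y ⟨s, hs, hs0, h1, h2⟩ ⟨t, ht, ht0, h3, h4⟩
    refine ⟨s * t, fun h => (h𝔮.mem_or_mem h).elim hs ht, mul_ne_zero hs0 ht0, ?_⟩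
    rw [ofElem_mul hs0 ht0, neg_add]
    exact ⟨add_le_add h1 h3, add_le_add h2 h4⟩
  neg_mem' := by
    rintro x ⟨s, hs, hs0, h1, h2⟩
    exact ⟨s, hs, hs0, h2, by rwa [neg_neg]⟩

/-- Suppose `a ∈ 𝔮` and the class of `a` is at most that of `s ∉ 𝔮`, say on `H ∈ ℱ`. Off `H` some `t
∉ 𝔮` dominates `a`. Then `a` divides `s * t` by orders, although `s * t ∉ 𝔮`. -/
theorem ofElem_mem_subgroupOf_iff {F : B.MaximalFilter} (h𝔮 : 𝔮.IsPrime) (hc : c ∈ 𝔮)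
    (hc0 : c ≠ 0) (hF : F.1 = filterOf 𝔮 c) {a : B.Elem} (ha0 : a ≠ 0) :
    ofElem F a ha0 ∈ subgroupOf F h𝔮 ↔ a ∉ 𝔮 := by
  have hne : ∀ {s}, s ∉ 𝔮 → s ≠ 0 := fun hs h => hs (h ▸ 𝔮.zero_mem)
  constructor
  · rintro ⟨s, hs, hs0, h, -⟩ ha
    obtain ⟨H, hH, h⟩ := ofElem_le_ofElem.1 h
    -- The defining condition of the filter bounds `c` only; passing to `c * a` gives a witness `t`
    -- that also dominates `a` off `H`.
    rw [hF, ← filterOf_mul h𝔮 hc hc0 ha0] at hH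
    obtain ⟨hHL, t, ht, h'⟩ := hH
    have hst : s * t ∉ 𝔮 := fun h => (h𝔮.mem_or_mem h).elim hs ht
    refine hst (𝔮.mem_of_dvd (dvd_of_ord_le ha0 (hne hst) fun 𝔭 => ?_) ha)
    rw [ord_mul 𝔭 hs0 (hne ht)]
    by_cases h𝔭 : 𝔭 ∈ H
    · exact (h 𝔭 h𝔭).trans (le_add_of_nonneg_right (ord_nonneg 𝔭 t))
    · have h1 := h' 𝔭 h𝔭
      rw [ord_mul 𝔭 hc0 ha0] at h1
      exact ((le_add_of_nonneg_left (ord_nonneg 𝔭 c)).trans h1).trans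
        (le_add_of_nonneg_left (ord_nonneg 𝔭 s))
  · intro ha
    exact ⟨a, ha, ha0, le_rfl, (neg_nonpos.2 (ofElem_nonneg a ha0)).trans (ofElem_nonneg a ha0)⟩

theorem isConvexSubgroup_subgroupOf (F : B.MaximalFilter) (h𝔮 : 𝔮.IsPrime) :
    IsConvexSubgroup (subgroupOf F h𝔮) := by
  rintro x ⟨s, hs, hs0, h, -⟩ y hy0 hyx
  exact ⟨s, hs, hs0, hyx.trans h, (neg_nonpos.2 hy0).trans (ofElem_nonneg s hs0)⟩

theorem exists_idealOfPair_eq (h0 : 𝔮 ≠ ⊥) (h𝔮 : 𝔮.IsPrime) :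
    ∃ p : B.FilterConvexPair, idealOfPair p = 𝔮 := by
  obtain ⟨c, hc, hc0⟩ := Submodule.exists_mem_ne_zero_of_ne_bot h0
  let F : B.MaximalFilter := ⟨filterOf 𝔮 c, maximal_filterOf h𝔮 hc hc0⟩
  have key : ∀ {a : B.Elem} (ha0 : a ≠ 0), ofElem F a ha0 ∈ subgroupOf F h𝔮 ↔ a ∉ 𝔮 :=
    fun ha0 => ofElem_mem_subgroupOf_iff h𝔮 hc hc0 rfl ha0
  have hne : subgroupOf F h𝔮 ≠ ⊤ := fun h => (key hc0).1 (h ▸ AddSubgroup.mem_top _) hc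
  refine ⟨⟨F, subgroupOf F h𝔮, isConvexSubgroup_subgroupOf F h𝔮, hne⟩, ?_⟩
  ext a
  refine mem_idealOfPair.trans ⟨fun h => ?_, fun ha ha0 h => (key ha0).1 h ha⟩
  rcases eq_or_ne a 0 with rfl | ha0
  · exact 𝔮.zero_mem
  · by_contra ha
    exact h ha0 ((key ha0).2 ha)

variable (B) in
/-- The pairs of maximal filters and proper convex subgroups correspond to the nonzero prime
ideals. -/
def pairEquiv : B.FilterConvexPair ≃ {𝔭 : Ideal B.Elem // 𝔭 ≠ ⊥ ∧ 𝔭.IsPrime} :=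
  Equiv.ofBijective (fun p => ⟨idealOfPair p, idealOfPair_ne_bot p, idealOfPair_isPrime p⟩)
    ⟨fun _ _ h => idealOfPair_injective (congrArg Subtype.val h), fun ⟨_, h0, h𝔮⟩ => by
      obtain ⟨p, hp⟩ := exists_idealOfPair_eq h0 h𝔮
      exact ⟨p, Subtype.ext hp⟩⟩

/-- For `a ≠ 0` the divisor of `a` exists and is unique by `isDivisorOf_iff`, and lying above the
subgroup amounts to lying outside it because the class is nonnegative. -/
theorem mem_pairEquiv_iff (p : B.FilterConvexPair) (a : B.Elem) : a ∈ (B.pairEquiv p).1 ↔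
    a = 0 ∨ ∃ d : B.WeilDiv, IsDivisorOf a d ∧ ∀ u ∈ p.2.1, u < DivMod.mk p.1 d := by
  rcases eq_or_ne a 0 with rfl | ha
  · exact iff_of_true (Ideal.zero_mem _) (Or.inl rfl)
  · refine Iff.trans (b := ofElem p.1 a ha ∉ p.2.1) ⟨fun h => h ha, fun h _ => h⟩ ?_
    rw [← forall_lt_iff p.2.2.1 (ofElem_nonneg a ha)]
    simp only [ha, false_or, isDivisorOf_iff ha, exists_eq_left, ofElem]

end InternalDedekindRing

end Nonstandard

end

/-! ### The main theorem -/

theorem mainTheorem6 {S T : ZFSet.{u}} (E : Nonstandard.NonstandardEmbedding S T)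
    (B : Nonstandard.InternalDedekindRing E)
    (L : Type w) [Field L] [Algebra B.Elem L] [IsFractionRing B.Elem L] :
    ∃ (e₁ : {𝔭 : Ideal B.Elem // 𝔭 ≠ ⊥ ∧ 𝔭.IsPrime} ≃
          Nonstandard.CenteredValuationClass B.Elem L)
      (e₂ : {𝔭 : Ideal B.Elem // 𝔭 ≠ ⊥ ∧ 𝔭.IsPrime} ≃ B.FilterConvexPair),
      (∀ (𝔭 : {𝔭 : Ideal B.Elem // 𝔭 ≠ ⊥ ∧ 𝔭.IsPrime})
        (v : Nonstandard.CenteredValuation B.Elem L), Quotient.mk _ v = e₁ 𝔭 →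
          (∀ x : L, v.v x ≤ 1 ↔
            ∃ a s : B.Elem, s ∉ 𝔭.1 ∧ x = algebraMap B.Elem L a / algebraMap B.Elem L s) ∧
          ∀ a : B.Elem, v.v (algebraMap B.Elem L a) < 1 ↔ a ∈ 𝔭.1) ∧
      ∀ (p : B.FilterConvexPair) (a : B.Elem),
        a ∈ (e₂.symm p).1 ↔
          a = 0 ∨ ∃ d : B.WeilDiv, Nonstandard.InternalDedekindRing.IsDivisorOf a d ∧
            ∀ u ∈ p.2.1, u < Nonstandard.InternalDedekindRing.DivMod.mk p.1 d := by
  obtain ⟨e₁, he₁⟩ := Nonstandard.exists_equiv_centeredValuationClass (B := B.Elem) (L := L)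
    Nonstandard.InternalDedekindRing.exists_add_eq_one_mul_eq_mul
  exact ⟨e₁, B.pairEquiv.symm, he₁, fun p a =>
    Nonstandard.InternalDedekindRing.mem_pairEquiv_iff p a⟩
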